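/- **Setting.** Let $d\ge 2$, let $l\in\{1,\dots,d\}$, $m,j\in\{1,\dots,d-1\}$; "$l\ne d-1$" means $l\in\{1,\dots,d-2,d\}$. Given are functions $I_l,\Gamma,B_{lijm},H_{jm},F_m,E_{m00j},E_{m10j},E_{m01j},G_{\phi,l},G_v,G_{w,m}\in W^{1,\infty}((0,1)^d)$ ($i,j\in\{0,1\}$ in $B_{lijm}$, $j\in\{0,1\}$ in $H_{jm}$), identified with their continuous representatives; the same letter without argument denotes a positive constant bounding the sup norms of the function and of its first partial derivatives. Given are constants $\delta_l,D_m,\gamma_m>0$, $A_m\in\mathbb R$, $\hat J_l$, $\phi_{l,res}$, $\phi_{l0}$, $\phi_{\min}$, $t_0$. Put $\mathcal L(f)=\max(f,0)$, $\|\cdot\|=\|\cdot\|_{L^2(0,1)}$, $C_\infty=\sqrt2$, $\Gamma_\alpha=\inf_{\mathcal I_\alpha^d}\Gamma$, $H_\alpha=\min_m\inf_{\mathcal I_\alpha^d}H_{1m}$ with $\mathcal I_\alpha=(\alpha,1-(d-1)\alpha)$. **Discretised system.** For $\Delta t>0$, $t_k=t_0+k\Delta t$, $\mathcal D^k(u)=(u^k-u^{k-1})/\Delta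 t$, a solution up to $T$ consists of $\phi^k_l,w^k_m\in H^2(0,1)$, $v^k\in H^1(0,1)$, $\mathcal W^k\in\mathbb R$ for $t_k\le T$ with $\phi^0_l=\phi_{l0}$, $w_m^0=0$, $\mathcal W^0=0$, $v^0$ the initial velocity below, and for $k\ge1$, a.e. in $(0,1)$, $\sum_l\phi_l^k=1$, $$\mathcal D^k(\phi_l)-\delta_l\partial_z^2\phi_l^k+I_l(\phi^{k-1})\partial_z(\Gamma(\phi^{k-1})v^{k-1})+\sum_{m}\sum_{i=0}^1\partial_z^i\big(B_{li0m}(\phi^{k-1})w_m^{k-1}+B_{li1m}(\phi^{k-1})\mathcal D^k(w_m)\big)=G_{\phi,l}(\phi^{k-1})\quad(l\ne d-1),$$ $$\partial_z(\Gamma(\phi^{k-1})v^k)+\sum_m\partial_z\big(H_{0m}(\phi^{k-1})w_m^{k-1}+H_{1m}(\phi^{k-1})\mathcal D^k(w_m)\big)=G_v(\phi^{k-1}),$$ $$\mathcal D^k(w_m)-D_m\partial_z^2w_m^k-\gamma_m\partial_z^2\mathcal D^k(w_m)+F_m(\phi^{k-1})v^{k-1}+\sum_j\Big[\sum_{i=0}^1\partial_z\big(E_{mi0j}(\phi^{k-1})\partial_z^iw_j^{k-1}\big)+\partial_z\big(E_{m01j}(\phi^{k-1})\mathcal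 D^k(w_j)\big)\Big]=G_{w,m}(\phi^{k-1}),$$ with $\partial_z\phi_l^k=0$ at $z=0,1$ ($l\neq d-1$), $H_{1m}(\phi^{k-1})\mathcal D^k(w_m)=\hat J_m\mathcal L(\phi_{m,res}-\phi_m^{k-1})$ at $z=0$, $\partial_zw_m^k=A_m(w_m^k-\mathcal W^k)$ at $z=1$, $v^k(0)=0$, and $\Gamma(\phi^{k-1})(\mathcal D^k(\mathcal W)-v^{k-1})=\hat J_d\mathcal L(\phi_{d,res}-\phi_d^{k-1})$ at $z=1$. An *initial velocity* is $v^0\in H^1(0,1)$ for which there are $u_m\in H^2(0,1)$, $\beta\in\mathbb R$ with, at $\phi^0=(\phi_{l0})_l$: $\partial_z(\Gamma v^0)+\sum_m\partial_z(H_{1m}u_m)=G_v$, $u_m-\gamma_m\partial_z^2u_m+F_mv^0+\sum_j\partial_z(E_{m01j}u_j)=G_{w,m}$, $H_{1m}u_m(0)=\hat J_m\mathcal L(\phi_{m,res}-\phi_{m0})$, $\partial_zu_m(1)=A_m(u_m(1)-\beta)$, $v^0(0)=0$, $\Gamma(\beta-v^0(1))=\hat J_d\mathcal L(\phi_{d,res}-\phi_{d0})$.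 **Constants.** Write $f_m=\hat J_m\phi_{m,res}/H_{\phi_{\min}}$, $f_d=\hat J_d\phi_{d,res}/\Gamma_{\phi_{\min}}$, $\mathcal M_{m00j}=E_{m00j}$, $\mathcal M_{m10j}=E_{m10j}(1+|A_j|)+E_{m00j}$, $\mathcal M_{m01j}=E_{m01j}$, $\mathcal M_{m11j}=E_{m01j}+\delta_{mj}\gamma_m|A_m|$ ($\delta_{mj}$ Kronecker), $\mathcal M_{mm}=D_m|A_m|$, $\mathcal M_{vm}=\gamma_m|A_m|$, $\mathcal N_{m0}=G_{w,m}f_m$, $\mathcal N_{m1}=F_mf_m$, $\mathcal N_{m2}=f_m$ and $$\mathcal M_m(x,y)=\sum_j\big[E_{m10j}|A_j|(f_jx+y\sqrt x+f_dx)+2E_{m00j}f_jx+2E_{m01j}f_j\big]+D_m|A_m|(f_mx+y\sqrt x+f_dx)+\gamma_m|A_m|(f_m+f_d).$$ Let $\eta$ be a family of positive parameters $\eta_{\rm index}$ and set $K_{w0}(x,y)=\sum_m\big[\tfrac{G_{w,m}^2}2(\tfrac1{\eta_{1m}}+\tfrac1{\eta_{2m}})+\mathcal N_{m0}(1+x)+\tfrac{\mathcal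 N_{m1}^2}2(\tfrac1{\eta_{\mathcal Nm11}}+\tfrac x{\eta_{\mathcal Nm12}})+\tfrac{\mathcal N_{m2}^2}2(\tfrac1{\eta_{\mathcal Nm21}}+\tfrac x{\eta_{\mathcal Nm22}})+\tfrac{\mathcal M_m(x,y)^2}2(\tfrac1{\eta_{\mathcal Mm1}}+\tfrac1{\eta_{\mathcal Mm2}})\big]$, $K_{w1m}=\tfrac12(\eta_{1m}+\eta_{Lm1})$, $K_{w2m}=\tfrac12\eta_{\mathcal Mm1}+\tfrac12\sum_j\sum_{i}(\eta_{\mathcal Mmi0j0}+\eta_{\mathcal Mmi1j0})+\tfrac12\eta_{\mathcal Mmm}+\tfrac{\mathcal M_{vm}^2}{2\eta_{\mathcal Mvm1}}+\mathcal M_{mm}-D_m$, $K_{w3m}=\sum_j\big[\tfrac{\mathcal M_{j00m}^2}{2\eta_{\mathcal Mj00m0}}+\tfrac12\mathcal M_{j00m}\eta_{\mathcal Mj00m1}\big]$, $K_{w4m}=\sum_j\big[\tfrac{\mathcal M_{j10m}^2}{2\eta_{\mathcal Mj10m0}}+\tfrac12\mathcal M_{j10m}\eta_{\mathcal Mj10m1}\big]$,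 $K_{w5m}=\tfrac12(\eta_{2m}+\eta_{Lm2}+\eta_{\mathcal Nm21}+\eta_{\mathcal Nm22})+\sum_j\big[\tfrac{\mathcal M_{j01m}^2}{2\eta_{\mathcal Mj01m0}}+\tfrac12\mathcal M_{j01m}\eta_{\mathcal Mj01m1}\big]$, $K_{w6m}=\tfrac12\eta_{\mathcal Mm2}+\tfrac{\mathcal M_{mm}^2}{2\eta_{\mathcal Mmm}}+\tfrac{\mathcal M_{vm}^2}{2\eta_{\mathcal Mvm2}}+\sum_j\big[\tfrac{\mathcal M_{m01j}}{2\eta_{\mathcal Mm01j1}}+\sum_i\tfrac{\mathcal M_{mi0j}}{2\eta_{\mathcal Mmi0j1}}+\tfrac{\mathcal M_{j11m}^2}{2\eta_{\mathcal Mj11m0}}+\tfrac12\mathcal M_{m11j}\eta_{\mathcal Mm11j1}+\tfrac{\mathcal M_{j11m}}{2\eta_{\mathcal Mj11m1}}\big]$, $K_{w7}=\sum_m\tfrac{F_m^2}2(\tfrac1{\eta_{Lm1}}+\tfrac1{\eta_{Lm2}})$, $K_{w8}=\tfrac12\sum_m(\eta_{\mathcal Nm11}+\eta_{\mathcal Nm12}+\eta_{\mathcal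 Mvm1}+\eta_{\mathcal Mvm2})$, $K_{w78}=K_{w7}+K_{w8}$. With indices $l,n,r$ running over values $\ne d-1$: $K_{a\phi0}=\max_l\tfrac{G_{\phi,l}^2}{\eta_{agl}}$, $K_{b\phi0}=\sum_l\tfrac{G_{\phi,l}^2}{\delta_l^2\eta_{bgl}}$, $K_{a\phi1}=\max_l\big[\tfrac{I_l^2\Gamma^2}{\eta_{al}}+2\sum_n\tfrac{I_l^2\Gamma^2}{\eta_{aln}}\big]$, $K_{b\phi1}=\sum_l\tfrac{I_l^2\Gamma^2}{\delta_l^2\eta_{bl}}$, $K_{a\phi2l}=\eta_{al}+\eta_{agl}+\sum_m\sum_{i,j\in\{0,1\}}\eta_{alijm}$, $K_{b\phi2l}=\eta_{bl}+\eta_{bgl}+\sum_m\sum_{i,j\in\{0,1\}}\eta_{blijm}+2\sum_n[\eta_{bln}+\sum_m(\eta_{bl10mn}+\eta_{bl11mn})]$, $K_{a\phi3ln}=2[\eta_{aln}+\sum_m(\eta_{al10mn}+\eta_{al11mn})]$, $K_{a\phi4m}=\max_l\big[\tfrac{B_{l00m}^2}{\eta_{al00m}}+2\sum_n\tfrac{B_{l10m}^2}{\eta_{al10mn}}\big]$,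 $K_{a\phi5m}=\max_l\tfrac{B_{l10m}^2}{\eta_{al10m}}$, $K_{a\phi6m}=\max_l\big[\tfrac{B_{l01m}^2}{\eta_{al01m}}+2\sum_n\tfrac{B_{l11m}^2}{\eta_{al11mn}}\big]$, $K_{a\phi7m}=\max_l\tfrac{B_{l11m}^2}{\eta_{al11m}}$, $K_{b\phi4m},K_{b\phi5m},K_{b\phi6m},K_{b\phi7m}=\sum_l\tfrac{B_{lijm}^2}{\delta_l^2\eta_{blijm}}$ for $(i,j)=(0,0),(1,0),(0,1),(1,1)$ respectively, $K_{\phi3l1}=2\sum_n\tfrac{I_n^2\Gamma^2C_\infty^2}{\delta_n^2\eta_{bnl}}$, $K_{\phi3l2m}=2\sum_n\tfrac{B_{n11m}^2C_\infty^2}{\delta_l^2\eta_{bn11ml}}$, $K_{\phi3l3m}=2\sum_n\tfrac{B_{n10m}^2C_\infty^2}{\delta_l^2\eta_{bn10ml}}$, $K_{\phi3l4}=\sum_m\tfrac{K_{\phi3l2m}+K_{\phi3l3m}}{\min\{1-K_{w5m},\gamma_m-K_{w6m}\}}$. Put $B=2\max_m\{K_{w1m},\tfrac{K_{w2m}}{\gamma_m+D_m}\}$,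 $C=2\max_m\{K_{w3m},\tfrac{K_{w4m}}{\gamma_m+D_m}\}$, $\kappa=\min_m\{1-K_{w5m},\gamma_m-K_{w6m}\}$, for $x\in\{a,b\}$ $K_{x,45}=\max_m\{K_{x\phi4m},\tfrac{K_{x\phi5m}}{\gamma_m+D_m}\}$, $K_{x,67}=\max_m\{\tfrac{K_{x\phi6m}}{1-K_{w5m}},\tfrac{K_{x\phi7m}}{\gamma_m-K_{w6m}}\}$, $D_a=\max_lK_{a\phi2l}$, $$\hat C^2(x,y)=\Big(K_{w78}y^2+K_{w0}(x,y)\tfrac{C+1.6838B}{C+B}x\Big)e^{(C+1.6838B)x},\qquad \tilde C^2=\hat C^2/\kappa,$$ $c_b=K_{b\phi0}x+K_{b\phi1}y^2+K_{b,45}\tilde C^2x+K_{b,67}\tilde C^2$, $D_b=\max_l\{2K_{\phi3l1}y^2+K_{\phi3l4}\tilde C^2\}$, $X=c_be^{D_b}$, $A_a=K_{a\phi0}+X\max_{l,n}K_{a\phi3ln}+K_{a,45}\tilde C^2$, $Z_a=K_{a\phi1}y^2+K_{a,67}\tilde C^2$ (functions of $(x,y)$), $\hat c_b=K_{b\phi1}+\tfrac{K_{b,67}}\kappa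 K_{w78}$, $\hat D_b=\max_l\{2K_{\phi3l1}+\tfrac{K_{\phi3l4}}\kappa K_{w78}\}$, $\hat Z_a=K_{a\phi1}+\tfrac{K_{a,67}}\kappa K_{w78}$, $\hat{\mathcal P}=5+2dK_{w78}$. For $j\neq d-1$ let $p_j(x,y)=(\phi_{j0}^2+Z_a+1.6838A_ax)e^{1.6838D_ax}$, let $$\mathcal P(x,y)=\big(\phi_{(d-1)0}^2+(2C_\infty^2+1)y^2+2d\hat C^2+1.6838\,a\,x\big)e^{1.6838\,b\,x}+(d-1)X,$$ $b=(4(d-1)X+1)(\sum_lI_l\Gamma)^2+2+\sum_{l}\sum_m\big(\tfrac{B_{l01m}^2}{1-K_{w5m}}+\tfrac{B_{l11m}^2}{\gamma_m-K_{w6m}}\big)$, $a=(\sum_lG_{\phi,l})^2+\hat C^2\sum_m\big[(\sum_lB_{l00m})^2+\tfrac{(\sum_lB_{l10m})^2}{\gamma_m+D_m}+(\sum_lB_{l10m})^2\big]+X\big[4(d-1)\big(1+\sum_l\sum_m\tfrac{B_{l11m}^2}{1-K_{w5m}}\big)+d-1+\sum_l\delta_l^2\big]$ (sums over $l\ne d-1$),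 and for $r\in\{1,\dots,d\}$ let $P_r=\sum_{j\ne r,d-1}p_j+X$ if $r=d-1$ and $P_r=\sum_{j\ne r,d-1}p_j+X+\mathcal P$ if $r\ne d-1$. With $\rho=\frac12\big(\frac{1-\phi_{\min}}{C_\infty}\big)^2$ and $Q_0=\|\partial_zv^0\|^2$, $$S=\{(x,y)\in(0,\infty)^2: P_r(x,y)<\rho\ \ \forall r\},\qquad \mathcal R=\{(x,y)\in(0,\infty)^2: Q_H(x,y)<y^2\},$$ $$Q_h(x,y)=Q_0h+\tfrac{4d-2}{\Gamma_{\phi_{\min}}^2}\Big[8\Gamma^2C_\infty^2(d-1)Xy^2+G_v^2x+x\max_m\big\{\tfrac{H_{0m}^2}{\gamma_m+D_m},4(d-1)C_\infty^2H_{0m}^2X\big\}\hat C^2+\max_m\big\{\tfrac{H_{1m}^2}{\gamma_m-K_{w6m}},\tfrac{4(d-1)C_\infty^2H_{1m}^2X}{1-K_{w5m}}\big\}\hat C^2\Big].$$ $Q_1=\tfrac{4d-2}{\Gamma_{\phi_{\min}}^2}\max_m\{\tfrac{H_{1m}^2}{\gamma_m-K_{w6m}}\}K_{w78}$, $Q_2=\tfrac{(4d-2)(4d-4)}{\Gamma_{\phi_{\min}}^2}C_\infty^2\hat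 c_b\max_m\{2\Gamma^2+\tfrac{H_{1m}^2}{1-K_{w5m}}K_{w78}\}$, $Q_3=\hat D_b$; with $W_0$ the principal product logarithm, $\tilde z=\frac23W_0\big(\frac{3Q_3}{4Q_2}(1-Q_1)\big)$ and $$\tilde y=\Big[\tfrac1{\hat D_b}W_0\Big(\min_{r}\tfrac{(\rho-\sum_{j\ne r}\phi_{j0}^2)\hat D_b}{\Theta_r}\Big)\Big]^{1/2},\quad \Theta_{d-1}=(d-1)\hat Z_a+\hat c_b,\quad \Theta_r=(d-2)\hat Z_a+d\hat c_b+\hat{\mathcal P}\ (r\ne d-1).$$ Call $\eta$ *admissible* if for all $m$ and all $l\neq d-1$: $K_{w5m}<1$, $K_{w6m}<\gamma_m$, $\delta_lK_{b\phi2l}<2$, and $B+C>0$, $Q_1<1$. **Assumptions.** (1) $\hat J_l\ge0$, $\hat J_1=0$, $\phi_{l,res}\in[0,1]$, $\sum_l\phi_{l,res}=1$. (4) $\Gamma_\alpha>0$ and $H_\alpha>0$ for all $0<\alpha<1/d$. (5) $\mathcal M_{m11j}+\mathcal M_{j11m}+\mathcal M_{m01j}\sqrt{\gamma_m}<\frac{2\gamma_m}{d-1}$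 for all $m,j$. (7) $0<\phi_{\min}<1/d$, $\sum_l\phi_{l0}=1$, $\phi_{l0}>\phi_{\min}$ for all $l$, $\sum_{j\ne r}\phi_{j0}^2\le\rho$ for all $r$; $\phi_{\min}<1-\frac{\sqrt{2(d-1)}C_\infty}d$ if $2<d\le5$, and $\phi_{\min}\le\frac1{1+\sqrt{2(d-1)}C_\infty}$ if $d>5$. (9) There are $\theta_m>0$ with $g_m:=\gamma_m-\frac{\mathcal M_{vm}^2}{2\theta_m}-\frac12\sum_j(\mathcal M_{m01j}\sqrt{\gamma_m}+\mathcal M_{m11j}+\mathcal M_{j11m})>0$ for all $m$ and $$\frac{(d-\frac12)(d+3)}{\Gamma_{\phi_{\min}}^2}\Big[\sum_m\Big(\frac{F_m^2}{1-\sum_j\mathcal M_{j01m}/(2\sqrt{\gamma_j})}+\frac{\theta_m}2\Big)\Big]\max_m\frac{H_{1m}^2}{g_m}<1.$$ (6), for given $\eta$, $v^0$ and $H>0$: $H<\min\big\{\frac{(1-Q_1)^2}{4Q_2Q_0},\frac{\tilde y^4Q_2}{Q_0},\frac{Q_2\tilde z^2}{Q_0Q_3^2}(1+\tilde z)e^{\tilde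 z},\frac{0.6838}B,\frac{0.6838}{D_a}\big\}$; if $Q_0=0$, the second entry requires $\tilde y>0$ and the first three entries are read as $+\infty$. **Theorem.** Let (1), (4), (5), (7), (9) hold. Then admissible $\eta$ exist and an initial velocity exists. For every admissible $\eta$, every initial velocity $v^0$ and every $H>0$ satisfying (6) there exist $T$, $V$ and $\mathcal C>0$, independent of $\Delta t$, with $(T-t_0,V)\in S\cap\mathcal R$ (in particular $T>t_0$, $V>0$), such that for every $\Delta t\in(0,H)$ the discretised system has a solution up to $T$ satisfying, for all $k\geq 0$ with $t_k\le T$, all $l\in\{1,\dots,d\}$ and $m\in\{1,\dots,d-1\}$, $$\sum_{j=0}^k\|v^j\|^2\Delta t\le V^2,\quad \sum_{j=0}^k\|\partial_zv^j\|^2\Delta t\le V^2,\quad \phi^k_l(z)\in[\phi_{\min},1-(d-1)\phi_{\min}]\ \ (z\in[0,1]),$$ $$\|\phi_l^k\|_{H^1}\le\mathcal C,\quad \sum_{j=1}^k\|\phi_l^j\|_{H^2}^2\Delta t\le\mathcal C,\quad \sum_{j=1}^k\|\mathcal D^j(\phi_l)\|^2\Delta t\le\mathcal C,\quad \|w_m^k\|_{H^2}\le\mathcal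 C,\quad \sum_{j=1}^k\|\mathcal D^j(w_m)\|_{H^1}^2\Delta t\le\mathcal C.$$ -/

import Mathlib

open MeasureTheory Set
open scoped BigOperators

noncomputable section

namespace Rothe

/-! ### Function spaces on the interval `(0,1)` -/

/-- Spatial derivative of a function on `[0,1]` (one-sided at the two end points). -/
def dz (u : ℝ → ℝ) : ℝ → ℝ := derivWithin u (Icc 0 1)

/-- `∂_z^i` for `i = 0, 1`. -/
def dzPow (i : Fin 2) (u : ℝ → ℝ) : ℝ → ℝ := if i = 0 then u else dz u

/-- `u ∈ H¹(0,1)`, `u` being the continuous representative on `[0,1]`: `u` is absolutely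
continuous and its (almost everywhere defined, equivalently weak) derivative lies in `L²(0,1)`. -/
def MemH1 (u : ℝ → ℝ) : Prop :=
  AbsolutelyContinuousOnInterval u 0 1 ∧ MemLp (dz u) 2 (volume.restrict (Ioo (0 : ℝ) 1))

/-- `u ∈ H²(0,1)`; then `u` is of class `C¹` on `[0,1]` and `dz u` is its derivative everywhere. -/
def MemH2 (u : ℝ → ℝ) : Prop := MemH1 u ∧ MemH1 (dz u)

/-- `‖u‖²` in `L²(0,1)`. -/
def l2sq (u : ℝ → ℝ) : ℝ := ∫ z in (0 : ℝ)..1, (u z) ^ 2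

/-- `‖u‖²` in `H¹(0,1)`. -/
def h1sq (u : ℝ → ℝ) : ℝ := l2sq u + l2sq (dz u)

/-- `‖u‖²` in `H²(0,1)`. -/
def h2sq (u : ℝ → ℝ) : ℝ := h1sq u + l2sq (dz (dz u))

/-- Principal branch of the product logarithm, the inverse of `w ↦ w eʷ` on `[-1, ∞)`. -/
def lambertW0 (x : ℝ) : ℝ := sSup {w : ℝ | -1 ≤ w ∧ w * Real.exp w ≤ x}

/-- Positive part. -/
def posPt (x : ℝ) : ℝ := max x 0

/-! ### Indices

The number of components is `d = n + 2`, so that `d ≥ 2`.  The component `l ∈ {1, …, d}` is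
`l - 1 : Comp n`, the solid `m ∈ {1, …, d-1}` is `m - 1 : Solid n`. -/

abbrev Comp (n : ℕ) := Fin (n + 2)

abbrev Solid (n : ℕ) := Fin (n + 1)

/-- The component `d - 1`, whose evolution equation is replaced by `∑ φ_l = 1`. -/
def compDm1 (n : ℕ) : Comp n := (Fin.last n).castSucc

/-- The component `d` (the fluid). -/
def compD (n : ℕ) : Comp n := Fin.last (n + 1)

/-- The components `l ≠ d - 1`. -/
abbrev Ind (n : ℕ) := {l : Comp n // l ≠ compDm1 n}

/-! ### The data of the system -/

/-- A function in `W^{1,∞}((0,1)^d)`, given by its continuous representative, with a constant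
`bd > 0` that dominates its `W^{1,∞}` norm, that is, the sup norms of the function and of its
partial derivatives (on the convex set `(0,1)^d`, all partial derivatives are bounded by `bd`
if and only if `lip` holds). -/
structure Coeff (n : ℕ) where
  toFun : (Comp n → ℝ) → ℝ
  bd : ℝ
  bd_pos : 0 < bd
  abs_le : ∀ x, (∀ l, x l ∈ Ioo (0 : ℝ) 1) → |toFun x| ≤ bd
  lip : ∀ x y, (∀ l, x l ∈ Ioo (0 : ℝ) 1) → (∀ l, y l ∈ Ioo (0 : ℝ) 1) →
    |toFun x - toFun y| ≤ bd * ∑ l, |x l - y l|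

instance (n : ℕ) : CoeFun (Coeff n) (fun _ => (Comp n → ℝ) → ℝ) := ⟨Coeff.toFun⟩

/-- Coefficients and constants of the system. -/
structure Model (n : ℕ) where
  I : Comp n → Coeff n
  Γ : Coeff n
  /-- `B l i j m` is `B_{lijm}`: `i` space derivatives, `j` time derivatives. -/
  B : Comp n → Fin 2 → Fin 2 → Solid n → Coeff n
  /-- `H j m` is `H_{jm}`. -/
  H : Fin 2 → Solid n → Coeff n
  F : Solid n → Coeff n
  /-- `E0 m i j` is `E_{mi0j}`. -/
  E0 : Solid n → Fin 2 → Solid n → Coeff n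
  /-- `E01 m j` is `E_{m01j}`. -/
  E01 : Solid n → Solid n → Coeff n
  Gφ : Comp n → Coeff n
  Gv : Coeff n
  Gw : Solid n → Coeff n
  δ : Comp n → ℝ
  D : Solid n → ℝ
  γ : Solid n → ℝ
  δ_pos : ∀ l, 0 < δ l
  D_pos : ∀ m, 0 < D m
  γ_pos : ∀ m, 0 < γ m
  /-- Robin coefficients `A_m`. -/
  A : Solid n → ℝ
  /-- Influx coefficients `Ĵ_l`. -/
  J : Comp n → ℝ
  /-- Reservoir volume fractions. -/
  res : Comp n → ℝ
  /-- Initial volume fractions (constants in space). -/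
  φ0 : Comp n → ℝ
  φmin : ℝ
  t0 : ℝ

/-- Auxiliary Young parameters belonging to the volume fraction estimates. -/
structure YoungPhi (n : ℕ) where
  /-- `η_{xl}` -/
  e : Ind n → ℝ
  /-- `η_{xgl}` -/
  eg : Ind n → ℝ
  /-- `η_{xln}` -/
  en : Ind n → Ind n → ℝ
  /-- `η_{xlijm}` -/
  eB : Ind n → Fin 2 → Fin 2 → Solid n → ℝ
  /-- `eBn l j m k` is `η_{xl1jmk}` -/
  eBn : Ind n → Fin 2 → Solid n → Ind n → ℝ

def YoungPhi.Pos {n : ℕ} (y : YoungPhi n) : Prop :=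
  (∀ l, 0 < y.e l) ∧ (∀ l, 0 < y.eg l) ∧ (∀ l k, 0 < y.en l k) ∧
  (∀ l i j m, 0 < y.eB l i j m) ∧ (∀ l j m k, 0 < y.eBn l j m k)

/-- Auxiliary Young parameters `η_index`. -/
structure Young (n : ℕ) where
  e1 : Solid n → ℝ
  e2 : Solid n → ℝ
  eL1 : Solid n → ℝ
  eL2 : Solid n → ℝ
  eM1 : Solid n → ℝ
  eM2 : Solid n → ℝ
  /-- `η_{𝓜mm}` -/
  eMm : Solid n → ℝ
  eMv1 : Solid n → ℝ
  eMv2 : Solid n → ℝ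
  /-- `eM m i k j s` is `η_{𝓜mikjs}` -/
  eM : Solid n → Fin 2 → Fin 2 → Solid n → Fin 2 → ℝ
  eN11 : Solid n → ℝ
  eN12 : Solid n → ℝ
  eN21 : Solid n → ℝ
  eN22 : Solid n → ℝ
  a : YoungPhi n
  b : YoungPhi n

def Young.Pos {n : ℕ} (η : Young n) : Prop :=
  (∀ m, 0 < η.e1 m) ∧ (∀ m, 0 < η.e2 m) ∧ (∀ m, 0 < η.eL1 m) ∧ (∀ m, 0 < η.eL2 m) ∧
  (∀ m, 0 < η.eM1 m) ∧ (∀ m, 0 < η.eM2 m) ∧ (∀ m, 0 < η.eMm m) ∧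
  (∀ m, 0 < η.eMv1 m) ∧ (∀ m, 0 < η.eMv2 m) ∧ (∀ m i k j s, 0 < η.eM m i k j s) ∧
  (∀ m, 0 < η.eN11 m) ∧ (∀ m, 0 < η.eN12 m) ∧ (∀ m, 0 < η.eN21 m) ∧ (∀ m, 0 < η.eN22 m) ∧
  η.a.Pos ∧ η.b.Pos

/-- Squared constant of the embedding `H¹(0,1) ⊂ L^∞(0,1)`: `C_∞ = √2`. -/
def Cinf2 : ℝ := 2

/-- The constant of the Poincaré inequality on `(0,1)` for functions vanishing at `0`. -/
def Cp : ℝ := 1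

/-- The solid cylinder intersection `{x | ∑_{j≠i} x_j² ≤ r² for all i}`. -/
def steinmetz {n : ℕ} (r : ℝ) : Set (Comp n → ℝ) :=
  {x | ∀ i, ∑ j ∈ Finset.univ.filter (fun j => j ≠ i), x j ^ 2 ≤ r ^ 2}

namespace Model

variable {n : ℕ} (M : Model n)

/-- `d` as a real number. -/
def dR (_M : Model n) : ℝ := (n : ℝ) + 2

/-- `𝓘_α^d` with `𝓘_α = (α, 1-(d-1)α)`. -/
def box (α : ℝ) : Set (Comp n → ℝ) := {x | ∀ l, x l ∈ Ioo α (1 - (M.dR - 1) * α)}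

/-- `Γ_α`. -/
def Γinf (α : ℝ) : ℝ := sInf (M.Γ '' M.box α)

/-- `H_α`. -/
def Hinf (α : ℝ) : ℝ := ⨅ m : Solid n, sInf (M.H 1 m '' M.box α)

def Γmin : ℝ := M.Γinf M.φmin

def Hmin : ℝ := M.Hinf M.φmin

/-- `Ĵ_m φ_{m,res} / H_{φ_min}`. -/
def fluxS (m : Solid n) : ℝ := M.J m.castSucc * M.res m.castSucc / M.Hmin

/-- `Ĵ_d φ_{d,res} / Γ_{φ_min}`. -/
def fluxD : ℝ := M.J (compD n) * M.res (compD n) / M.Γmin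

/-! #### Coefficients of the boundary and coupling terms in the displacement estimate -/

/-- `𝓜_{mi0j}` -/
def Mi0 (m : Solid n) (i : Fin 2) (j : Solid n) : ℝ :=
  if i = 0 then (M.E0 m 0 j).bd
  else (M.E0 m 1 j).bd + (M.E0 m 1 j).bd * |M.A j| + (M.E0 m 0 j).bd

/-- `𝓜_{mi1j}` -/
def Mi1 (m : Solid n) (i : Fin 2) (j : Solid n) : ℝ :=
  if i = 0 then (M.E01 m j).bd
  else (M.E01 m j).bd + if m = j then M.γ m * |M.A m| else 0

/-- `𝓜_{mikj}` -/
def Mc (m : Solid n) (i k : Fin 2) (j : Solid n) : ℝ := if k = 0 then M.Mi0 m i j else M.Mi1 m i j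

/-- `𝓜_{mm}` -/
def Mmm (m : Solid n) : ℝ := M.D m * |M.A m|

/-- `𝓜_{vm}` -/
def Mv (m : Solid n) : ℝ := M.γ m * |M.A m|

/-- `𝓜_m^k` at elapsed time `t` and velocity bound `V`. -/
def Mt (m : Solid n) (t V : ℝ) : ℝ :=
  (∑ j, (M.E0 m 1 j).bd * |M.A j| * (M.fluxS j * t + V * Real.sqrt t + M.fluxD * t))
  + (∑ j, (M.E0 m 0 j).bd * (2 * M.fluxS j * t))
  + (∑ j, (M.E01 m j).bd * (2 * M.fluxS j))
  + M.D m * |M.A m| * (M.fluxS m * t + V * Real.sqrt t + M.fluxD * t)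
  + M.γ m * |M.A m| * (M.fluxS m + M.fluxD)

def N0 (m : Solid n) : ℝ := (M.Gw m).bd * M.fluxS m

def N1 (m : Solid n) : ℝ := (M.F m).bd * M.fluxS m

def N2 (m : Solid n) : ℝ := M.fluxS m

variable (η : Young n)

/-! #### The constants of the displacement inequality -/

def Kw0 (t V : ℝ) : ℝ :=
  ∑ m, ((M.Gw m).bd ^ 2 / 2 * (1 / η.e1 m + 1 / η.e2 m) + M.N0 m * (1 + t)
    + M.N1 m ^ 2 / 2 * (1 / η.eN11 m + t / η.eN12 m)
    + M.N2 m ^ 2 / 2 * (1 / η.eN21 m + t / η.eN22 m)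
    + M.Mt m t V ^ 2 / 2 * (1 / η.eM1 m + 1 / η.eM2 m))

def Kw1 (_M : Model n) (η : Young n) (m : Solid n) : ℝ := η.e1 m / 2 + η.eL1 m / 2

def Kw2 (m : Solid n) : ℝ :=
  η.eM1 m / 2 + (∑ j, ∑ i, (η.eM m i 0 j 0 / 2 + η.eM m i 1 j 0 / 2)) + η.eMm m / 2
    + M.Mv m ^ 2 / (2 * η.eMv1 m) + M.Mmm m - M.D m

def Kw3 (m : Solid n) : ℝ :=
  ∑ j, (M.Mc j 0 0 m ^ 2 / (2 * η.eM j 0 0 m 0) + M.Mc j 0 0 m / 2 * η.eM j 0 0 m 1)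

def Kw4 (m : Solid n) : ℝ :=
  ∑ j, (M.Mc j 1 0 m ^ 2 / (2 * η.eM j 1 0 m 0) + M.Mc j 1 0 m / 2 * η.eM j 1 0 m 1)

def Kw5 (m : Solid n) : ℝ :=
  η.e2 m / 2 + η.eL2 m / 2 + η.eN21 m / 2 + η.eN22 m / 2
    + ∑ j, (M.Mc j 0 1 m ^ 2 / (2 * η.eM j 0 1 m 0) + M.Mc j 0 1 m / 2 * η.eM j 0 1 m 1)

def Kw6 (m : Solid n) : ℝ :=
  η.eM2 m / 2 + M.Mmm m ^ 2 / (2 * η.eMm m) + M.Mv m ^ 2 / (2 * η.eMv2 m)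
    + (∑ j, (M.Mc m 0 1 j / (2 * η.eM m 0 1 j 1)
        + ∑ i, M.Mc m i 0 j / (2 * η.eM m i 0 j 1)))
    + ∑ j, (M.Mc j 1 1 m ^ 2 / (2 * η.eM j 1 1 m 0) + M.Mc m 1 1 j / 2 * η.eM m 1 1 j 1
        + M.Mc j 1 1 m / (2 * η.eM j 1 1 m 1))

def Kw7 : ℝ := ∑ m, (M.F m).bd ^ 2 / 2 * (1 / η.eL1 m + 1 / η.eL2 m)

def Kw8 (_M : Model n) (η : Young n) : ℝ :=
  ∑ m, (η.eN11 m / 2 + η.eN12 m / 2 + η.eMv1 m / 2 + η.eMv2 m / 2)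

/-- `K_{w7} + K_{w8}` -/
def Kw78 : ℝ := M.Kw7 η + M.Kw8 η

/-! #### The constants of the volume fraction inequalities, versions `a` and `b` -/

def Ka0 : ℝ := ⨆ l : Ind n, (M.Gφ l).bd ^ 2 / η.a.eg l

def Kb0 : ℝ := ∑ l : Ind n, (M.Gφ l).bd ^ 2 / (M.δ l ^ 2 * η.b.eg l)

def Ka1 : ℝ := ⨆ l : Ind n, ((M.I l).bd ^ 2 * M.Γ.bd ^ 2 / η.a.e l
  + 2 * ∑ k : Ind n, (M.I l).bd ^ 2 * M.Γ.bd ^ 2 * Cp ^ 2 / η.a.en l k)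

def Kb1 : ℝ := ∑ l : Ind n, (M.I l).bd ^ 2 * M.Γ.bd ^ 2 / (M.δ l ^ 2 * η.b.e l)

def Ka2 (_M : Model n) (η : Young n) (l : Ind n) : ℝ :=
  η.a.e l + η.a.eg l
    + ∑ m, (η.a.eB l 0 0 m + η.a.eB l 0 1 m + η.a.eB l 1 0 m + η.a.eB l 1 1 m)

def Kb2 (_M : Model n) (η : Young n) (l : Ind n) : ℝ :=
  η.b.e l + η.b.eg l
    + (∑ m, (η.b.eB l 0 0 m + η.b.eB l 0 1 m + η.b.eB l 1 0 m + η.b.eB l 1 1 m))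
    + 2 * ∑ k : Ind n, (η.b.en l k + ∑ j, (η.b.eBn l 0 j k + η.b.eBn l 1 j k))

def Ka3 (_M : Model n) (η : Young n) (l k : Ind n) : ℝ :=
  2 * (η.a.en l k + ∑ m, (η.a.eBn l 0 m k + η.a.eBn l 1 m k))

def Ka4 (m : Solid n) : ℝ := ⨆ l : Ind n, ((M.B l 0 0 m).bd ^ 2 / η.a.eB l 0 0 m
  + 2 * ∑ k : Ind n, (M.B l 1 0 m).bd ^ 2 / η.a.eBn l 0 m k)

def Kb4 (m : Solid n) : ℝ := ∑ l : Ind n, (M.B l 0 0 m).bd ^ 2 / (M.δ l ^ 2 * η.b.eB l 0 0 m)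

def Ka5 (m : Solid n) : ℝ := ⨆ l : Ind n, (M.B l 1 0 m).bd ^ 2 / η.a.eB l 1 0 m

def Kb5 (m : Solid n) : ℝ := ∑ l : Ind n, (M.B l 1 0 m).bd ^ 2 / (M.δ l ^ 2 * η.b.eB l 1 0 m)

def Ka6 (m : Solid n) : ℝ := ⨆ l : Ind n, ((M.B l 0 1 m).bd ^ 2 / η.a.eB l 0 1 m
  + 2 * ∑ k : Ind n, (M.B l 1 1 m).bd ^ 2 / η.a.eBn l 1 m k)

def Kb6 (m : Solid n) : ℝ := ∑ l : Ind n, (M.B l 0 1 m).bd ^ 2 / (M.δ l ^ 2 * η.b.eB l 0 1 m)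

def Ka7 (m : Solid n) : ℝ := ⨆ l : Ind n, (M.B l 1 1 m).bd ^ 2 / η.a.eB l 1 1 m

def Kb7 (m : Solid n) : ℝ := ∑ l : Ind n, (M.B l 1 1 m).bd ^ 2 / (M.δ l ^ 2 * η.b.eB l 1 1 m)

/-- `K_{φ3l1}` -/
def Kφ31 (l : Ind n) : ℝ :=
  2 * ∑ k : Ind n, (M.I k).bd ^ 2 * M.Γ.bd ^ 2 * Cinf2 / (M.δ k ^ 2 * η.b.en k l)

/-- `K_{φ3l2m}` -/
def Kφ32 (l : Ind n) (m : Solid n) : ℝ :=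
  2 * ∑ k : Ind n, (M.B k 1 1 m).bd ^ 2 * Cinf2 / (M.δ l ^ 2 * η.b.eBn k 1 m l)

/-- `K_{φ3l3m}` -/
def Kφ33 (l : Ind n) (m : Solid n) : ℝ :=
  2 * ∑ k : Ind n, (M.B k 1 0 m).bd ^ 2 * Cinf2 / (M.δ l ^ 2 * η.b.eBn k 0 m l)

/-- `K_{φ3l4}` -/
def Kφ34 (l : Ind n) : ℝ :=
  ∑ m, (M.Kφ32 η l m + M.Kφ33 η l m) / min (1 - M.Kw5 η m) (M.γ m - M.Kw6 η m)

/-! #### Gronwall constants.  Below `x` is the length of the time interval and `y` the velocity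
bound `V`. -/

def gA (x y : ℝ) : ℝ := M.Kw0 η x y

def gB : ℝ := 2 * ⨆ m, max (M.Kw1 η m) (M.Kw2 η m / (M.γ m + M.D m))

def gC : ℝ := 2 * ⨆ m, max (M.Kw3 η m) (M.Kw4 η m / (M.γ m + M.D m))

/-- `min_m {1 - K_{w5m}, γ_m - K_{w6m}}` -/
def κ : ℝ := ⨅ m, min (1 - M.Kw5 η m) (M.γ m - M.Kw6 η m)

/-- `Ĉ²(x,y)` -/
def Chat2 (x y : ℝ) : ℝ :=
  (M.Kw78 η * y ^ 2
    + M.gA η x y * ((M.gC η + 1.6838 * M.gB η) / (M.gC η + M.gB η)) * x)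
    * Real.exp ((M.gC η + 1.6838 * M.gB η) * x)

/-- `C̃²(x,y)` -/
def Ctil2 (x y : ℝ) : ℝ := M.Chat2 η x y / M.κ η

def Kb45 : ℝ := ⨆ m, max (M.Kb4 η m) (M.Kb5 η m / (M.γ m + M.D m))

def Kb67 : ℝ := ⨆ m, max (M.Kb6 η m / (1 - M.Kw5 η m)) (M.Kb7 η m / (M.γ m - M.Kw6 η m))

def Ka45 : ℝ := ⨆ m, max (M.Ka4 η m) (M.Ka5 η m / (M.γ m + M.D m))

def Ka67 : ℝ := ⨆ m, max (M.Ka6 η m / (1 - M.Kw5 η m)) (M.Ka7 η m / (M.γ m - M.Kw6 η m))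

def cb (x y : ℝ) : ℝ :=
  M.Kb0 η * x + M.Kb1 η * y ^ 2 + M.Kb45 η * M.Ctil2 η x y * x + M.Kb67 η * M.Ctil2 η x y

def Db (x y : ℝ) : ℝ :=
  ⨆ l : Ind n, (2 * M.Kφ31 η l * y ^ 2 + M.Kφ34 η l * M.Ctil2 η x y)

/-- `c_b(x,y) exp(D_b(x,y))`, the bound on `∑_{l≠d-1} ‖∂_z φ_l^k‖²`. -/
def gradB (x y : ℝ) : ℝ := M.cb η x y * Real.exp (M.Db η x y)

def Aa (x y : ℝ) : ℝ :=
  M.Ka0 η + M.gradB η x y * (⨆ l : Ind n, ⨆ k : Ind n, M.Ka3 η l k) + M.Ka45 η * M.Ctil2 η x y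

def Za (x y : ℝ) : ℝ := M.Ka1 η * y ^ 2 + M.Ka67 η * M.Ctil2 η x y

def Da : ℝ := ⨆ l : Ind n, M.Ka2 η l

/-! #### The bounding functions `P_α` and the region `S` -/

/-- Bound on `‖φ_j^k‖²` in `L²` for `j ≠ d - 1`. -/
def phiB (j : Ind n) (x y : ℝ) : ℝ :=
  (M.φ0 j ^ 2 + M.Za η x y + 1.6838 * M.Aa η x y * x) * Real.exp (1.6838 * M.Da η * x)

/-- Coefficient of `‖φ_{d-1}^k‖²` after Cauchy's inequality in the tested equation
for `φ_{d-1}`. -/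
def pB (x y : ℝ) : ℝ :=
  (4 * (M.dR - 1) * M.gradB η x y + 1) * (∑ l : Ind n, (M.I l).bd * M.Γ.bd) ^ 2 + 2
    + ∑ l : Ind n, ∑ m, ((M.B l 0 1 m).bd ^ 2 / (1 - M.Kw5 η m)
        + (M.B l 1 1 m).bd ^ 2 / (M.γ m - M.Kw6 η m))

/-- Constant term after Cauchy's inequality in the tested equation for `φ_{d-1}`. -/
def pA (x y : ℝ) : ℝ :=
  (∑ l : Ind n, (M.Gφ l).bd) ^ 2
    + (∑ m, (((∑ l : Ind n, (M.B l 0 0 m).bd) ^ 2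
        + (∑ l : Ind n, (M.B l 1 0 m).bd) ^ 2 / (M.γ m + M.D m))
        + (∑ l : Ind n, (M.B l 1 0 m).bd) ^ 2)) * M.Chat2 η x y
    + (4 * (M.dR - 1) * (1 + ∑ l : Ind n, ∑ m, (M.B l 1 1 m).bd ^ 2 / (1 - M.Kw5 η m))
        + (M.dR - 1) + ∑ l : Ind n, M.δ l ^ 2) * M.gradB η x y

/-- The bound `𝒫(x,y)` on `‖φ_{d-1}^k‖²` in `H¹`: the first discrete Gronwall lemma applied to
the tested equation for `φ_{d-1}`, and `‖∂_z φ_{d-1}‖² ≤ (d-1) ∑_{l≠d-1} ‖∂_z φ_l‖²`. -/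
def pH1 (x y : ℝ) : ℝ :=
  (M.φ0 (compDm1 n) ^ 2 + (2 * Cinf2 + 1) * y ^ 2 + 2 * M.dR * M.Chat2 η x y
      + 1.6838 * M.pA η x y * x) * Real.exp (1.6838 * M.pB η x y * x)
    + (M.dR - 1) * M.gradB η x y

/-- `P_α(x,y)`, the bound on `∑_{j≠l} ‖φ_j^k‖²` in `H¹`, where `l = α_d` is the component left out
by the cyclic permutation `α`. -/
def P (l : Comp n) (x y : ℝ) : ℝ :=
  (∑ j : Ind n, if (j : Comp n) = l then 0 else M.phiB η j x y) + M.gradB η x y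
    + if l = compDm1 n then 0 else M.pH1 η x y

/-- `½ ((1 - φ_min)/C_∞)²` -/
def thr : ℝ := (1 - M.φmin) ^ 2 / (2 * Cinf2)

/-- The region `S`. -/
def regionS : Set (ℝ × ℝ) := {p | 0 < p.1 ∧ 0 < p.2 ∧ ∀ l, M.P η l p.1 p.2 < M.thr}

/-! #### The bounding function `Q` and the region `ℛ`.  Here `Q0 = ‖∂_z v⁰‖²`. -/

def Q (Q0 h x y : ℝ) : ℝ :=
  Q0 * h + (4 * M.dR - 2) / M.Γmin ^ 2 *
    (8 * M.Γ.bd ^ 2 * Cinf2 * (M.dR - 1) * M.gradB η x y * y ^ 2 + M.Gv.bd ^ 2 * x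
      + x * (⨆ m, max ((M.H 0 m).bd ^ 2 / (M.γ m + M.D m))
          (4 * (M.dR - 1) * Cinf2 * (M.H 0 m).bd ^ 2 * M.gradB η x y)) * M.Chat2 η x y
      + (⨆ m, max ((M.H 1 m).bd ^ 2 / (M.γ m - M.Kw6 η m))
          (4 * (M.dR - 1) * Cinf2 * (M.H 1 m).bd ^ 2 * M.gradB η x y / (1 - M.Kw5 η m)))
        * M.Chat2 η x y)

/-- The region `ℛ` for time steps in `(0, h)`. -/
def regionR (Q0 h : ℝ) : Set (ℝ × ℝ) :=
  {p | 0 < p.1 ∧ 0 < p.2 ∧ M.Q η Q0 h p.1 p.2 < p.2 ^ 2}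

def cbHat : ℝ := M.Kb1 η + M.Kb67 η / M.κ η * M.Kw78 η

def DbHat : ℝ := ⨆ l : Ind n, (2 * M.Kφ31 η l + M.Kφ34 η l / M.κ η * M.Kw78 η)

def Q1 : ℝ :=
  (4 * M.dR - 2) / M.Γmin ^ 2 * (⨆ m, (M.H 1 m).bd ^ 2 / (M.γ m - M.Kw6 η m)) * M.Kw78 η

def Q2 : ℝ :=
  (4 * M.dR - 2) * (4 * M.dR - 4) / M.Γmin ^ 2 * Cinf2 * M.cbHat η *
    ⨆ m, (2 * M.Γ.bd ^ 2 + (M.H 1 m).bd ^ 2 / (1 - M.Kw5 η m) * M.Kw78 η)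

def Q3 : ℝ := M.DbHat η

def ZaHat : ℝ := M.Ka1 η + M.Ka67 η / M.κ η * M.Kw78 η

def PHat : ℝ := 5 + 2 * M.dR * M.Kw78 η

def yTilde : ℝ :=
  Real.sqrt (1 / M.DbHat η * lambertW0 (⨅ l : Comp n,
    (M.thr - ∑ j ∈ Finset.univ.filter (fun j => j ≠ l), M.φ0 j ^ 2) * M.DbHat η /
      (if l = compDm1 n then (M.dR - 1) * M.ZaHat η + M.cbHat η
        else (M.dR - 2) * M.ZaHat η + M.dR * M.cbHat η + M.PHat η)))

def zTilde : ℝ := 2 / 3 * lambertW0 (3 * M.Q3 η / (4 * M.Q2 η) * (1 - M.Q1 η))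

/-! #### The assumptions -/

/-- Reservoirs and influx. -/
def Reservoirs : Prop :=
  (∀ l, 0 ≤ M.J l) ∧ M.J 0 = 0 ∧ (∀ l, M.res l ∈ Icc (0 : ℝ) 1) ∧ ∑ l, M.res l = 1

/-- Non-degeneracy of `Γ` and of all `H_{1m}`. -/
def Nondegenerate : Prop :=
  ∀ α, 0 < α → α < 1 / M.dR → 0 < M.Γinf α ∧ ∀ m, 0 < sInf (M.H 1 m '' M.box α)

/-- Pseudo-parabolicity. -/
def PseudoParabolic : Prop :=
  ∀ m j, M.Mc m 1 1 j + M.Mc j 1 1 m + M.Mc m 0 1 j * Real.sqrt (M.γ m)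
    < 2 * M.γ m / (M.dR - 1)

/-- Initial volume fractions and the lower bound `φ_min`. -/
def InitialFractions : Prop :=
  0 < M.φmin ∧ M.φmin < 1 / M.dR ∧
  M.φ0 ∈ steinmetz ((1 - M.φmin) / (Real.sqrt 2 * Real.sqrt Cinf2)) ∧
  ∑ l, M.φ0 l = 1 ∧ (∀ l, M.φmin < M.φ0 l) ∧
  (2 < M.dR → M.dR ≤ 5 →
    M.φmin < 1 - Real.sqrt (2 * (M.dR - 1)) * Real.sqrt Cinf2 / M.dR) ∧
  (5 < M.dR → M.φmin ≤ 1 / (1 + Real.sqrt (2 * (M.dR - 1)) * Real.sqrt Cinf2))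

/-- The gap `γ_m - 𝓜_{vm}²/(2θ_m) - ∑_j (…)`, where `θ_m` stands for `η_{𝓜vm2}`. -/
def gap (θ : Solid n → ℝ) (m : Solid n) : ℝ :=
  M.γ m - M.Mv m ^ 2 / (2 * θ m)
    - ∑ j, (M.Mc m 0 1 j * Real.sqrt (M.γ m) / 2 + M.Mc m 1 1 j / 2 + M.Mc j 1 1 m / 2)

/-- Smallness of the velocity coupling. -/
def VelocityCoupling : Prop :=
  ∃ θ : Solid n → ℝ, (∀ m, 0 < θ m) ∧ (∀ m, 0 < M.gap θ m) ∧
    (M.dR - 1 / 2) * (M.dR + 3) / M.Γmin ^ 2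
      * (∑ m, ((M.F m).bd ^ 2 / (1 - ∑ j, M.Mc j 0 1 m / (2 * Real.sqrt (M.γ j))) + θ m / 2))
      * (⨆ m, (M.H 1 m).bd ^ 2 / M.gap θ m) < 1

/-- An admissible choice of the auxiliary Young parameters. -/
def Admissible : Prop :=
  η.Pos ∧ (∀ m, M.Kw5 η m < 1) ∧ (∀ m, M.Kw6 η m < M.γ m) ∧
  (∀ l : Ind n, M.δ l * M.Kb2 η l < 2) ∧ 0 < M.gB η + M.gC η ∧ M.Q1 η < 1

/-- `H` lies strictly below
`min {(1-Q₁)²/(4Q₂Q₀), ỹ⁴Q₂/Q₀, Q₂z̃²(1+z̃)e^z̃/(Q₀Q₃²), 0.6838/B, 0.6838/D_a}`; a quotient by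
`Q₀ = 0` counts as `+∞`, hence that factor is multiplied out. -/
def StepBound (Q0 h : ℝ) : Prop :=
  Q0 * h < (1 - M.Q1 η) ^ 2 / (4 * M.Q2 η) ∧
  Q0 * h < M.yTilde η ^ 4 * M.Q2 η ∧
  Q0 * h < M.Q2 η * M.zTilde η ^ 2 / M.Q3 η ^ 2 * (1 + M.zTilde η) * Real.exp (M.zTilde η) ∧
  h < 0.6838 / M.gB η ∧ h < 0.6838 / M.Da η

/-! #### The discretised system -/

/-- The initial velocity: together with the initial displacement rates `u_m = ∂_t w_m(t₀)` and the
rate `β = W'(t₀)`, `v0` solves the elliptic subsystem obtained from the displacement equation, the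
continuity equation and the boundary conditions at `t = t₀`. -/
def IsInitialVelocity (v0 : ℝ → ℝ) : Prop :=
  ∃ (u : Solid n → ℝ → ℝ) (β : ℝ), (∀ m, MemH2 (u m)) ∧ MemH1 v0 ∧
    (∀ᵐ z ∂(volume.restrict (Ioo (0 : ℝ) 1)),
      dz (fun y => M.Γ M.φ0 * v0 y) z + ∑ m, dz (fun y => M.H 1 m M.φ0 * u m y) z
        = M.Gv M.φ0) ∧
    (∀ m, ∀ᵐ z ∂(volume.restrict (Ioo (0 : ℝ) 1)),
      u m z - M.γ m * dz (dz (u m)) z + M.F m M.φ0 * v0 z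
        + ∑ j, dz (fun y => M.E01 m j M.φ0 * u j y) z = M.Gw m M.φ0) ∧
    (∀ m, M.H 1 m M.φ0 * u m 0
      = M.J m.castSucc * posPt (M.res m.castSucc - M.φ0 m.castSucc)) ∧
    (∀ m, dz (u m) 1 = M.A m * (u m 1 - β)) ∧
    v0 0 = 0 ∧
    M.Γ M.φ0 * (β - v0 1) = M.J (compD n) * posPt (M.res (compD n) - M.φ0 (compD n))

/-- One time step from `(φ, w, v, W)` at `t_{k-1}` to `(φ', w', v', W')` at `t_k`. -/
structure Step (τ : ℝ) (φ φ' : Comp n → ℝ → ℝ) (w w' : Solid n → ℝ → ℝ) (v v' : ℝ → ℝ)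
    (W W' : ℝ) : Prop where
  regφ : ∀ l, MemH2 (φ' l)
  regw : ∀ m, MemH2 (w' m)
  regv : MemH1 v'
  sum_eq : ∀ z ∈ Icc (0 : ℝ) 1, ∑ l, φ' l z = 1
  eqφ : ∀ l, l ≠ compDm1 n → ∀ᵐ z ∂(volume.restrict (Ioo (0 : ℝ) 1)),
    (φ' l z - φ l z) / τ - M.δ l * dz (dz (φ' l)) z
      + M.I l (fun k => φ k z) * dz (fun y => M.Γ (fun k => φ k y) * v y) z
      + ∑ m, ∑ i : Fin 2, dzPow i (fun y => M.B l i 0 m (fun k => φ k y) * w m y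
          + M.B l i 1 m (fun k => φ k y) * ((w' m y - w m y) / τ)) z
      = M.Gφ l (fun k => φ k z)
  eqv : ∀ᵐ z ∂(volume.restrict (Ioo (0 : ℝ) 1)),
    (∑ m, dz (fun y => M.H 0 m (fun k => φ k y) * w m y
        + M.H 1 m (fun k => φ k y) * ((w' m y - w m y) / τ)) z)
      + dz (fun y => M.Γ (fun k => φ k y) * v' y) z = M.Gv (fun k => φ k z)
  eqw : ∀ m, ∀ᵐ z ∂(volume.restrict (Ioo (0 : ℝ) 1)),
    (w' m z - w m z) / τ - M.D m * dz (dz (w' m)) z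
      - M.γ m * dz (dz (fun y => (w' m y - w m y) / τ)) z
      + M.F m (fun k => φ k z) * v z
      + ∑ j, ((∑ i : Fin 2, dz (fun y => M.E0 m i j (fun k => φ k y) * dzPow i (w j) y) z)
          + dz (fun y => M.E01 m j (fun k => φ k y) * ((w' j y - w j y) / τ)) z)
      = M.Gw m (fun k => φ k z)
  bcφ : ∀ l, l ≠ compDm1 n → dz (φ' l) 0 = 0 ∧ dz (φ' l) 1 = 0
  bcw0 : ∀ m, M.H 1 m (fun k => φ k 0) * ((w' m 0 - w m 0) / τ)
    = M.J m.castSucc * posPt (M.res m.castSucc - φ m.castSucc 0)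
  bcw1 : ∀ m, dz (w' m) 1 = M.A m * (w' m 1 - W')
  bcv : v' 0 = 0
  bcW : M.Γ (fun k => φ k 1) * ((W' - W) / τ - v 1)
    = M.J (compD n) * posPt (M.res (compD n) - φ (compD n) 1)

/-- `(φ^k, w^k, v^k, 𝒲^k)` solves the discretised system with step `τ` for all grid times
`t_k = t₀ + kτ ≤ T`. -/
structure IsSolution (τ T : ℝ) (v0 : ℝ → ℝ) (φ : ℕ → Comp n → ℝ → ℝ) (w : ℕ → Solid n → ℝ → ℝ)
    (v : ℕ → ℝ → ℝ) (W : ℕ → ℝ) : Prop where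
  initφ : ∀ l z, φ 0 l z = M.φ0 l
  initw : ∀ m z, w 0 m z = 0
  initv : v 0 = v0
  initW : W 0 = 0
  step : ∀ k : ℕ, M.t0 + ((k + 1 : ℕ) : ℝ) * τ ≤ T →
    M.Step τ (φ k) (φ (k + 1)) (w k) (w (k + 1)) (v k) (v (k + 1)) (W k) (W (k + 1))

end Model

end Rothe

end

/-! Two independent arguments are joined at the end by taking `T - t₀` small: solvability with
bounds uniform in the step size, and membership of `(T - t₀, V)` in `S ∩ ℛ`. The bounding functions
`P` and `Q` serve only the second; the estimates for the discrete solution are obtained directly.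

Solvability. Because the couplings are lagged, one step splits. The rates `u_m = 𝒟(w_m)` solve a
linear elliptic system with Robin conditions, the continuity equation is then integrated for the new
velocity, each fraction other than the one with index `d - 1` solves a Neumann problem, and that
last fraction is read off from the constraint. Elliptic existence is the Fredholm alternative for a
first-order system of ordinary differential equations (`exists_linear_bvp`, `exists_elliptic`): as
many boundary conditions as unknowns, so uniqueness suffices, and uniqueness comes from energy
estimates.

The danger is the loop old velocity → rates → new velocity, which carries no factor of the step size
and could amplify geometrically. Assumption (9) makes it contract: the energy inequalities of all
solids are summed with Young weights matched to the gap (`energy_absorption`), and the velocity fed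
back is at most `3/4` of the old one plus data (`exists_contraction`). A large velocity bound
therefore reproduces itself at every step (`exists_velocity`). Once it is fixed, the displacements,
the means of the fractions and their squared gradients drift at most proportionally to elapsed time
(`heat_step`, `exists_advance`). For a short time the fractions thus stay above `φmin` with small
gradients (`exists_good_time`), which closes the induction; summation gives `exists_local_solution`.

Membership. At `x = 0` the bounding functions reduce to explicit expressions in `s = y²`: `P` to the
initial squares plus a multiple of `s exp(D s)` (`P_zero_le`), and `Q` to `Q₀H + Q₁ s + Q₂ s² exp(D
s)` (`Q_zero_le`). The step bound supplies an `s` for which both inequalities are strict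
(`exists_smallness`), and continuity in `x` extends them to short intervals
(`exists_velocity_bound`).

The remaining existence claims use the same ingredients. Admissible parameters arise by perturbing a
degenerate choice for which the admissibility constants reduce to, or are dominated by, those of (9)
(`exists_admissible`). The initial velocity solves the elliptic system at constant fractions, where
uniqueness is again the contraction (`exists_initialVelocity`). -/

namespace Rothe

/-! ### The norm of `L²(0,1)`. -/

open Filter Topology

/-- Lebesgue measure on `(0,1)`. -/
noncomputable abbrev vol01 : Measure ℝ := volume.restrict (Ioo (0 : ℝ) 1)

/-- The norm of `L²(0,1)`. -/
noncomputable abbrev nrm (u : ℝ → ℝ) : ℝ := lpNorm u 2 vol01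

theorem vol01_univ : vol01 univ = 1 := by simp [vol01]

instance : IsProbabilityMeasure vol01 := ⟨vol01_univ⟩

theorem intervalIntegral_eq_vol01 (f : ℝ → ℝ) : ∫ z in (0 : ℝ)..1, f z = ∫ z, f z ∂vol01 := by
  rw [intervalIntegral.integral_of_le zero_le_one, integral_Ioc_eq_integral_Ioo]

theorem l2sq_eq {u : ℝ → ℝ} (hu : MemLp u 2 vol01) : l2sq u = nrm u ^ 2 := by
  unfold l2sq nrm
  rw [intervalIntegral_eq_vol01,
    lpNorm_eq_integral_norm_rpow_toReal (by norm_num) (by norm_num) hu.1]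
  have h0 : 0 ≤ ∫ x, ‖u x‖ ^ (2 : ENNReal).toReal ∂vol01 := integral_nonneg fun x => by positivity
  rw [← Real.rpow_natCast, ← Real.rpow_mul h0]
  simp

theorem integral_mul_le_nrm {u v : ℝ → ℝ} (hu : MemLp u 2 vol01) (hv : MemLp v 2 vol01) :
    |∫ z, u z * v z ∂vol01| ≤ nrm u * nrm v := by
  have h := integral_mul_norm_le_Lp_mul_Lq (μ := vol01) (f := u) (g := v) (p := 2) (q := 2)
    ⟨by norm_num, by norm_num, by norm_num⟩ (by simpa using hu) (by simpa using hv)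
  have e : ∀ {u : ℝ → ℝ}, MemLp u 2 vol01 →
      (∫ a, ‖u a‖ ^ (2 : ℝ) ∂vol01) ^ (1 / 2 : ℝ) = nrm u := by
    intro u hu
    rw [nrm, lpNorm_eq_integral_norm_rpow_toReal (by norm_num) (by norm_num) hu.1]
    norm_num
  rw [e hu, e hv] at h
  refine le_trans ?_ h
  have := norm_integral_le_integral_norm (μ := vol01) (fun z => u z * v z)
  simpa [norm_mul] using this

theorem nrm_mono {u v : ℝ → ℝ} (hu : AEStronglyMeasurable u vol01) (hv : MemLp v 2 vol01)
    (h : ∀ᵐ z ∂vol01, |u z| ≤ |v z|) : MemLp u 2 vol01 ∧ nrm u ≤ nrm v := by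
  refine ⟨hv.mono hu h, ?_⟩
  rw [nrm, nrm, ← toReal_eLpNorm hu, ← toReal_eLpNorm hv.1]
  exact ENNReal.toReal_mono hv.2.ne (eLpNorm_mono_ae h)

theorem nrm_congr {u v : ℝ → ℝ} (h : u =ᵐ[vol01] v) : nrm u = nrm v := by
  by_cases hu : AEStronglyMeasurable u vol01
  · rw [nrm, nrm, ← toReal_eLpNorm hu, ← toReal_eLpNorm (hu.congr h), eLpNorm_congr_ae h]
  · rw [nrm, nrm, lpNorm_of_not_aestronglyMeasurable hu,
      lpNorm_of_not_aestronglyMeasurable fun hv => hu (hv.congr h.symm)]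

theorem nrm_nonneg (u : ℝ → ℝ) : 0 ≤ nrm u := lpNorm_nonneg

theorem nrm_add_le {u v : ℝ → ℝ} (hu : MemLp u 2 vol01) :
    nrm (fun z => u z + v z) ≤ nrm u + nrm v := lpNorm_add_le hu (by norm_num)

theorem nrm_sub_le {u v : ℝ → ℝ} (hu : MemLp u 2 vol01) :
    nrm (fun z => u z - v z) ≤ nrm u + nrm v := lpNorm_sub_le hu (by norm_num)

theorem nrm_sum_le {ι : Type*} {s : Finset ι} {u : ι → ℝ → ℝ}
    (hu : ∀ i ∈ s, MemLp (u i) 2 vol01) :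
    nrm (fun z => ∑ i ∈ s, u i z) ≤ ∑ i ∈ s, nrm (u i) := by
  have := lpNorm_sum_le (μ := vol01) (p := 2) hu (by norm_num)
  convert this using 2
  ext z; simp

theorem nrm_const_mul (c : ℝ) (u : ℝ → ℝ) : nrm (fun z => c * u z) = |c| * nrm u :=
  lpNorm_const_smul c u vol01

theorem nrm_const (c : ℝ) : nrm (fun _ => c) = |c| := by
  have := lpNorm_const (p := 2) (μ := vol01) (by norm_num) (IsProbabilityMeasure.ne_zero _) c
  simpa using this

theorem nrm_le_of_bound {u : ℝ → ℝ} {c : ℝ} (hu : AEStronglyMeasurable u vol01)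
    (h : ∀ᵐ z ∂vol01, |u z| ≤ c) : MemLp u 2 vol01 ∧ nrm u ≤ |c| := by
  have := nrm_mono hu (memLp_const c) (by filter_upwards [h] with z hz using hz.trans (le_abs_self c))
  rwa [nrm_const] at this

theorem nrm_mul_le {u v : ℝ → ℝ} {c : ℝ} (hu : AEStronglyMeasurable u vol01) (hv : MemLp v 2 vol01)
    (h : ∀ᵐ z ∂vol01, |u z| ≤ c) (hc : 0 ≤ c) :
    MemLp (fun z => u z * v z) 2 vol01 ∧ nrm (fun z => u z * v z) ≤ c * nrm v := by
  have := nrm_mono (u := fun z => u z * v z) (v := fun z => c * v z) (hu.mul hv.1)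
    (hv.const_mul c) (by
      filter_upwards [h] with z hz
      rw [abs_mul, abs_mul, abs_of_nonneg hc]; gcongr)
  rwa [nrm_const_mul, abs_of_nonneg hc] at this

theorem memLp_two_integrable {u : ℝ → ℝ} (hu : MemLp u 2 vol01) : Integrable u vol01 :=
  hu.integrable (by norm_num)

theorem integral_le_nrm {u : ℝ → ℝ} (hu : MemLp u 2 vol01) : |∫ z, u z ∂vol01| ≤ nrm u := by
  have := integral_mul_le_nrm hu (memLp_const (1 : ℝ))
  simpa [nrm_const] using this

theorem memLp_intervalIntegrable {u : ℝ → ℝ} (hu : MemLp u 2 vol01) :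
    IntervalIntegrable u volume 0 1 := by
  rw [intervalIntegrable_iff_integrableOn_Ioo_of_le zero_le_one]
  exact memLp_two_integrable hu

theorem abs_intervalIntegral_le_nrm {u : ℝ → ℝ} (hu : MemLp u 2 vol01) {a b : ℝ}
    (ha : a ∈ Icc (0 : ℝ) 1) (hb : b ∈ Icc (0 : ℝ) 1) : |∫ z in a..b, u z| ≤ nrm u := by
  have h1 : |∫ z in a..b, u z| ≤ ∫ z in Set.uIoc a b, ‖u z‖ :=
    by rw [← Real.norm_eq_abs]; exact intervalIntegral.norm_integral_le_integral_norm_uIoc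
  have h2 : ∫ z in Set.uIoc a b, ‖u z‖ ≤ ∫ z, ‖u z‖ ∂vol01 := by
    rw [vol01, ← integral_Ioc_eq_integral_Ioo]
    apply setIntegral_mono_set
    · exact ((intervalIntegrable_iff_integrableOn_Ioc_of_le zero_le_one).1
        (memLp_intervalIntegrable hu)).norm
    · exact ae_of_all _ fun z => norm_nonneg _
    · apply LE.le.eventuallyLE
      intro z hz
      rw [Set.mem_uIoc] at hz
      rcases hz with h | h
      · exact ⟨ha.1.trans_lt h.1, h.2.trans hb.2⟩
      · exact ⟨hb.1.trans_lt h.1, h.2.trans ha.2⟩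
  have h3 := integral_le_nrm hu.norm
  rw [abs_of_nonneg (integral_nonneg fun z => norm_nonneg _)] at h3
  exact h1.trans (h2.trans (h3.trans (le_of_eq (lpNorm_fun_abs hu.1 2))))

/-! ### Derivatives -/

theorem dz_congr {u v : ℝ → ℝ} (h : EqOn u v (Icc 0 1)) {z : ℝ} (hz : z ∈ Icc (0 : ℝ) 1) :
    dz u z = dz v z := derivWithin_congr h (h hz)

theorem HasDerivWithinAt.dz_eq {u : ℝ → ℝ} {d z : ℝ} (h : HasDerivWithinAt u d (Icc 0 1) z)
    (hz : z ∈ Icc (0 : ℝ) 1) : dz u z = d :=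
  h.derivWithin ((uniqueDiffOn_Icc zero_lt_one) z hz)

theorem ae_vol01_mem : ∀ᵐ z ∂vol01, z ∈ Ioo (0 : ℝ) 1 := ae_restrict_mem measurableSet_Ioo

theorem ae_vol01_mem_Icc : ∀ᵐ z ∂vol01, z ∈ Icc (0 : ℝ) 1 := by
  filter_upwards [ae_vol01_mem] with z hz using Ioo_subset_Icc_self hz

theorem ContinuousOn.memLp_vol01 {u : ℝ → ℝ} (h : ContinuousOn u (Icc 0 1)) :
    MemLp u 2 vol01 := by
  obtain ⟨C, hC⟩ := isCompact_Icc.exists_bound_of_continuousOn h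
  refine MemLp.of_bound ((h.mono Ioo_subset_Icc_self).aestronglyMeasurable measurableSet_Ioo) C ?_
  filter_upwards [ae_vol01_mem_Icc] with z hz using hC z hz

theorem ContinuousOn.nrm_le {u : ℝ → ℝ} (h : ContinuousOn u (Icc 0 1)) {c : ℝ}
    (hc : ∀ z ∈ Icc (0 : ℝ) 1, |u z| ≤ c) : nrm u ≤ c := by
  have := (nrm_le_of_bound (u := u) (c := c) (ContinuousOn.memLp_vol01 h).1 (by
    filter_upwards [ae_vol01_mem_Icc] with z hz using hc z hz)).2
  rwa [abs_of_nonneg ((abs_nonneg _).trans (hc 0 ⟨le_rfl, zero_le_one⟩))] at this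

theorem ae_hasDerivAt_dz {u : ℝ → ℝ} (h : AbsolutelyContinuousOnInterval u 0 1) :
    ∀ᵐ z ∂vol01, HasDerivAt u (dz u z) z := by
  have h1 := ae_restrict_of_ae (s := Ioo (0 : ℝ) 1) h.ae_differentiableAt
  filter_upwards [h1, ae_vol01_mem] with z hz hz'
  have hd := hz (by rw [uIcc_of_le zero_le_one]; exact Ioo_subset_Icc_self hz')
  have : dz u z = deriv u z := derivWithin_of_mem_nhds (Icc_mem_nhds hz'.1 hz'.2)
  rw [this]; exact hd.hasDerivAt

theorem ae_dz_eq_deriv (u : ℝ → ℝ) : dz u =ᵐ[vol01] deriv u := by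
  filter_upwards [ae_vol01_mem] with z hz
  exact derivWithin_of_mem_nhds (Icc_mem_nhds hz.1 hz.2)

theorem AC.continuousOn {u : ℝ → ℝ} (h : AbsolutelyContinuousOnInterval u 0 1) :
    ContinuousOn u (Icc 0 1) := by
  have := h.continuousOn
  rwa [uIcc_of_le zero_le_one] at this

theorem AC.congr {u v : ℝ → ℝ} (hu : AbsolutelyContinuousOnInterval u 0 1)
    (h : EqOn u v (Icc 0 1)) : AbsolutelyContinuousOnInterval v 0 1 := by
  rw [absolutelyContinuousOnInterval_iff] at hu ⊢
  intro ε hε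
  obtain ⟨δ, hδ, H⟩ := hu ε hε
  refine ⟨δ, hδ, fun E hE hl => ?_⟩
  convert H E hE hl using 1
  refine Finset.sum_congr rfl fun i hi => ?_
  have := hE.1 i hi
  rw [uIcc_of_le zero_le_one] at this
  rw [h this.1, h this.2]

/-- Absolute continuity only concerns sums of increments, so domination of increments transfers it
by squeezing. This covers both Lipschitz superposition and reciprocals. -/
theorem AC.of_dist_le {ι : Type*} {s : Finset ι} {u : ι → ℝ → ℝ} {v : ℝ → ℝ} {K : ℝ}
    (hu : ∀ i ∈ s, AbsolutelyContinuousOnInterval (u i) 0 1)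
    (h : ∀ x ∈ Icc (0 : ℝ) 1, ∀ y ∈ Icc (0 : ℝ) 1, |v x - v y| ≤ K * ∑ i ∈ s, |u i x - u i y|) :
    AbsolutelyContinuousOnInterval v 0 1 := by
  unfold AbsolutelyContinuousOnInterval at hu ⊢
  have hlim := (tendsto_finsetSum s fun i hi => hu i hi).const_mul K
  simp only [Finset.sum_const_zero, mul_zero] at hlim
  apply squeeze_zero' ?_ ?_ hlim
  · exact Eventually.of_forall fun _ => Finset.sum_nonneg fun i hi => dist_nonneg
  · rw [eventually_inf_principal]
    filter_upwards with E hE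
    rw [Finset.sum_comm, Finset.mul_sum]
    refine Finset.sum_le_sum fun i hi => ?_
    have := hE.1 i hi
    rw [uIcc_of_le zero_le_one] at this
    exact h _ this.1 _ this.2

theorem AC.ftc {u : ℝ → ℝ} (h : AbsolutelyContinuousOnInterval u 0 1) {a b : ℝ}
    (ha : a ∈ Icc (0 : ℝ) 1) (hb : b ∈ Icc (0 : ℝ) 1) : ∫ z in a..b, dz u z = u b - u a := by
  have hsub : uIcc a b ⊆ Icc 0 1 := uIcc_subset_Icc ha hb
  have h' : AbsolutelyContinuousOnInterval u a b :=
    h.mono (by rwa [uIcc_of_le (zero_le_one (α := ℝ))])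
  rw [← h'.integral_deriv_eq_sub]
  apply intervalIntegral.integral_congr_ae
  -- The one-sided `dz` and the two-sided `deriv` can differ only at the end points, a null set.
  have h0 : ∀ᵐ z : ℝ, z ≠ 0 := by simp [ae_iff]
  have h1 : ∀ᵐ z : ℝ, z ≠ 1 := by simp [ae_iff]
  filter_upwards [h0, h1] with z hz0 hz1 hz
  have hz' := hsub (uIoc_subset_uIcc hz)
  exact derivWithin_of_mem_nhds (Icc_mem_nhds (lt_of_le_of_ne hz'.1 (Ne.symm hz0))
    (lt_of_le_of_ne hz'.2 hz1))

/-! ### Calculus in `H¹(0,1)` and `H²(0,1)`. -/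

theorem MemH1.congr {u v : ℝ → ℝ} (hu : MemH1 u) (h : EqOn u v (Icc 0 1)) : MemH1 v :=
  ⟨AC.congr hu.1 h, hu.2.ae_eq (by
    filter_upwards [ae_vol01_mem_Icc] with z hz using dz_congr h hz)⟩

theorem MemH1.continuousOn {u : ℝ → ℝ} (hu : MemH1 u) : ContinuousOn u (Icc 0 1) :=
  AC.continuousOn hu.1

theorem MemH1.memLp {u : ℝ → ℝ} (hu : MemH1 u) : MemLp u 2 vol01 :=
  ContinuousOn.memLp_vol01 hu.continuousOn

theorem MemH1.of_integral {u f : ℝ → ℝ} {c : ℝ} (hf : MemLp f 2 vol01)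
    (h : ∀ z ∈ Icc (0 : ℝ) 1, u z = c + ∫ s in (0 : ℝ)..z, f s) :
    MemH1 u ∧ dz u =ᵐ[vol01] f := by
  have hac : AbsolutelyContinuousOnInterval (fun z => c + ∫ s in (0 : ℝ)..z, f s) 0 1 := by
    have h1 := (memLp_intervalIntegrable hf).absolutelyContinuousOnInterval_intervalIntegral
      (c := 0) (by simp)
    have h2 : AbsolutelyContinuousOnInterval (fun _ : ℝ => c) 0 1 :=
      (LipschitzWith.const c).lipschitzOnWith.absolutelyContinuousOnInterval
    exact h2.fun_add h1
  have hu : AbsolutelyContinuousOnInterval u 0 1 := AC.congr hac fun z hz => (h z hz).symm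
  have hd : dz u =ᵐ[vol01] f := by
    have h1 := (memLp_intervalIntegrable hf).ae_hasDerivAt_integral
    have h2 := ae_restrict_of_ae (s := Ioo (0 : ℝ) 1) h1
    filter_upwards [h2, ae_vol01_mem] with z hz hz'
    have hzI := Ioo_subset_Icc_self hz'
    have := (hz (by rwa [uIcc_of_le zero_le_one]) 0 (by simp)).const_add c
    have := this.hasDerivWithinAt (s := Icc 0 1)
    rw [dz_congr h hzI]
    exact HasDerivWithinAt.dz_eq this hzI
  exact ⟨⟨hu, hf.ae_eq hd.symm⟩, hd⟩

theorem hasDerivWithinAt_of_integral {u f : ℝ → ℝ} {c : ℝ} (hf : ContinuousOn f (Icc 0 1))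
    (h : ∀ z ∈ Icc (0 : ℝ) 1, u z = c + ∫ s in (0 : ℝ)..z, f s) {z : ℝ} (hz : z ∈ Icc (0 : ℝ) 1) :
    HasDerivWithinAt u (f z) (Icc 0 1) z := by
  -- This instance selects the version of the fundamental theorem relative to `Icc 0 1`, which also
  -- covers the end points.
  have : Fact (z ∈ Icc (0 : ℝ) 1) := ⟨hz⟩
  have h1 : HasDerivWithinAt (fun x => ∫ s in (0 : ℝ)..x, f s) (f z) (Icc 0 1) z := by
    apply intervalIntegral.integral_hasDerivWithinAt_right
    · exact (hf.mono (by rw [uIcc_of_le hz.1]; exact Icc_subset_Icc_right hz.2)).intervalIntegrable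
    · exact hf.stronglyMeasurableAtFilter_nhdsWithin measurableSet_Icc z
    · exact hf z hz
  exact (h1.const_add c).congr h (h z hz)

theorem MemH1.ftc {u : ℝ → ℝ} (hu : MemH1 u) {z : ℝ} (hz : z ∈ Icc (0 : ℝ) 1) :
    u z = u 0 + ∫ s in (0 : ℝ)..z, dz u s := by
  rw [AC.ftc hu.1 ⟨le_rfl, zero_le_one⟩ hz]; ring

/-- The derivative is continuous, so `u` is the primitive of a continuous function. Validity at the
end points is what makes the boundary conditions linear in the unknowns. -/
theorem MemH2.hasDerivWithinAt {u : ℝ → ℝ} (hu : MemH2 u) {z : ℝ} (hz : z ∈ Icc (0 : ℝ) 1) :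
    HasDerivWithinAt u (dz u z) (Icc 0 1) z :=
  hasDerivWithinAt_of_integral hu.2.continuousOn (fun _ h => hu.1.ftc h) hz

theorem MemH1.ae_hasDerivAt {u : ℝ → ℝ} (hu : MemH1 u) : ∀ᵐ z ∂vol01, HasDerivAt u (dz u z) z :=
  ae_hasDerivAt_dz hu.1

theorem HasDerivAt.dz_eq {u : ℝ → ℝ} {d z : ℝ} (h : HasDerivAt u d z)
    (hz : z ∈ Icc (0 : ℝ) 1) : dz u z = d := HasDerivWithinAt.dz_eq h.hasDerivWithinAt hz

theorem MemH1.const (c : ℝ) : MemH1 (fun _ => c) :=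
  (MemH1.of_integral (f := fun _ => 0) (c := c) (memLp_const 0) (by simp)).1

theorem dz_const (c : ℝ) : dz (fun _ => c) = fun _ => 0 := by
  ext z; simp [dz]

theorem MemH2.const (c : ℝ) : MemH2 (fun _ => c) := ⟨MemH1.const c, by
  rw [dz_const]; exact MemH1.const 0⟩

theorem MemH1.dz_add {u v : ℝ → ℝ} (hu : MemH1 u) (hv : MemH1 v) :
    dz (fun z => u z + v z) =ᵐ[vol01] fun z => dz u z + dz v z := by
  filter_upwards [hu.ae_hasDerivAt, hv.ae_hasDerivAt, ae_vol01_mem_Icc] with z h1 h2 hz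
  exact HasDerivAt.dz_eq (h1.add h2) hz

theorem MemH1.add {u v : ℝ → ℝ} (hu : MemH1 u) (hv : MemH1 v) : MemH1 (fun z => u z + v z) :=
  ⟨hu.1.fun_add hv.1, (hu.2.add hv.2).ae_eq (MemH1.dz_add hu hv).symm⟩

theorem MemH1.dz_const_mul {u : ℝ → ℝ} (c : ℝ) (hu : MemH1 u) :
    dz (fun z => c * u z) =ᵐ[vol01] fun z => c * dz u z := by
  filter_upwards [hu.ae_hasDerivAt, ae_vol01_mem_Icc] with z h1 hz
  exact HasDerivAt.dz_eq (h1.const_mul c) hz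

theorem MemH1.const_mul {u : ℝ → ℝ} (c : ℝ) (hu : MemH1 u) : MemH1 (fun z => c * u z) :=
  ⟨hu.1.const_mul c, (hu.2.const_mul c).ae_eq (MemH1.dz_const_mul c hu).symm⟩

theorem MemH1.dz_mul {u v : ℝ → ℝ} (hu : MemH1 u) (hv : MemH1 v) :
    dz (fun z => u z * v z) =ᵐ[vol01] fun z => dz u z * v z + u z * dz v z := by
  filter_upwards [hu.ae_hasDerivAt, hv.ae_hasDerivAt, ae_vol01_mem_Icc] with z h1 h2 hz
  exact HasDerivAt.dz_eq (h1.mul h2) hz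

theorem MemLp.mul_continuousOn {u v : ℝ → ℝ} (hu : MemLp u 2 vol01)
    (hv : ContinuousOn v (Icc 0 1)) : MemLp (fun z => v z * u z) 2 vol01 := by
  obtain ⟨C, hC⟩ := isCompact_Icc.exists_bound_of_continuousOn hv
  refine (nrm_mul_le (c := C) (ContinuousOn.memLp_vol01 hv).1 hu ?_ ?_).1
  · filter_upwards [ae_vol01_mem_Icc] with z hz using hC z hz
  · exact (norm_nonneg _).trans (hC 0 ⟨le_rfl, zero_le_one⟩)

theorem MemH1.mul {u v : ℝ → ℝ} (hu : MemH1 u) (hv : MemH1 v) : MemH1 (fun z => u z * v z) := by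
  refine ⟨hu.1.fun_mul hv.1, MemLp.ae_eq (MemH1.dz_mul hu hv).symm ?_⟩
  have h1 := MemLp.mul_continuousOn hu.2 hv.continuousOn
  have h2 := MemLp.mul_continuousOn hv.2 hu.continuousOn
  exact (h1.add h2).congr_norm (by
    exact (h1.add h2).1.congr (ae_of_all _ fun z => by simp [mul_comm])) (ae_of_all _ fun z => by
      simp [mul_comm])

theorem MemH1.sum {ι : Type*} {s : Finset ι} {u : ι → ℝ → ℝ} (hu : ∀ i ∈ s, MemH1 (u i)) :
    MemH1 (fun z => ∑ i ∈ s, u i z) ∧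
      dz (fun z => ∑ i ∈ s, u i z) =ᵐ[vol01] fun z => ∑ i ∈ s, dz (u i) z := by
  classical
  induction s using Finset.induction_on with
  | empty => simp only [Finset.sum_empty, dz_const]; exact ⟨MemH1.const 0, EventuallyEq.rfl⟩
  | insert a s ha ih =>
    have h1 := hu a (Finset.mem_insert_self a s)
    obtain ⟨h2, h3⟩ := ih fun i hi => hu i (Finset.mem_insert_of_mem hi)
    simp only [Finset.sum_insert ha]
    refine ⟨h1.add h2, (MemH1.dz_add h1 h2).trans ?_⟩
    filter_upwards [h3] with z hz
    rw [hz]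

theorem MemH1.integral_mul_dz {u v : ℝ → ℝ} (hu : MemH1 u) (hv : MemH1 v) :
    ∫ z, u z * dz v z ∂vol01 = u 1 * v 1 - u 0 * v 0 - ∫ z, dz u z * v z ∂vol01 := by
  have h := AC.ftc (hu.mul hv).1 (a := 0) (b := 1) (by simp) (by simp)
  rw [intervalIntegral_eq_vol01, integral_congr_ae (MemH1.dz_mul hu hv), integral_add] at h
  · linarith
  · have := memLp_two_integrable (MemLp.mul_continuousOn hu.2 hv.continuousOn)
    exact this.congr (ae_of_all _ fun z => by simp [mul_comm])
  · exact memLp_two_integrable (MemLp.mul_continuousOn hv.2 hu.continuousOn)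

theorem MemH1.abs_sub_le {u : ℝ → ℝ} (hu : MemH1 u) {a b : ℝ} (ha : a ∈ Icc (0 : ℝ) 1)
    (hb : b ∈ Icc (0 : ℝ) 1) : |u b - u a| ≤ nrm (dz u) := by
  rw [← AC.ftc hu.1 ha hb]; exact abs_intervalIntegral_le_nrm hu.2 ha hb

/-- A norm of `H¹(0,1)` that dominates the sup norm. -/
noncomputable def hnrm (u : ℝ → ℝ) : ℝ := |u 0| + nrm (dz u)

theorem hnrm_nonneg (u : ℝ → ℝ) : 0 ≤ hnrm u := add_nonneg (abs_nonneg _) (nrm_nonneg _)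

theorem MemH1.abs_le {u : ℝ → ℝ} (hu : MemH1 u) {z : ℝ} (hz : z ∈ Icc (0 : ℝ) 1) :
    |u z| ≤ hnrm u := by
  have h := hu.abs_sub_le (a := 0) (by simp) hz
  have h2 := abs_add_le (u 0) (u z - u 0)
  rw [add_sub_cancel] at h2
  exact h2.trans (by unfold hnrm; linarith)

theorem MemH1.nrm_le {u : ℝ → ℝ} (hu : MemH1 u) : nrm u ≤ hnrm u :=
  ContinuousOn.nrm_le hu.continuousOn fun _ => hu.abs_le

theorem MemH2.dz_add {u v : ℝ → ℝ} (hu : MemH2 u) (hv : MemH2 v) {z : ℝ}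
    (hz : z ∈ Icc (0 : ℝ) 1) : dz (fun z => u z + v z) z = dz u z + dz v z :=
  HasDerivWithinAt.dz_eq ((hu.hasDerivWithinAt hz).add (hv.hasDerivWithinAt hz)) hz

theorem MemH2.add {u v : ℝ → ℝ} (hu : MemH2 u) (hv : MemH2 v) : MemH2 (fun z => u z + v z) :=
  ⟨hu.1.add hv.1, (hu.2.add hv.2).congr fun _ hz => (MemH2.dz_add hu hv hz).symm⟩

theorem MemH2.dz_const_mul {u : ℝ → ℝ} (c : ℝ) (hu : MemH2 u) {z : ℝ}
    (hz : z ∈ Icc (0 : ℝ) 1) : dz (fun z => c * u z) z = c * dz u z :=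
  HasDerivWithinAt.dz_eq ((hu.hasDerivWithinAt hz).const_mul c) hz

theorem MemH2.const_mul {u : ℝ → ℝ} (c : ℝ) (hu : MemH2 u) : MemH2 (fun z => c * u z) :=
  ⟨hu.1.const_mul c, (hu.2.const_mul c).congr fun _ hz => (MemH2.dz_const_mul c hu hz).symm⟩

theorem MemH2.sum {ι : Type*} {s : Finset ι} {u : ι → ℝ → ℝ} (hu : ∀ i ∈ s, MemH2 (u i)) :
    MemH2 (fun z => ∑ i ∈ s, u i z) ∧
      ∀ z ∈ Icc (0 : ℝ) 1, dz (fun z => ∑ i ∈ s, u i z) z = ∑ i ∈ s, dz (u i) z := by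
  classical
  induction s using Finset.induction_on with
  | empty => simp only [Finset.sum_empty, dz_const]; exact ⟨MemH2.const 0, by simp⟩
  | insert a s ha ih =>
    have h1 := hu a (Finset.mem_insert_self a s)
    obtain ⟨h2, h3⟩ := ih fun i hi => hu i (Finset.mem_insert_of_mem hi)
    simp only [Finset.sum_insert ha]
    exact ⟨h1.add h2, fun z hz => (MemH2.dz_add h1 h2 hz).trans (by rw [h3 z hz])⟩

theorem MemH2.dz_dz_add {u v : ℝ → ℝ} (hu : MemH2 u) (hv : MemH2 v) :
    dz (dz (fun z => u z + v z)) =ᵐ[vol01] fun z => dz (dz u) z + dz (dz v) z := by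
  refine EventuallyEq.trans ?_ (MemH1.dz_add hu.2 hv.2)
  filter_upwards [ae_vol01_mem_Icc] with z hz
  exact dz_congr (fun y hy => MemH2.dz_add hu hv hy) hz

theorem MemH2.dz_dz_const_mul {u : ℝ → ℝ} (c : ℝ) (hu : MemH2 u) :
    dz (dz (fun z => c * u z)) =ᵐ[vol01] fun z => c * dz (dz u) z := by
  refine EventuallyEq.trans ?_ (MemH1.dz_const_mul c hu.2)
  filter_upwards [ae_vol01_mem_Icc] with z hz
  exact dz_congr (fun y hy => MemH2.dz_const_mul c hu hy) hz

end Rothe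

namespace Rothe

open Filter Topology

/-! ### Linear boundary value problems -/

/-- Picard iteration in an exponentially weighted sup norm contracts on the whole interval at once,
so no continuation of local solutions is needed. -/
theorem exists_linear_ode {E : Type*} [NormedAddCommGroup E] [NormedSpace ℝ E] [CompleteSpace E]
    {A : ℝ → E →L[ℝ] E} {b : ℝ → E} (hA : ContinuousOn A (Icc 0 1)) (hb : ContinuousOn b (Icc 0 1))
    (y0 : E) : ∃ y : ℝ → E, y 0 = y0 ∧
      ∀ t ∈ Icc (0 : ℝ) 1, HasDerivWithinAt y (A t (y t) + b t) (Icc 0 1) t := by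
  obtain ⟨K, hK⟩ := isCompact_Icc.exists_bound_of_continuousOn hA
  have hK0 : 0 ≤ K := (norm_nonneg _).trans (hK 0 (by simp))
  -- Projecting the time onto `[0,1]` extends the coefficients to continuous functions on the line.
  set P : ℝ → ℝ := fun t => (projIcc (0 : ℝ) 1 zero_le_one t : ℝ) with hP
  have hPc : Continuous P := continuous_subtype_val.comp continuous_projIcc
  have hPm : ∀ t, P t ∈ Icc (0 : ℝ) 1 := fun t => (projIcc (0 : ℝ) 1 zero_le_one t).2
  have hPe : ∀ t ∈ Icc (0 : ℝ) 1, P t = t := fun t ht => by simp [hP, projIcc_of_mem _ ht]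
  have hAc : Continuous fun t => A (P t) := hA.comp_continuous hPc hPm
  have hbc : Continuous fun t => b (P t) := hb.comp_continuous hPc hPm
  -- Any weight exceeding the bound `K` of `A` works: the contraction factor is `K / a`.
  set a : ℝ := K + 1 with ha
  have ha0 : 0 < a := by positivity
  let ext : C(Icc (0 : ℝ) 1, E) → ℝ → E := fun x => IccExtend zero_le_one x
  have hext : ∀ x, Continuous (ext x) := fun x => x.continuous.Icc_extend'
  -- The unknown is the rescaled function `x(t) = exp(-a t) y(t)`, so the weighted norm of `y`
  -- becomes the ordinary sup norm of `x`.
  let g : C(Icc (0 : ℝ) 1, E) → ℝ → E := fun x s =>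
    Real.exp (a * s) • A (P s) (ext x s) + b (P s)
  have hg : ∀ x, Continuous (g x) := fun x =>
    ((by fun_prop : Continuous fun s : ℝ => Real.exp (a * s)).smul
      (hAc.clm_apply (hext x))).add hbc
  have hgi : ∀ x u v, IntervalIntegrable (g x) volume u v := fun x u v =>
    (hg x).intervalIntegrable u v
  let T : C(Icc (0 : ℝ) 1, E) → C(Icc (0 : ℝ) 1, E) := fun x =>
    ⟨fun t => Real.exp (-(a * t)) • (y0 + ∫ s in (0 : ℝ)..t, g x s), by
      have h1 : Continuous fun t : ℝ => ∫ s in (0 : ℝ)..t, g x s :=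
        intervalIntegral.continuous_primitive (hgi x) 0
      have h2 : Continuous fun t : ℝ => Real.exp (-(a * t)) • (y0 + ∫ s in (0 : ℝ)..t, g x s) :=
        (by fun_prop : Continuous fun t : ℝ => Real.exp (-(a * t))).smul (continuous_const.add h1)
      exact h2.comp continuous_subtype_val⟩
  have hT : ∀ x x', dist (T x) (T x') ≤ K / a * dist x x' := by
    intro x x'
    rw [ContinuousMap.dist_le (by positivity)]
    rintro ⟨t, ht⟩
    set D := dist x x'
    have hD : ∀ s, ‖ext x s - ext x' s‖ ≤ D := fun s => by
      rw [← dist_eq_norm]; exact ContinuousMap.dist_apply_le_dist _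
    have h1 : dist (T x ⟨t, ht⟩) (T x' ⟨t, ht⟩)
        = Real.exp (-(a * t)) * ‖∫ s in (0 : ℝ)..t, (g x s - g x' s)‖ := by
      rw [intervalIntegral.integral_sub (hgi x 0 t) (hgi x' 0 t), dist_eq_norm]
      change ‖Real.exp (-(a * t)) • (y0 + ∫ s in (0 : ℝ)..t, g x s)
        - Real.exp (-(a * t)) • (y0 + ∫ s in (0 : ℝ)..t, g x' s)‖ = _
      rw [← smul_sub, norm_smul, add_sub_add_left_eq_sub, Real.norm_eq_abs, Real.abs_exp]
    have h2 : ‖∫ s in (0 : ℝ)..t, (g x s - g x' s)‖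
        ≤ ∫ s in (0 : ℝ)..t, K * D * Real.exp (a * s) := by
      apply intervalIntegral.norm_integral_le_of_norm_le ht.1
      · refine ae_of_all _ fun s _ => ?_
        have : g x s - g x' s = Real.exp (a * s) • A (P s) (ext x s - ext x' s) := by
          simp only [g, map_sub, smul_sub]; abel
        rw [this, norm_smul, Real.norm_eq_abs, Real.abs_exp, mul_comm]
        refine mul_le_mul_of_nonneg_right ?_ (Real.exp_pos _).le
        exact ((A (P s)).le_opNorm _).trans
          (mul_le_mul (hK _ (hPm s)) (hD s) (norm_nonneg _) hK0)
      · exact Continuous.intervalIntegrable (by fun_prop) _ _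
    have h3 : ∫ s in (0 : ℝ)..t, K * D * Real.exp (a * s)
        = K * D * ((Real.exp (a * t) - 1) / a) := by
      rw [intervalIntegral.integral_const_mul, intervalIntegral.integral_comp_mul_left _ ha0.ne']
      simp [div_eq_inv_mul]
    rw [h1]
    calc Real.exp (-(a * t)) * ‖∫ s in (0 : ℝ)..t, (g x s - g x' s)‖
        ≤ Real.exp (-(a * t)) * (K * D * ((Real.exp (a * t) - 1) / a)) := by
          rw [← h3]; gcongr
      _ = K / a * D * (1 - Real.exp (-(a * t))) := by
          have : Real.exp (-(a * t)) * Real.exp (a * t) = 1 := by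
            rw [← Real.exp_add]; simp
          field_simp
          linear_combination K * D * this
      _ ≤ K / a * D * 1 := by
          have := (Real.exp_pos (-(a * t))).le
          gcongr; linarith
      _ = K / a * D := mul_one _
  have hc : ContractingWith ⟨K / a, by positivity⟩ T :=
    ⟨by show K / a < 1; rw [div_lt_one ha0]; linarith,
      LipschitzWith.of_dist_le_mul hT⟩
  obtain ⟨x, hx⟩ : ∃ x, T x = x := ⟨_, hc.fixedPoint_isFixedPt⟩
  have hxt : ∀ t ∈ Icc (0 : ℝ) 1,
      Real.exp (a * t) • ext x t = y0 + ∫ s in (0 : ℝ)..t, g x s := by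
    intro t ht
    have h1 : ext x t = Real.exp (-(a * t)) • (y0 + ∫ s in (0 : ℝ)..t, g x s) := by
      have : ext x t = x ⟨t, ht⟩ := IccExtend_of_mem zero_le_one x ht
      rw [this]; conv_lhs => rw [← hx]
      rfl
    rw [h1, smul_smul, ← Real.exp_add]; simp
  refine ⟨fun t => y0 + ∫ s in (0 : ℝ)..t, g x s, by simp, fun t ht => ?_⟩
  have h1 : HasDerivAt (fun t => y0 + ∫ s in (0 : ℝ)..t, g x s) (g x t) t :=
    (intervalIntegral.integral_hasDerivAt_right (hgi x 0 t)
      ((hg x).stronglyMeasurableAtFilter _ _) (hg x).continuousAt).const_add y0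
  have h2 : g x t = A t (y0 + ∫ s in (0 : ℝ)..t, g x s) + b t := by
    rw [← hxt t ht]
    simp only [g, hPe t ht, map_smul]
  rw [← h2]
  exact h1.hasDerivWithinAt

/-- Fredholm alternative by shooting: solutions are parametrised by their initial value, and the
boundary operator becomes a linear endomorphism of a finite-dimensional space. Uniqueness makes it
injective, hence surjective; a particular solution takes care of `b`. -/
theorem exists_linear_bvp {E : Type*} [NormedAddCommGroup E] [NormedSpace ℝ E]
    [FiniteDimensional ℝ E] {A : ℝ → E →L[ℝ] E} {b : ℝ → E} (hA : ContinuousOn A (Icc 0 1))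
    (hb : ContinuousOn b (Icc 0 1)) (L0 L1 : E →ₗ[ℝ] E)
    (hu : ∀ y : ℝ → E, (∀ t ∈ Icc (0 : ℝ) 1, HasDerivWithinAt y (A t (y t)) (Icc 0 1) t) →
      L0 (y 0) + L1 (y 1) = 0 → y 0 = 0) (c : E) :
    ∃ y : ℝ → E, (∀ t ∈ Icc (0 : ℝ) 1, HasDerivWithinAt y (A t (y t) + b t) (Icc 0 1) t) ∧
      L0 (y 0) + L1 (y 1) = c := by
  have : CompleteSpace E := FiniteDimensional.complete ℝ E
  let B := Module.finBasis ℝ E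
  choose Y hY0 hY using fun i => exists_linear_ode hA (continuousOn_const (c := (0 : E))) (B i)
  obtain ⟨yp, hyp0, hyp⟩ := exists_linear_ode hA hb (0 : E)
  let Φ : E →ₗ[ℝ] (ℝ → E) := B.constr ℝ Y
  have hΦ : ∀ x t, Φ x t = ∑ i, B.repr x i • Y i t := fun x t => by
    simp [Φ, Module.Basis.constr_apply_fintype, Module.Basis.equivFun_apply]
  have hΦ0 : ∀ x, Φ x 0 = x := fun x => by
    rw [hΦ]; simp_rw [hY0]; exact B.sum_repr x
  have hΦd : ∀ x, ∀ t ∈ Icc (0 : ℝ) 1, HasDerivWithinAt (Φ x) (A t (Φ x t)) (Icc 0 1) t := by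
    intro x t ht
    have h1 : HasDerivWithinAt (fun t => ∑ i, B.repr x i • Y i t)
        (∑ i, B.repr x i • A t (Y i t)) (Icc 0 1) t :=
      HasDerivWithinAt.fun_sum fun i _ => by
        have := (hY i t ht).const_smul (B.repr x i)
        rw [add_zero] at this; exact this
    have h2 : Φ x = fun t => ∑ i, B.repr x i • Y i t := funext (hΦ x)
    rw [h2]; simpa using h1
  let S : E →ₗ[ℝ] E := L0 + L1 ∘ₗ (LinearMap.proj (1 : ℝ)) ∘ₗ Φ
  have hS : ∀ x, S x = L0 x + L1 (Φ x 1) := fun x => rfl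
  have hinj : Function.Injective S := by
    rw [injective_iff_map_eq_zero]
    intro x hx
    rw [hS] at hx
    have := hu (Φ x) (hΦd x) (by rw [hΦ0]; exact hx)
    rwa [hΦ0] at this
  obtain ⟨x, hx⟩ := (LinearMap.injective_iff_surjective.1 hinj) (c - L1 (yp 1))
  refine ⟨fun t => Φ x t + yp t, fun t ht => ?_, ?_⟩
  · have := (hΦd x t ht).add (hyp t ht)
    rw [map_add, add_assoc]
    exact this
  · simp only [hΦ0, hyp0, add_zero, map_add]
    rw [hS] at hx
    rw [← add_assoc, hx]; abel

theorem MemH1.of_hasDerivWithinAt {u f : ℝ → ℝ} (hf : ContinuousOn f (Icc 0 1))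
    (h : ∀ z ∈ Icc (0 : ℝ) 1, HasDerivWithinAt u (f z) (Icc 0 1) z) :
    MemH1 u ∧ ∀ z ∈ Icc (0 : ℝ) 1, dz u z = f z := by
  have hd : ∀ z ∈ Icc (0 : ℝ) 1, dz u z = f z := fun z hz => HasDerivWithinAt.dz_eq (h z hz) hz
  refine ⟨⟨?_, ?_⟩, hd⟩
  · obtain ⟨C, hC⟩ := isCompact_Icc.exists_bound_of_continuousOn hf
    have := (convex_Icc (0 : ℝ) 1).lipschitzOnWith_of_nnnorm_hasDerivWithin_le
      (C := ⟨max C 0, le_max_right _ _⟩) h fun z hz => by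
        change ‖f z‖ ≤ max C 0; exact (hC z hz).trans (le_max_left _ _)
    exact LipschitzOnWith.absolutelyContinuousOnInterval (by rwa [uIcc_of_le zero_le_one])
  · exact ContinuousOn.memLp_vol01 (hf.congr hd)

/-- The second unknown is the flux `ρ = G u' - ∑ e u + F`. In this form neither `e` nor `F` has to
be differentiated in the first-order system, so coefficients that are merely in `H¹` are admitted.
-/
theorem memH2_of_first_order {ι : Type*} [Fintype ι] {G : ι → ℝ} (hG : ∀ m, 0 < G m)
    {Cm : ι → ι → ℝ} {e : ι → ι → ℝ → ℝ} (he : ∀ m j, MemH1 (e m j)) {F : ι → ℝ → ℝ}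
    (hF : ∀ m, MemH1 (F m)) {u ρ : ι → ℝ → ℝ}
    (hu : ∀ m, ∀ z ∈ Icc (0 : ℝ) 1,
      HasDerivWithinAt (u m) ((ρ m z + ∑ j, e m j z * u j z - F m z) / G m) (Icc 0 1) z)
    (hρ : ∀ m, ∀ z ∈ Icc (0 : ℝ) 1,
      HasDerivWithinAt (ρ m) (∑ j, Cm m j * u j z) (Icc 0 1) z) (m : ι) :
    MemH2 (u m) ∧ (∀ z ∈ Icc (0 : ℝ) 1,
        dz (u m) z = (ρ m z + ∑ j, e m j z * u j z - F m z) / G m) ∧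
      ∀ᵐ z ∂vol01, ∑ j, Cm m j * u j z - G m * dz (dz (u m)) z
        + ∑ j, dz (fun y => e m j y * u j y) z = dz (F m) z := by
  have huc : ∀ m, ContinuousOn (u m) (Icc 0 1) := fun m z hz => (hu m z hz).continuousWithinAt
  have hρc : ∀ m, ContinuousOn (ρ m) (Icc 0 1) := fun m z hz => (hρ m z hz).continuousWithinAt
  have hu1 : ∀ m, MemH1 (u m) ∧ ∀ z ∈ Icc (0 : ℝ) 1,
      dz (u m) z = (ρ m z + ∑ j, e m j z * u j z - F m z) / G m := fun m =>
    MemH1.of_hasDerivWithinAt ((((hρc m).add (continuousOn_finsetSum _ fun j _ =>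
      (he m j).continuousOn.mul (huc j))).sub (hF m).continuousOn).div_const _) (hu m)
  have hρ1 : ∀ m, MemH1 (ρ m) ∧ ∀ z ∈ Icc (0 : ℝ) 1, dz (ρ m) z = ∑ j, Cm m j * u j z := fun m =>
    MemH1.of_hasDerivWithinAt (continuousOn_finsetSum _ fun j _ => (huc j).const_mul _) (hρ m)
  have hS := MemH1.sum (s := Finset.univ) (u := fun j z => e m j z * u j z)
    fun j _ => (he m j).mul (hu1 j).1
  have hR := (hρ1 m).1.add hS.1
  have hT := hR.add ((hF m).const_mul (-1))
  have hU := hT.const_mul (G m)⁻¹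
  have heq : EqOn (fun z => (G m)⁻¹ * (ρ m z + ∑ j, e m j z * u j z + -1 * F m z)) (dz (u m))
      (Icc 0 1) := fun z hz => by
    rw [(hu1 m).2 z hz, div_eq_inv_mul]; ring
  refine ⟨⟨(hu1 m).1, hU.congr heq⟩, (hu1 m).2, ?_⟩
  filter_upwards [ae_vol01_mem_Icc, MemH1.dz_const_mul (G m)⁻¹ hT,
    MemH1.dz_add hR ((hF m).const_mul (-1)), MemH1.dz_add (hρ1 m).1 hS.1,
    MemH1.dz_const_mul (-1) (hF m), hS.2] with z hz h1 h2 h3 h4 h5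
  rw [← dz_congr heq hz, h1, h2, h3, h4, h5, (hρ1 m).2 z hz]
  have := (hG m).ne'
  field_simp
  ring

theorem exists_elliptic {ι : Type*} [Fintype ι] {G : ι → ℝ} (hG : ∀ m, 0 < G m)
    {Cm R : ι → ι → ℝ} {e : ι → ι → ℝ → ℝ} (he : ∀ m j, MemH1 (e m j)) {f : ι → ℝ → ℝ}
    (hf : ∀ m, MemLp (f m) 2 vol01) {p q : ι → ℝ} (g b : ι → ℝ)
    (huniq : ∀ u : ι → ℝ → ℝ, (∀ m, MemH2 (u m)) →
      (∀ m, ∀ᵐ z ∂vol01, ∑ j, Cm m j * u j z - G m * dz (dz (u m)) z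
        + ∑ j, dz (fun y => e m j y * u j y) z = 0) →
      (∀ m, p m * u m 0 + q m * dz (u m) 0 = 0) → (∀ m, dz (u m) 1 = ∑ j, R m j * u j 1) →
      ∀ m, ∀ z ∈ Icc (0 : ℝ) 1, u m z = 0) :
    ∃ u : ι → ℝ → ℝ, (∀ m, MemH2 (u m)) ∧
      (∀ m, ∀ᵐ z ∂vol01, ∑ j, Cm m j * u j z - G m * dz (dz (u m)) z
        + ∑ j, dz (fun y => e m j y * u j y) z = f m z) ∧
      (∀ m, p m * u m 0 + q m * dz (u m) 0 = g m) ∧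
      (∀ m, dz (u m) 1 = ∑ j, R m j * u j 1 + b m) := by
  let A : ℝ → ((ι → ℝ) × (ι → ℝ)) →L[ℝ] ((ι → ℝ) × (ι → ℝ)) := fun z => LinearMap.toContinuousLinearMap
    { toFun := fun y => (fun m => (y.2 m + ∑ j, e m j z * y.1 j) / G m,
        fun m => ∑ j, Cm m j * y.1 j)
      map_add' := fun x y => by
        ext m <;> simp [mul_add, Finset.sum_add_distrib] <;> ring
      map_smul' := fun c y => by
        ext m
        · simp only [Prod.smul_fst, Prod.smul_snd, Pi.smul_apply, smul_eq_mul, RingHom.id_apply,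
            mul_left_comm _ c, ← Finset.mul_sum]; ring
        · simp only [Prod.smul_fst, Prod.smul_snd, Pi.smul_apply, smul_eq_mul, RingHom.id_apply,
            mul_left_comm _ c, ← Finset.mul_sum] }
  have hA1 : ∀ z (y : ((ι → ℝ) × (ι → ℝ))) m, (A z y).1 m = (y.2 m + ∑ j, e m j z * y.1 j) / G m :=
    fun _ _ _ => rfl
  have hA2 : ∀ z (y : ((ι → ℝ) × (ι → ℝ))) m, (A z y).2 m = ∑ j, Cm m j * y.1 j := fun _ _ _ => rfl
  have hAc : ContinuousOn A (Icc 0 1) := by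
    rw [continuousOn_clm_apply]
    intro y
    refine ContinuousOn.prodMk ?_ ?_
    · refine continuousOn_pi.2 fun m => ?_
      exact (continuousOn_const.add (continuousOn_finsetSum _ fun j _ =>
        (he m j).continuousOn.mul continuousOn_const)).div_const _
    · exact continuousOn_const
  -- Absorbing a primitive of `f` into the flux leaves a continuous inhomogeneity even though `f` is
  -- only in `L²`.
  let F : ι → ℝ → ℝ := fun m z => ∫ s in (0 : ℝ)..z, f m s
  have hF : ∀ m, MemH1 (F m) ∧ dz (F m) =ᵐ[vol01] f m := fun m =>
    MemH1.of_integral (c := 0) (hf m) fun z _ => by simp [F]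
  have hF0 : ∀ m, F m 0 = 0 := fun m => by simp [F]
  let b' : ℝ → ((ι → ℝ) × (ι → ℝ)) := fun z => (fun m => -F m z / G m, 0)
  have hb' : ContinuousOn b' (Icc 0 1) :=
    ContinuousOn.prodMk (continuousOn_pi.2 fun m => (hF m).1.continuousOn.neg.div_const _)
      continuousOn_const
  let P1 : ((ι → ℝ) × (ι → ℝ)) →ₗ[ℝ] (ι → ℝ) := LinearMap.fst ℝ _ _
  let D : ℝ → ((ι → ℝ) × (ι → ℝ)) →ₗ[ℝ] (ι → ℝ) := fun z => LinearMap.fst ℝ _ _ ∘ₗ (A z : ((ι → ℝ) × (ι → ℝ)) →ₗ[ℝ] ((ι → ℝ) × (ι → ℝ)))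
  -- The left conditions fill the first factor and the right ones the second, so the number of
  -- conditions equals the dimension.
  let L0 : ((ι → ℝ) × (ι → ℝ)) →ₗ[ℝ] ((ι → ℝ) × (ι → ℝ)) := LinearMap.inl ℝ _ _ ∘ₗ
    (LinearMap.pi fun m => p m • (LinearMap.proj m ∘ₗ P1) + q m • (LinearMap.proj m ∘ₗ D 0))
  let L1 : ((ι → ℝ) × (ι → ℝ)) →ₗ[ℝ] ((ι → ℝ) × (ι → ℝ)) := LinearMap.inr ℝ _ _ ∘ₗ
    (LinearMap.pi fun m => LinearMap.proj m ∘ₗ D 1 - ∑ j, R m j • (LinearMap.proj j ∘ₗ P1))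
  have hL : ∀ (y y' c : ((ι → ℝ) × (ι → ℝ))), L0 y + L1 y' = c ↔
      (∀ m, p m * y.1 m + q m * (A 0 y).1 m = c.1 m) ∧
      (∀ m, (A 1 y').1 m - ∑ j, R m j * y'.1 j = c.2 m) := by
    intro y y' c
    rw [Prod.ext_iff, funext_iff, funext_iff]
    simp [L0, L1, P1, D]
  have hcomp : ∀ (y : ℝ → ((ι → ℝ) × (ι → ℝ))) (y' : ((ι → ℝ) × (ι → ℝ))) z, HasDerivWithinAt y y' (Icc 0 1) z →
      (∀ m, HasDerivWithinAt (fun t => (y t).1 m) (y'.1 m) (Icc 0 1) z) ∧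
      (∀ m, HasDerivWithinAt (fun t => (y t).2 m) (y'.2 m) (Icc 0 1) z) := by
    intro y y' z h
    have h1 : HasDerivWithinAt (fun t => (y t).1) y'.1 (Icc 0 1) z :=
      (ContinuousLinearMap.fst ℝ (ι → ℝ) (ι → ℝ)).hasFDerivAt.comp_hasDerivWithinAt z h
    have h2 : HasDerivWithinAt (fun t => (y t).2) y'.2 (Icc 0 1) z :=
      (ContinuousLinearMap.snd ℝ (ι → ℝ) (ι → ℝ)).hasFDerivAt.comp_hasDerivWithinAt z h
    exact ⟨hasDerivWithinAt_pi.1 h1, hasDerivWithinAt_pi.1 h2⟩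
  obtain ⟨y, hy, hyb⟩ := exists_linear_bvp hAc hb' L0 L1 (by
    intro y hy hyb
    rw [hL] at hyb
    have key := memH2_of_first_order hG (Cm := Cm) he (F := fun _ _ => 0)
      (fun _ => MemH1.const 0) (u := fun m z => (y z).1 m) (ρ := fun m z => (y z).2 m)
      (fun m z hz => by simpa [hA1] using (hcomp y _ z (hy z hz)).1 m)
      (fun m z hz => by simpa [hA2] using (hcomp y _ z (hy z hz)).2 m)
    have hz := huniq (fun m z => (y z).1 m) (fun m => (key m).1)
      (fun m => by simpa [dz_const] using (key m).2.2)
      (fun m => by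
        rw [(key m).2.1 0 (by simp)]
        simpa [hA1] using hyb.1 m)
      (fun m => by
        rw [(key m).2.1 1 (by simp)]
        simpa [hA1, sub_eq_zero] using hyb.2 m)
    -- The hypothesis only annihilates `u`; the initial flux vanishes as well, since `u = 0` on the
    -- interval forces `u'(0) = 0`.
    have h0 : (y 0).1 = 0 := funext fun m => hz m 0 (by simp)
    refine Prod.ext h0 (funext fun m => ?_)
    have h1 : dz (fun z => (y z).1 m) 0 = 0 := by
      rw [dz_congr (v := fun _ => (0 : ℝ)) (fun z hz' => hz m z hz') (by simp), dz_const]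
    rw [(key m).2.1 0 (by simp)] at h1
    simpa [h0, (hG m).ne'] using h1) (g, fun m => b m + F m 1 / G m)
  rw [hL] at hyb
  have key := memH2_of_first_order hG (Cm := Cm) he (fun m => (hF m).1)
    (u := fun m z => (y z).1 m) (ρ := fun m z => (y z).2 m)
    (fun m z hz => by
      have := (hcomp y _ z (hy z hz)).1 m
      simp only [Prod.fst_add, Pi.add_apply, hA1, b'] at this
      convert this using 1; ring)
    (fun m z hz => by simpa [hA2, b'] using (hcomp y _ z (hy z hz)).2 m)
  refine ⟨fun m z => (y z).1 m, fun m => (key m).1, fun m => ?_, fun m => ?_, fun m => ?_⟩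
  · filter_upwards [(key m).2.2, (hF m).2] with z h1 h2
    rw [h1, h2]
  · rw [(key m).2.1 0 (by simp)]
    simpa [hA1, hF0] using hyb.1 m
  · rw [(key m).2.1 1 (by simp)]
    have := hyb.2 m
    rw [hA1] at this
    simp only at this
    rw [sub_div]
    linarith

end Rothe

namespace Rothe

open Filter Topology

/-! ### Superposition with Lipschitz coefficients -/

/-- Fractions with values in the open unit cube. -/
def InCube {n : ℕ} (φ : Comp n → ℝ → ℝ) : Prop :=
  ∀ z ∈ Icc (0 : ℝ) 1, ∀ l, φ l z ∈ Ioo (0 : ℝ) 1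

/-- Sum of the norms of the gradients. -/
noncomputable def gradNrm {n : ℕ} (φ : Comp n → ℝ → ℝ) : ℝ := ∑ k, nrm (dz (φ k))

theorem gradNrm_nonneg {n : ℕ} (φ : Comp n → ℝ → ℝ) : 0 ≤ gradNrm φ :=
  Finset.sum_nonneg fun _ _ => nrm_nonneg _

section Coeff

variable {n : ℕ} (f : Coeff n) {φ : Comp n → ℝ → ℝ}

theorem Coeff.ac_comp (hφ : ∀ l, MemH1 (φ l)) (hc : InCube φ) :
    AbsolutelyContinuousOnInterval (fun y => f (fun k => φ k y)) 0 1 :=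
  AC.of_dist_le (K := f.bd) (s := Finset.univ) (u := φ) (fun i _ => (hφ i).1)
    fun x hx y hy => f.lip _ _ (hc x hx) (hc y hy)

/-- The coefficient is only Lipschitz, so there is no chain rule. At points where the composition
and all fractions are differentiable, the Lipschitz bound for difference quotients passes to the
limit. -/
theorem Coeff.ae_dz_comp_le (hφ : ∀ l, MemH1 (φ l)) (hc : InCube φ) :
    ∀ᵐ z ∂vol01, |dz (fun y => f (fun k => φ k y)) z| ≤ f.bd * ∑ k, |dz (φ k) z| := by
  have h1 : ∀ᵐ z ∂vol01, ∀ k, HasDerivAt (φ k) (dz (φ k) z) z :=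
    ae_all_iff.2 fun k => (hφ k).ae_hasDerivAt
  filter_upwards [h1, ae_hasDerivAt_dz (f.ac_comp hφ hc), ae_vol01_mem] with z hz hz' hm
  have t1 := hz'.tendsto_slope.abs
  have t2 : Tendsto (fun y => f.bd * ∑ k, |slope (φ k) z y|) (𝓝[≠] z)
      (𝓝 (f.bd * ∑ k, |dz (φ k) z|)) :=
    (tendsto_finsetSum _ fun k _ => (hz k).tendsto_slope.abs).const_mul _
  refine le_of_tendsto_of_tendsto t1 t2 ?_
  have : ∀ᶠ y in 𝓝[≠] z, y ∈ Icc (0 : ℝ) 1 :=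
    nhdsWithin_le_nhds (Icc_mem_nhds hm.1 hm.2)
  filter_upwards [this] with y hy
  have hl := f.lip _ _ (hc y hy) (hc z (Ioo_subset_Icc_self hm))
  simp only [slope_def_field, abs_div, ← Finset.sum_div]
  rw [← mul_div_assoc]
  gcongr

theorem Coeff.memH1_comp (hφ : ∀ l, MemH1 (φ l)) (hc : InCube φ) :
    MemH1 (fun y => f (fun k => φ k y)) ∧
      nrm (dz fun y => f (fun k => φ k y)) ≤ f.bd * gradNrm φ := by
  have hm : AEStronglyMeasurable (dz fun y => f (fun k => φ k y)) vol01 :=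
    (measurable_deriv _).aestronglyMeasurable.congr (ae_dz_eq_deriv _).symm
  have hs : ∀ k ∈ (Finset.univ : Finset (Comp n)), MemLp (fun z => |dz (φ k) z|) 2 vol01 :=
    fun k _ => (hφ k).2.abs
  have hS : MemLp (fun z => f.bd * ∑ k, |dz (φ k) z|) 2 vol01 :=
    (memLp_finsetSum _ hs).const_mul _
  have h := nrm_mono hm hS (by
    filter_upwards [f.ae_dz_comp_le hφ hc] with z hz using hz.trans (le_abs_self _))
  refine ⟨⟨f.ac_comp hφ hc, h.1⟩, h.2.trans ?_⟩
  rw [nrm_const_mul, abs_of_pos f.bd_pos]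
  refine mul_le_mul_of_nonneg_left ((nrm_sum_le hs).trans (le_of_eq ?_)) f.bd_pos.le
  exact Finset.sum_congr rfl fun k _ => lpNorm_fun_abs (hφ k).2.1 2

theorem Coeff.abs_comp_le (hc : InCube φ) {z : ℝ} (hz : z ∈ Icc (0 : ℝ) 1) :
    |f (fun k => φ k z)| ≤ f.bd := f.abs_le _ (hc z hz)

theorem Coeff.nrm_mul_le (hφ : ∀ l, MemH1 (φ l)) (hc : InCube φ) {g : ℝ → ℝ}
    (hg : MemLp g 2 vol01) : MemLp (fun y => f (fun k => φ k y) * g y) 2 vol01 ∧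
      nrm (fun y => f (fun k => φ k y) * g y) ≤ f.bd * nrm g :=
  Rothe.nrm_mul_le (f.memH1_comp hφ hc).1.memLp.1 hg (by
    filter_upwards [ae_vol01_mem_Icc] with z hz using f.abs_comp_le hc hz) f.bd_pos.le

theorem Coeff.memLp_comp (hφ : ∀ l, MemH1 (φ l)) (hc : InCube φ) :
    MemLp (fun y => f (fun k => φ k y)) 2 vol01 ∧ nrm (fun y => f (fun k => φ k y)) ≤ f.bd :=
  ⟨(f.memH1_comp hφ hc).1.memLp,
    ContinuousOn.nrm_le (f.memH1_comp hφ hc).1.continuousOn fun _ hz => f.abs_comp_le hc hz⟩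

/-- The derivative of the composition is only in `L²`, so the factor `g` has to be estimated in the
sup norm. -/
theorem Coeff.nrm_dz_comp_mul_le (hφ : ∀ l, MemH1 (φ l)) (hc : InCube φ) {g : ℝ → ℝ}
    (hg : MemH1 g) :
    nrm (fun z => dz (fun y => f (fun k => φ k y)) z * g z) ≤ f.bd * gradNrm φ * hnrm g := by
  have h := (f.memH1_comp hφ hc)
  have := (Rothe.nrm_mul_le (u := g) hg.memLp.1 h.1.2 (c := hnrm g) (by
    filter_upwards [ae_vol01_mem_Icc] with z hz using hg.abs_le hz) (hnrm_nonneg g)).2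
  calc nrm (fun z => dz (fun y => f (fun k => φ k y)) z * g z)
      = nrm (fun z => g z * dz (fun y => f (fun k => φ k y)) z) := by
        congr 1; ext z; ring
    _ ≤ hnrm g * (f.bd * gradNrm φ) :=
        this.trans (mul_le_mul_of_nonneg_left h.2 (hnrm_nonneg g))
    _ = _ := by ring

theorem Coeff.nrm_dz_mul_le (hφ : ∀ l, MemH1 (φ l)) (hc : InCube φ) {g : ℝ → ℝ} (hg : MemH1 g) :
    MemH1 (fun y => f (fun k => φ k y) * g y) ∧
      nrm (dz fun y => f (fun k => φ k y) * g y)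
        ≤ f.bd * nrm (dz g) + f.bd * gradNrm φ * hnrm g := by
  have h := (f.memH1_comp hφ hc).1
  refine ⟨h.mul hg, ?_⟩
  rw [nrm_congr (MemH1.dz_mul h hg)]
  have h1 : MemLp (fun z => dz (fun y => f (fun k => φ k y)) z * g z) 2 vol01 := by
    simpa only [mul_comm] using MemLp.mul_continuousOn h.2 hg.continuousOn
  refine (nrm_add_le h1).trans ?_
  have h2 := f.nrm_dz_comp_mul_le hφ hc hg
  have h3 := (f.nrm_mul_le hφ hc hg.2).2
  linarith

end Coeff

/-! ### The elliptic energy estimate -/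

/-- The equation is tested with `u_m - u_m(0)`. This function vanishes on the left, so integration
by parts leaves a boundary term at `1` only, where `|u_m(1) - u_m(0)| ≤ ‖∂_z u_m‖`. -/
theorem elliptic_energy {ι : Type*} [Fintype ι] {u : ι → ℝ → ℝ} (hu : ∀ m, MemH2 (u m))
    {e : ι → ι → ℝ → ℝ} (he : ∀ m j, MemH1 (e m j)) {E : ι → ι → ℝ}
    (hE : ∀ m j, ∀ z ∈ Icc (0 : ℝ) 1, |e m j z| ≤ E m j) {G : ι → ℝ} (hG : ∀ m, 0 ≤ G m)
    {h : ι → ℝ → ℝ} (hh : ∀ m, MemLp (h m) 2 vol01)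
    (heq : ∀ m, ∀ᵐ z ∂vol01, u m z - G m * dz (dz (u m)) z
      + ∑ j, dz (fun y => e m j y * u j y) z = h m z) (m : ι) :
    nrm (fun z => u m z - u m 0) ^ 2 + G m * nrm (dz (u m)) ^ 2 ≤
      (|u m 0| + nrm (h m)) * nrm (fun z => u m z - u m 0)
      + ∑ j, E m j * (nrm (fun z => u j z - u j 0) + |u j 0|) * nrm (dz (u m))
      + (G m * |dz (u m) 1| + ∑ j, E m j * (nrm (dz (u j)) + |u j 0|)) * nrm (dz (u m)) := by
  set g := u m 0 with hg
  have hψ : ∀ j, MemH1 (fun z => u j z - u j 0) := fun j =>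
    ((hu j).1.add (MemH1.const (-u j 0))).congr fun z _ => by ring
  have hdψ : dz (fun z => u m z - g) =ᵐ[vol01] dz (u m) := by
    filter_upwards [(hu m).1.ae_hasDerivAt, ae_vol01_mem_Icc] with z hz hz'
    exact HasDerivAt.dz_eq (hz.sub_const g) hz'
  have hE0 : ∀ j, 0 ≤ E m j := fun j => (abs_nonneg _).trans (hE m j 0 (by simp))
  have hS := MemH1.sum (s := Finset.univ) (u := fun j y => e m j y * u j y)
    fun j _ => (he m j).mul (hu j).1
  have hs1 := (hu m).2.const_mul (-G m)
  have hs := hs1.add hS.1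
  -- The total flux: the equation says `s' = h - u`, so a single integration by parts handles
  -- diffusion and coupling together.
  set s : ℝ → ℝ := fun z => -G m * dz (u m) z + ∑ j, e m j z * u j z with hsdef
  have hds : dz s =ᵐ[vol01] fun z => h m z - u m z := by
    filter_upwards [MemH1.dz_add hs1 hS.1, MemH1.dz_const_mul (-G m) (hu m).2, hS.2, heq m]
      with z h1 h2 h3 h4
    rw [h1, h2, h3]; linarith
  have hibp := (hψ m).integral_mul_dz hs
  set X := nrm (fun z => u m z - g)
  set Y := nrm (dz (u m))
  have hX0 : 0 ≤ X := nrm_nonneg _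
  have hY0 : 0 ≤ Y := nrm_nonneg _
  have hψL := (hψ m).memLp
  have i1 : Integrable (fun z => (u m z - g) * h m z) vol01 := hψL.integrable_mul (hh m)
  have i2 : Integrable (fun z => (u m z - g) * (u m z - g)) vol01 := hψL.integrable_mul hψL
  have i3 : Integrable (fun z => u m z - g) vol01 := memLp_two_integrable hψL
  have e1 : ∫ z, (u m z - g) * dz s z ∂vol01
      = (∫ z, (u m z - g) * h m z ∂vol01) - X ^ 2 - g * ∫ z, (u m z - g) ∂vol01 := by
    have hX2 : X ^ 2 = ∫ z, (u m z - g) * (u m z - g) ∂vol01 := by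
      rw [← l2sq_eq hψL, l2sq, intervalIntegral_eq_vol01]
      simp only [sq]; rfl
    have i12 : Integrable (fun z => (u m z - g) * h m z - (u m z - g) * (u m z - g)) vol01 :=
      i1.sub i2
    rw [hX2, ← integral_const_mul, ← integral_sub i1 i2, ← integral_sub i12 (i3.const_mul g)]
    refine integral_congr_ae ?_
    filter_upwards [hds] with z hz
    rw [hz]; ring
  have hprod : ∀ j, MemLp (fun z => e m j z * u j z) 2 vol01 :=
    fun j => ((he m j).mul (hu j).1).memLp
  have i4 : ∀ j, Integrable (fun z => dz (u m) z * (e m j z * u j z)) vol01 :=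
    fun j => (hu m).1.2.integrable_mul (hprod j)
  have i5 : Integrable (fun z => dz (u m) z * dz (u m) z) vol01 :=
    (hu m).1.2.integrable_mul (hu m).1.2
  have e2 : ∫ z, dz (fun z => u m z - g) z * s z ∂vol01
      = -G m * Y ^ 2 + ∑ j, ∫ z, dz (u m) z * (e m j z * u j z) ∂vol01 := by
    have hY2 : Y ^ 2 = ∫ z, dz (u m) z * dz (u m) z ∂vol01 := by
      rw [← l2sq_eq (hu m).1.2, l2sq, intervalIntegral_eq_vol01]
      simp only [sq]
    rw [hY2, ← integral_const_mul, ← integral_finsetSum _ fun j _ => i4 j, ← integral_add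
      (i5.const_mul _) (integrable_finsetSum _ fun j _ => i4 j)]
    refine integral_congr_ae ?_
    filter_upwards [hdψ] with z hz
    rw [hz, hsdef]; simp only [mul_add, Finset.mul_sum]; ring
  rw [e1, e2] at hibp
  simp only [hg, sub_self, zero_mul, sub_zero] at hibp
  rw [← hg] at hibp
  have b1 : |∫ z, (u m z - g) * h m z ∂vol01| ≤ X * nrm (h m) := integral_mul_le_nrm hψL (hh m)
  have b2 : |g * ∫ z, (u m z - g) ∂vol01| ≤ |g| * X := by
    rw [abs_mul]; exact mul_le_mul_of_nonneg_left (integral_le_nrm hψL) (abs_nonneg _)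
  have hu1 : ∀ j, |u j 1 - u j 0| ≤ nrm (dz (u j)) := fun j =>
    (hu j).1.abs_sub_le (by simp) (by simp)
  have hu1' : ∀ j, |u j 1| ≤ nrm (dz (u j)) + |u j 0| := fun j => by
    have := abs_add_le (u j 1 - u j 0) (u j 0)
    rw [sub_add_cancel] at this
    linarith [hu1 j]
  have b3 : |(u m 1 - g) * s 1| ≤
      (G m * |dz (u m) 1| + ∑ j, E m j * (nrm (dz (u j)) + |u j 0|)) * Y := by
    rw [abs_mul, mul_comm]
    refine mul_le_mul ?_ (hu1 m) (abs_nonneg _) ?_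
    · refine (abs_add_le _ _).trans (add_le_add ?_ ((Finset.abs_sum_le_sum_abs _ _).trans ?_))
      · rw [abs_mul, abs_neg, abs_of_nonneg (hG m)]
      · refine Finset.sum_le_sum fun j _ => ?_
        rw [abs_mul]
        exact mul_le_mul (hE m j 1 (by simp)) (hu1' j) (abs_nonneg _) (hE0 j)
    · exact add_nonneg (mul_nonneg (hG m) (abs_nonneg _)) (Finset.sum_nonneg fun j _ =>
        mul_nonneg (hE0 j) (add_nonneg (nrm_nonneg _) (abs_nonneg _)))
  have b4 : ∑ j, ∫ z, dz (u m) z * (e m j z * u j z) ∂vol01 ≤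
      ∑ j, E m j * (nrm (fun z => u j z - u j 0) + |u j 0|) * Y := by
    refine Finset.sum_le_sum fun j _ => ?_
    refine (le_abs_self _).trans ((integral_mul_le_nrm (hu m).1.2 (hprod j)).trans ?_)
    rw [mul_comm]
    refine mul_le_mul_of_nonneg_right ?_ hY0
    refine (nrm_mul_le (he m j).memLp.1 (hu j).1.memLp (c := E m j) ?_ (hE0 j)).2.trans ?_
    · filter_upwards [ae_vol01_mem_Icc] with z hz using hE m j z hz
    · refine mul_le_mul_of_nonneg_left ?_ (hE0 j)
      have h1 := nrm_add_le (u := fun z => u j z - u j 0) (v := fun _ => u j 0) (hψ j).memLp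
      rw [nrm_const] at h1
      simpa using h1
  have b1' := (abs_le.1 b1).2
  have b2' := (abs_le.1 b2).1
  have b3' := (abs_le.1 b3).1
  nlinarith

end Rothe

namespace Rothe

open Filter Topology

/-! ### Absorption in the elliptic energy estimate -/

theorem young_ineq (a b : ℝ) {t : ℝ} (ht : 0 < t) : a * b ≤ t / 2 * a ^ 2 + b ^ 2 / (2 * t) := by
  have h : t / 2 * a ^ 2 + b ^ 2 / (2 * t) - a * b = (t * a - b) ^ 2 / (2 * t) := by
    field_simp; ring
  have : 0 ≤ (t * a - b) ^ 2 / (2 * t) := by positivity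
  linarith

theorem exists_forall_le_of_finite {ι : Type*} [Finite ι] (f : ι → ℝ) :
    ∃ K : ℝ, 0 ≤ K ∧ ∀ i, f i ≤ K := by
  obtain ⟨K, hK⟩ := (Set.finite_range f).bddAbove
  exact ⟨max K 0, le_max_right _ _, fun i => (hK ⟨i, rfl⟩).trans (le_max_left _ _)⟩

theorem exists_pos_forall_le_of_finite {ι : Type*} [Finite ι] (f : ι → ℝ) (hf : ∀ i, 0 < f i) :
    ∃ t : ℝ, 0 < t ∧ ∀ i, t ≤ f i := by
  obtain ⟨K, hK0, hK⟩ := exists_forall_le_of_finite fun i => (f i)⁻¹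
  refine ⟨(K + 1)⁻¹, by positivity, fun i => ?_⟩
  rw [inv_le_comm₀ (by positivity) (hf i)]
  linarith [hK i]

set_option maxHeartbeats 1000000 in
/-- A system of energy inequalities can be solved for the gradients `Y`. -/
theorem energy_absorption {ι : Type*} [Fintype ι] [DecidableEq ι] {γ D a F θ : ι → ℝ} {e : ι → ι → ℝ}
    (hγ : ∀ m, 0 < γ m) (hD : ∀ m, 0 ≤ D m) (ha : ∀ m, 0 ≤ a m)
    (he : ∀ m j, 0 ≤ e m j) (hθ : ∀ m, 0 < θ m) {c gap : ι → ℝ}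
    (hc : ∀ m, 0 < c m) (hgap : ∀ m, 0 < gap m)
    (hcd : ∀ m, c m = 1 - ∑ j, e j m / (2 * √(γ j)))
    (hgd : ∀ m, gap m = γ m - (γ m * a m) ^ 2 / (2 * θ m)
      - ∑ j, (e m j * √(γ m) / 2 + (e m j + if m = j then γ m * a m else 0) / 2
        + (e j m + if j = m then γ j * a j else 0) / 2)) :
    ∃ τ0 K : ℝ, 0 < τ0 ∧ 0 ≤ K ∧ ∀ τ C Z : ℝ, 0 ≤ τ → τ ≤ τ0 → 0 ≤ C → 0 ≤ Z →
      ∀ X Y : ι → ℝ, (∀ m, 0 ≤ X m) → (∀ m, 0 ≤ Y m) →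
      (∀ m, X m ^ 2 + (γ m + τ * D m) * Y m ^ 2 ≤ (C + F m * Z) * X m
        + ∑ j, e m j * (X j + C) * Y m
        + ((γ m + τ * D m) * (a m * (Y m + C + Z)) + ∑ j, e m j * (Y j + C)) * Y m) →
      ∑ m, gap m * Y m ^ 2 ≤ 3 * (∑ m, (F m ^ 2 / c m + θ m / 2)) * Z ^ 2 + K * C ^ 2 := by
  obtain ⟨t1, ht1, ht1'⟩ := exists_pos_forall_le_of_finite
    (fun m => gap m / (6 * (D m * a m + 1))) fun m => by
      have := mul_nonneg (hD m) (ha m); have := hgap m; positivity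
  obtain ⟨t2, ht2, ht2'⟩ := exists_pos_forall_le_of_finite
    (fun m => θ m / (2 * (D m * a m + 1))) fun m => by
      have := mul_nonneg (hD m) (ha m); have := hθ m; positivity
  -- `q` collects the coefficients of `C * Y m`: both coupling sums and the Robin term, with `τ ≤
  -- 1`.
  set q : ι → ℝ := fun m => 2 * ∑ j, e m j + (γ m + D m) * a m with hq
  -- `t1` and `t2` are chosen so that the contributions of `τ * D` cost at most a quarter of the gap
  -- and a quarter of `θ`.
  refine ⟨min 1 (min t1 t2), 2 * ∑ m, (1 / (2 * c m) + q m ^ 2 / gap m), by positivity, ?_, ?_⟩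
  · refine mul_nonneg two_pos.le (Finset.sum_nonneg fun m _ => ?_)
    have := hc m; have := hgap m; positivity
  intro τ C Z hτ hτ0 hC hZ X Y hX hY hXY
  have hτ1 : τ ≤ 1 := hτ0.trans (min_le_left _ _)
  -- Young's inequality with weight `c m` for the data, `√(γ m)` for the mixed terms `X j * Y m` and
  -- `θ m` for the velocity at the Robin end. Half of the gap is reserved for the remaining terms in
  -- `C` and `τ`.
  have key : ∀ m, X m ^ 2 + γ m * Y m ^ 2 ≤
      c m * X m ^ 2 + (C ^ 2 / (2 * c m) + F m ^ 2 / (2 * c m) * Z ^ 2)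
      + ∑ j, (e m j / (2 * √(γ m)) * X j ^ 2 + e m j * √(γ m) / 2 * Y m ^ 2)
      + ∑ j, (e m j + if m = j then γ m * a m else 0) / 2 * (Y j ^ 2 + Y m ^ 2)
      + ((γ m * a m) ^ 2 / (2 * θ m) * Y m ^ 2 + 3 * θ m / 4 * Z ^ 2)
      + (gap m / 2 * Y m ^ 2 + C ^ 2 * (q m ^ 2 / gap m)) := by
    intro m
    have hcm := hc m
    have hgm := hgap m
    have hDa := mul_nonneg (hD m) (ha m)
    have hsq : 0 < √(γ m) := Real.sqrt_pos.2 (hγ m)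
    have k1 : (C + F m * Z) * X m
        ≤ c m * X m ^ 2 + (C ^ 2 / (2 * c m) + F m ^ 2 / (2 * c m) * Z ^ 2) := by
      have h1 := young_ineq (X m) C hcm
      have h2 := young_ineq (X m) (F m * Z) hcm
      have : (F m * Z) ^ 2 / (2 * c m) = F m ^ 2 / (2 * c m) * Z ^ 2 := by ring
      linarith
    have k2 : ∑ j, e m j * (X j + C) * Y m ≤
        ∑ j, (e m j / (2 * √(γ m)) * X j ^ 2 + e m j * √(γ m) / 2 * Y m ^ 2)
          + C * (∑ j, e m j) * Y m := by
      rw [mul_comm C, Finset.sum_mul, Finset.sum_mul, ← Finset.sum_add_distrib]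
      refine Finset.sum_le_sum fun j _ => ?_
      have h1 := mul_le_mul_of_nonneg_left (young_ineq (Y m) (X j) hsq) (he m j)
      have : e m j * (√(γ m) / 2 * Y m ^ 2 + X j ^ 2 / (2 * √(γ m)))
        = e m j / (2 * √(γ m)) * X j ^ 2 + e m j * √(γ m) / 2 * Y m ^ 2 := by ring
      linarith
    have k3 : γ m * a m * Y m ^ 2 + (∑ j, e m j * Y j) * Y m ≤
        ∑ j, (e m j + if m = j then γ m * a m else 0) / 2 * (Y j ^ 2 + Y m ^ 2) := by
      have h1 : ∑ j, (e m j + if m = j then γ m * a m else 0) / 2 * (Y j ^ 2 + Y m ^ 2)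
          = γ m * a m * Y m ^ 2 + ∑ j, e m j / 2 * (Y j ^ 2 + Y m ^ 2) := by
        have : ∀ j, (e m j + if m = j then γ m * a m else 0) / 2 * (Y j ^ 2 + Y m ^ 2)
            = (if m = j then γ m * a m * Y j ^ 2 else 0) + e m j / 2 * (Y j ^ 2 + Y m ^ 2) := by
          intro j
          split_ifs with h
          · subst h; ring
          · ring
        simp_rw [this]
        rw [Finset.sum_add_distrib, Finset.sum_ite_eq Finset.univ m]
        simp
      rw [h1, Finset.sum_mul]
      refine add_le_add le_rfl (Finset.sum_le_sum fun j _ => ?_)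
      nlinarith [mul_nonneg (he m j) (sq_nonneg (Y j - Y m))]
    have k4 : γ m * a m * Z * Y m ≤ (γ m * a m) ^ 2 / (2 * θ m) * Y m ^ 2 + θ m / 2 * Z ^ 2 := by
      have h1 := young_ineq Z (γ m * a m * Y m) (hθ m)
      have : (γ m * a m * Y m) ^ 2 / (2 * θ m) = (γ m * a m) ^ 2 / (2 * θ m) * Y m ^ 2 := by ring
      linarith
    have k5 : C * q m * Y m ≤ gap m / 4 * Y m ^ 2 + C ^ 2 * (q m ^ 2 / gap m) := by
      have h1 := young_ineq (Y m) (C * q m) (half_pos hgm)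
      have : (C * q m) ^ 2 / (2 * (gap m / 2)) = C ^ 2 * (q m ^ 2 / gap m) := by
        field_simp
      linarith
    have k6 : τ * (D m * a m) * (3 / 2) ≤ gap m / 4 := by
      have h1 : τ ≤ gap m / (6 * (D m * a m + 1)) :=
        (hτ0.trans ((min_le_right _ _).trans (min_le_left _ _))).trans (ht1' m)
      rw [le_div_iff₀ (by positivity)] at h1
      nlinarith
    have k7 : τ * (D m * a m) / 2 ≤ θ m / 4 := by
      have h1 : τ ≤ θ m / (2 * (D m * a m + 1)) :=
        (hτ0.trans ((min_le_right _ _).trans (min_le_right _ _))).trans (ht2' m)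
      rw [le_div_iff₀ (by positivity)] at h1
      nlinarith
    have k8 : τ * (D m * a m) * (Y m ^ 2 + Z * Y m) ≤ gap m / 4 * Y m ^ 2 + θ m / 4 * Z ^ 2 := by
      have h1 : τ * (D m * a m) * (Y m ^ 2 + Z * Y m)
          ≤ τ * (D m * a m) * (3 / 2) * Y m ^ 2 + τ * (D m * a m) / 2 * Z ^ 2 := by
        nlinarith [mul_nonneg (mul_nonneg hτ hDa) (sq_nonneg (Y m - Z))]
      nlinarith [mul_le_mul_of_nonneg_right k6 (sq_nonneg (Y m)),
        mul_le_mul_of_nonneg_right k7 (sq_nonneg Z)]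
    have k9 : τ * (D m * a m) * C * Y m ≤ D m * a m * C * Y m := by
      have : 0 ≤ D m * a m * C * Y m := mul_nonneg (mul_nonneg hDa hC) (hY m)
      nlinarith
    have k10 : 0 ≤ τ * D m * Y m ^ 2 := mul_nonneg (mul_nonneg hτ (hD m)) (sq_nonneg _)
    have h0 := hXY m
    have hexp : ((γ m + τ * D m) * (a m * (Y m + C + Z)) + ∑ j, e m j * (Y j + C)) * Y m
        = (γ m * a m * Y m ^ 2 + (∑ j, e m j * Y j) * Y m) + γ m * a m * Z * Y m
          + τ * (D m * a m) * (Y m ^ 2 + Z * Y m) + (τ * (D m * a m) * C * Y m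
          + (γ m * a m * C * Y m + C * (∑ j, e m j) * Y m)) := by
      simp only [mul_add, Finset.sum_add_distrib, ← Finset.sum_mul]; ring
    have hqe : C * q m * Y m = D m * a m * C * Y m + γ m * a m * C * Y m
        + 2 * (C * (∑ j, e m j) * Y m) := by simp only [hq]; ring
    rw [hexp] at h0
    linarith
  have hsum := Finset.sum_le_sum fun m (_ : m ∈ Finset.univ) => key m
  -- Interchanging the sums turns the coefficient of `X m ^ 2` into `1 - c m`; together with the
  -- data term it cancels the left side exactly.
  have sw1 : ∑ m, ∑ j, (e m j / (2 * √(γ m)) * X j ^ 2 + e m j * √(γ m) / 2 * Y m ^ 2)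
      = ∑ m, ((1 - c m) * X m ^ 2 + (∑ j, e m j * √(γ m) / 2) * Y m ^ 2) := by
    simp only [Finset.sum_add_distrib]
    congr 1
    · rw [Finset.sum_comm]
      refine Finset.sum_congr rfl fun m _ => ?_
      rw [hcd m, ← Finset.sum_mul]; ring
    · exact Finset.sum_congr rfl fun m _ => by rw [← Finset.sum_mul]
  have sw2 : ∑ m, ∑ j, (e m j + if m = j then γ m * a m else 0) / 2 * (Y j ^ 2 + Y m ^ 2)
      = ∑ m, (∑ j, ((e m j + if m = j then γ m * a m else 0) / 2
        + (e j m + if j = m then γ j * a j else 0) / 2)) * Y m ^ 2 := by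
    simp only [mul_add, Finset.sum_add_distrib, add_mul]
    rw [add_comm]
    congr 1
    · exact Finset.sum_congr rfl fun m _ => by rw [← Finset.sum_mul]
    · rw [Finset.sum_comm]
      exact Finset.sum_congr rfl fun m _ => by rw [← Finset.sum_mul]
  have tot : ∑ m, (X m ^ 2 + γ m * Y m ^ 2) ≤ ∑ m, (c m * X m ^ 2
      + (C ^ 2 / (2 * c m) + F m ^ 2 / (2 * c m) * Z ^ 2)
      + ((1 - c m) * X m ^ 2 + (∑ j, e m j * √(γ m) / 2) * Y m ^ 2)
      + (∑ j, ((e m j + if m = j then γ m * a m else 0) / 2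
        + (e j m + if j = m then γ j * a j else 0) / 2)) * Y m ^ 2
      + ((γ m * a m) ^ 2 / (2 * θ m) * Y m ^ 2 + 3 * θ m / 4 * Z ^ 2)
      + (gap m / 2 * Y m ^ 2 + C ^ 2 * (q m ^ 2 / gap m))) := by
    refine hsum.trans (le_of_eq ?_)
    simp only [Finset.sum_add_distrib] at sw1 sw2 ⊢
    linarith
  have fin : ∑ m, (gap m / 2 * Y m ^ 2) ≤ ∑ m, ((F m ^ 2 / (2 * c m) + 3 * θ m / 4) * Z ^ 2
      + (1 / (2 * c m) + q m ^ 2 / gap m) * C ^ 2) := by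
    have := sub_nonneg.2 tot
    rw [← Finset.sum_sub_distrib] at this
    rw [← sub_nonneg, ← Finset.sum_sub_distrib]
    refine this.trans (le_of_eq (Finset.sum_congr rfl fun m _ => ?_))
    have hg := hgd m
    simp only [add_assoc, Finset.sum_add_distrib] at hg ⊢
    linear_combination (Y m ^ 2) * hg
  rw [Finset.sum_add_distrib, ← Finset.sum_mul, ← Finset.sum_mul] at fin
  have e1 : ∑ m, (gap m / 2 * Y m ^ 2) = (∑ m, gap m * Y m ^ 2) / 2 := by
    rw [Finset.sum_div]; exact Finset.sum_congr rfl fun m _ => by ring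
  -- Doubling, to undo the half gap, gives the factor `3` in front of the sum that occurs in (9).
  have e2 : ∑ m, (F m ^ 2 / (2 * c m) + 3 * θ m / 4) ≤ 3 / 2 * ∑ m, (F m ^ 2 / c m + θ m / 2) := by
    rw [Finset.mul_sum]
    refine Finset.sum_le_sum fun m _ => ?_
    have h1 : 0 ≤ F m ^ 2 / c m := div_nonneg (sq_nonneg _) (hc m).le
    have h2 : F m ^ 2 / (2 * c m) = F m ^ 2 / c m / 2 := by rw [div_div]; ring_nf
    rw [h2]; linarith
  have e3 := mul_le_mul_of_nonneg_right e2 (sq_nonneg Z)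
  rw [e1] at fin
  linarith

/-! ### The velocity feedback as a contraction. -/

namespace Model

variable {n : ℕ} (M : Model n)

theorem one_le_dR_sub_one : 1 ≤ M.dR - 1 := by
  simp only [dR]; have : (0 : ℝ) ≤ n := n.cast_nonneg; linarith

/-- `1 - ∑_j 𝓜_{j01m}/(2√γ_j)` -/
noncomputable def cgap (m : Solid n) : ℝ := 1 - ∑ j, M.Mc j 0 1 m / (2 * √(M.γ j))

theorem Mc01 (m j : Solid n) : M.Mc m 0 1 j = (M.E01 m j).bd := by simp [Mc, Mi1]

theorem Mc11 (m j : Solid n) :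
    M.Mc m 1 1 j = (M.E01 m j).bd + if m = j then M.γ m * |M.A m| else 0 := by simp [Mc, Mi1]

theorem Mc11_pos (m j : Solid n) : 0 < M.Mc m 1 1 j := by
  rw [Mc11]
  have := (M.E01 m j).bd_pos
  have h2 : 0 ≤ M.γ m * |M.A m| := mul_nonneg (M.γ_pos m).le (abs_nonneg _)
  split_ifs <;> linarith

variable {M}

/-- Dropping the positive terms `𝓜_{m11j}` from (5) makes each summand smaller than `1 / (d - 1)`,
and there are `d - 1` of them. -/
theorem cgap_pos (h5 : M.PseudoParabolic) (m : Solid n) : 0 < M.cgap m := by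
  have hd := M.one_le_dR_sub_one
  have h : ∀ j, M.Mc j 0 1 m / (2 * √(M.γ j)) < 1 / (M.dR - 1) := by
    intro j
    have h1 := h5 j m
    have h2 := M.Mc11_pos j m
    have h3 := M.Mc11_pos m j
    have hs : 0 < √(M.γ j) := Real.sqrt_pos.2 (M.γ_pos j)
    have hss := Real.mul_self_sqrt (M.γ_pos j).le
    rw [lt_div_iff₀ (by linarith)] at h1
    rw [div_lt_div_iff₀ (by positivity) (by linarith)]
    have h4 : M.Mc j 0 1 m * √(M.γ j) * (M.dR - 1) < 2 * M.γ j := by nlinarith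
    have h5 : √(M.γ j) * (M.Mc j 0 1 m * (M.dR - 1)) < √(M.γ j) * (1 * (2 * √(M.γ j))) := by
      nlinarith
    exact lt_of_mul_lt_mul_left h5 hs.le
  have hsum : ∑ j, M.Mc j 0 1 m / (2 * √(M.γ j)) < ∑ _j : Solid n, 1 / (M.dR - 1) :=
    Finset.sum_lt_sum_of_nonempty Finset.univ_nonempty fun j _ => h j
  have hone : ∑ _j : Solid n, 1 / (M.dR - 1) = 1 := by
    rw [Finset.sum_const, Finset.card_univ, Fintype.card_fin, nsmul_eq_mul, dR]
    have : (0 : ℝ) ≤ n := n.cast_nonneg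
    push_cast
    rw [show (n : ℝ) + 2 - 1 = n + 1 by ring, mul_one_div_cancel (by positivity)]
  unfold cgap
  linarith

/-- Gradients of the displacement rates are controlled by the velocity, and the velocity induced by
them contracts. -/
theorem exists_contraction (hΓ : 0 < M.Γmin) (h5 : M.PseudoParabolic) (h9 : M.VelocityCoupling) :
    ∃ τ0 K : ℝ, 0 < τ0 ∧ 0 ≤ K ∧ ∀ τ C Z : ℝ, 0 ≤ τ → τ ≤ τ0 → 0 ≤ C → 0 ≤ Z →
      ∀ X Y : Solid n → ℝ, (∀ m, 0 ≤ X m) → (∀ m, 0 ≤ Y m) →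
      (∀ m, X m ^ 2 + (M.γ m + τ * M.D m) * Y m ^ 2 ≤ (C + (M.F m).bd * Z) * X m
        + ∑ j, (M.E01 m j).bd * (X j + C) * Y m
        + ((M.γ m + τ * M.D m) * (|M.A m| * (Y m + C + Z)) + ∑ j, (M.E01 m j).bd * (Y j + C))
          * Y m) →
      (∀ m, Y m ≤ K * (Z + C)) ∧
        (∑ m, (M.H 1 m).bd * Y m) / M.Γmin ≤ 3 / 4 * Z + K * C := by
  obtain ⟨θ, hθ, hgap, hsmall⟩ := h9
  obtain ⟨τ0, K, hτ0, hK, H⟩ := energy_absorption (γ := M.γ) (D := M.D) (a := fun m => |M.A m|)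
    (F := fun m => (M.F m).bd) (θ := θ) (e := fun m j => (M.E01 m j).bd) M.γ_pos
    (fun m => (M.D_pos m).le) (fun m => abs_nonneg _) (fun m j => (M.E01 m j).bd_pos.le) hθ
    (c := M.cgap) (gap := M.gap θ) (cgap_pos h5) hgap
    (fun m => by simp only [cgap, Mc01]) (fun m => by simp only [gap, Mc01, Mc11, Mv])
  set κ0 : ℝ := ∑ m, ((M.F m).bd ^ 2 / M.cgap m + θ m / 2) with hκ0
  have hκ0pos : 0 < κ0 := Finset.sum_pos (fun m _ => by
    have := cgap_pos h5 m; have := hθ m; have := (M.F m).bd_pos; positivity) Finset.univ_nonempty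
  set hm : ℝ := ⨆ m, (M.H 1 m).bd ^ 2 / M.gap θ m with hhm
  have hle : ∀ m, (M.H 1 m).bd ^ 2 / M.gap θ m ≤ hm := fun m =>
    le_ciSup (f := fun m => (M.H 1 m).bd ^ 2 / M.gap θ m) (Set.finite_range _).bddAbove m
  have hm0 : 0 < hm := lt_of_lt_of_le (by
    have := hgap 0; have := (M.H 1 0).bd_pos; positivity) (hle 0)
  obtain ⟨g0, hg0, hg0'⟩ := exists_pos_forall_le_of_finite (M.gap θ) hgap
  set d := M.dR with hd
  have hd1 : 1 ≤ d - 1 := M.one_le_dR_sub_one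
  set K1 : ℝ := √(3 * κ0 / g0) + √(K / g0)
  set K2 : ℝ := √((d - 1) * hm * K / M.Γmin ^ 2)
  refine ⟨τ0, max K1 K2, hτ0, le_max_of_le_left (by positivity), ?_⟩
  intro τ C Z hτ hτ' hC hZ X Y hX hY hXY
  have hE := H τ C Z hτ hτ' hC hZ X Y hX hY hXY
  constructor
  · intro m
    have h1 : g0 * Y m ^ 2 ≤ 3 * κ0 * Z ^ 2 + K * C ^ 2 := by
      refine le_trans ?_ hE
      refine le_trans (mul_le_mul_of_nonneg_right (hg0' m) (sq_nonneg _)) ?_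
      exact Finset.single_le_sum (f := fun m => M.gap θ m * Y m ^ 2)
        (fun i _ => mul_nonneg (hgap i).le (sq_nonneg _)) (Finset.mem_univ m)
    have h2 : Y m ≤ √(3 * κ0 / g0) * Z + √(K / g0) * C := by
      refine abs_le_of_sq_le_sq' ?_ (by positivity) |>.2
      have e1 := Real.sq_sqrt (show 0 ≤ 3 * κ0 / g0 by positivity)
      have e2 := Real.sq_sqrt (show 0 ≤ K / g0 by positivity)
      have e3 : 0 ≤ √(3 * κ0 / g0) * Z * (√(K / g0) * C) := by positivity
      have e4 : Y m ^ 2 ≤ 3 * κ0 / g0 * Z ^ 2 + K / g0 * C ^ 2 := by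
        rw [div_mul_eq_mul_div, div_mul_eq_mul_div, ← add_div, le_div_iff₀ hg0]; linarith
      nlinarith
    have h3 : √(3 * κ0 / g0) * Z + √(K / g0) * C ≤ K1 * (Z + C) := by
      have : 0 ≤ √(3 * κ0 / g0) * C + √(K / g0) * Z := by positivity
      simp only [K1]; linarith
    exact h2.trans (h3.trans (mul_le_mul_of_nonneg_right (le_max_left _ _) (by positivity)))
  -- Cauchy–Schwarz over the `d - 1` solids; the gap weights are those of the absorbed energy
  -- inequality.
  · have hCS : (∑ m, (M.H 1 m).bd * Y m) ^ 2 ≤ (d - 1) * hm * ∑ m, M.gap θ m * Y m ^ 2 := by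
      have h1 : (∑ m, (M.H 1 m).bd * Y m) ^ 2
          ≤ (Finset.univ : Finset (Solid n)).card * ∑ m, ((M.H 1 m).bd * Y m) ^ 2 :=
        sq_sum_le_card_mul_sum_sq
      have h2 : ((Finset.univ : Finset (Solid n)).card : ℝ) = d - 1 := by
        rw [Finset.card_univ, Fintype.card_fin, hd, dR]; push_cast; ring
      rw [h2] at h1
      refine h1.trans ?_
      rw [mul_assoc]
      refine mul_le_mul_of_nonneg_left ?_ (by linarith)
      rw [Finset.mul_sum]
      refine Finset.sum_le_sum fun m _ => ?_
      have h3 := hle m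
      rw [div_le_iff₀ (hgap m)] at h3
      rw [mul_pow, ← mul_assoc]
      exact mul_le_mul_of_nonneg_right h3 (sq_nonneg _)
    -- Since `6 (d - 1) ≤ (d - 1/2)(d + 3)`, assumption (9) bounds the squared feedback factor by
    -- `1/2 < (3/4)²`.
    have hq : (d - 1) * hm * (3 * κ0) / M.Γmin ^ 2 ≤ 1 / 2 := by
      have h1 : (d - 1 / 2) * (d + 3) / M.Γmin ^ 2 * κ0 * hm < 1 := hsmall
      have h2 : 3 * (d - 1) ≤ 1 / 2 * ((d - 1 / 2) * (d + 3)) := by nlinarith [sq_nonneg (d - 7 / 4)]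
      have h3 : 0 ≤ κ0 * hm / M.Γmin ^ 2 := by positivity
      calc (d - 1) * hm * (3 * κ0) / M.Γmin ^ 2
          = 3 * (d - 1) * (κ0 * hm / M.Γmin ^ 2) := by ring
        _ ≤ 1 / 2 * ((d - 1 / 2) * (d + 3)) * (κ0 * hm / M.Γmin ^ 2) :=
            mul_le_mul_of_nonneg_right h2 h3
        _ = 1 / 2 * ((d - 1 / 2) * (d + 3) / M.Γmin ^ 2 * κ0 * hm) := by ring
        _ ≤ 1 / 2 := by linarith
    have hK2 : (∑ m, (M.H 1 m).bd * Y m) / M.Γmin ≤ 3 / 4 * Z + K2 * C := by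
      refine abs_le_of_sq_le_sq' ?_ (by positivity) |>.2
      have hn : 0 ≤ (d - 1) * hm * K / M.Γmin ^ 2 :=
        div_nonneg (mul_nonneg (mul_nonneg (by linarith) hm0.le) hK) (sq_nonneg _)
      have e1 := Real.sq_sqrt hn
      have e2 : ((∑ m, (M.H 1 m).bd * Y m) / M.Γmin) ^ 2
          ≤ (d - 1) * hm * (3 * κ0) / M.Γmin ^ 2 * Z ^ 2
            + (d - 1) * hm * K / M.Γmin ^ 2 * C ^ 2 := by
        rw [div_pow, div_mul_eq_mul_div, div_mul_eq_mul_div, ← add_div]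
        refine div_le_div_of_nonneg_right (hCS.trans ?_) (by positivity)
        have h5 := mul_le_mul_of_nonneg_left hE (mul_nonneg (by linarith : 0 ≤ d - 1) hm0.le)
        refine h5.trans (le_of_eq ?_); ring
      have e3 : 0 ≤ 3 / 4 * Z * (K2 * C) := by positivity
      have e4 := mul_le_mul_of_nonneg_right hq (sq_nonneg Z)
      have e5 : (3 / 4 * Z + K2 * C) ^ 2
        = 9 / 16 * Z ^ 2 + 2 * (3 / 4 * Z * (K2 * C)) + K2 ^ 2 * C ^ 2 := by ring
      rw [e5, e1]
      nlinarith [sq_nonneg Z]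
    exact hK2.trans (add_le_add le_rfl (mul_le_mul_of_nonneg_right (le_max_right _ _) hC))

end Model

end Rothe

/-! ### Estimate of the displacement rates and the initial velocity. -/

namespace Rothe

open Filter Topology

namespace Model

variable {n : ℕ} {M : Model n}

theorem one_sub_lt (h : 0 < M.φmin) : 1 - (M.dR - 1) * M.φmin < 1 := by
  have := M.one_le_dR_sub_one
  nlinarith

theorem box_subset (h : 0 < M.φmin) {x : Comp n → ℝ} (hx : x ∈ M.box M.φmin) (l : Comp n) :
    x l ∈ Ioo (0 : ℝ) 1 :=
  ⟨h.trans (hx l).1, (hx l).2.trans (one_sub_lt h)⟩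

theorem sInf_image_le (h : 0 < M.φmin) (f : Coeff n) {x : Comp n → ℝ} (hx : x ∈ M.box M.φmin) :
    sInf (f '' M.box M.φmin) ≤ f x := by
  refine csInf_le ⟨-f.bd, ?_⟩ ⟨x, hx, rfl⟩
  rintro _ ⟨y, hy, rfl⟩
  exact (abs_le.1 (f.abs_le y (box_subset h hy))).1

theorem Γmin_le (h : 0 < M.φmin) {x : Comp n → ℝ} (hx : x ∈ M.box M.φmin) : M.Γmin ≤ M.Γ x :=
  sInf_image_le h M.Γ hx

theorem Γmin_pos (h4 : M.Nondegenerate) (h7 : M.InitialFractions) : 0 < M.Γmin :=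
  (h4 _ h7.1 h7.2.1).1

theorem exists_H_lower (h4 : M.Nondegenerate) (h7 : M.InitialFractions) :
    ∃ h0 : ℝ, 0 < h0 ∧ ∀ x ∈ M.box M.φmin, ∀ m, h0 ≤ M.H 1 m x := by
  obtain ⟨t, ht, ht'⟩ := exists_pos_forall_le_of_finite
    (fun m => sInf (M.H 1 m '' M.box M.φmin)) (h4 _ h7.1 h7.2.1).2
  exact ⟨t, ht, fun x hx m => (ht' m).trans (sInf_image_le h7.1 (M.H 1 m) hx)⟩

/-- The upper bounds come for free: the other `d - 1` fractions use up more than `(d - 1) φ_min` of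
the total. Only lower bounds have to be propagated in time. -/
theorem mem_box_of_sum_eq_one {x : Comp n → ℝ} (hx : ∀ l, M.φmin < x l) (hs : ∑ l, x l = 1) :
    x ∈ M.box M.φmin := by
  intro l
  refine ⟨hx l, ?_⟩
  have h1 := Finset.add_sum_erase Finset.univ x (Finset.mem_univ l)
  have h2 : ∑ k ∈ Finset.univ.erase l, M.φmin < ∑ k ∈ Finset.univ.erase l, x k := by
    refine Finset.sum_lt_sum_of_nonempty ?_ fun k _ => hx k
    rw [← Finset.card_pos, Finset.card_erase_of_mem (Finset.mem_univ l), Finset.card_univ,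
      Fintype.card_fin]
    omega
  rw [Finset.sum_const, Finset.card_erase_of_mem (Finset.mem_univ l), Finset.card_univ,
    Fintype.card_fin, nsmul_eq_mul] at h2
  have h3 : ((n + 2 - 1 : ℕ) : ℝ) = M.dR - 1 := by
    rw [dR]; push_cast [show n + 2 - 1 = n + 1 by omega]; ring
  rw [h3] at h2
  linarith

theorem φ0_mem_box (h7 : M.InitialFractions) : M.φ0 ∈ M.box M.φmin :=
  mem_box_of_sum_eq_one h7.2.2.2.2.1 h7.2.2.2.1

/-- Estimate of the displacement rates by data and velocity. -/
theorem exists_rate_estimate (hΓ : 0 < M.Γmin) (h5 : M.PseudoParabolic) (h9 : M.VelocityCoupling) :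
    ∃ τ0 K : ℝ, 0 < τ0 ∧ 0 ≤ K ∧ ∀ τ C Z : ℝ, 0 ≤ τ → τ ≤ τ0 → 0 ≤ C → 0 ≤ Z →
      ∀ φ : Comp n → ℝ → ℝ, (∀ l, MemH1 (φ l)) → InCube φ →
      ∀ u h : Solid n → ℝ → ℝ, (∀ m, MemH2 (u m)) → (∀ m, MemLp (h m) 2 vol01) →
      (∀ m, |u m 0| + nrm (h m) ≤ C + (M.F m).bd * Z) → (∀ m, |u m 0| ≤ C) →
      (∀ m, |dz (u m) 1| ≤ |M.A m| * (nrm (dz (u m)) + C + Z)) →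
      (∀ m, ∀ᵐ z ∂vol01, u m z - (M.γ m + τ * M.D m) * dz (dz (u m)) z
        + ∑ j, dz (fun y => M.E01 m j (fun k => φ k y) * u j y) z = h m z) →
      (∀ m, nrm (dz (u m)) ≤ K * (Z + C)) ∧
        (∑ m, (M.H 1 m).bd * nrm (dz (u m))) / M.Γmin ≤ 3 / 4 * Z + K * C := by
  obtain ⟨τ0, K, hτ0, hK, H⟩ := exists_contraction hΓ h5 h9
  refine ⟨τ0, K, hτ0, hK, fun τ C Z hτ hτ' hC hZ φ hφ hc u h hu hh h1 h2 h3 heq => ?_⟩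
  refine H τ C Z hτ hτ' hC hZ (fun m => nrm (fun z => u m z - u m 0)) (fun m => nrm (dz (u m)))
    (fun m => nrm_nonneg _) (fun m => nrm_nonneg _) fun m => ?_
  have hG : ∀ m, 0 ≤ M.γ m + τ * M.D m := fun m =>
    add_nonneg (M.γ_pos m).le (mul_nonneg hτ (M.D_pos m).le)
  refine (elliptic_energy hu (fun m j => ((M.E01 m j).memH1_comp hφ hc).1)
    (E := fun m j => (M.E01 m j).bd) (fun m j z hz => (M.E01 m j).abs_comp_le hc hz)
    (G := fun m => M.γ m + τ * M.D m) hG hh heq m).trans ?_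
  have hY := nrm_nonneg (dz (u m))
  refine add_le_add (add_le_add (mul_le_mul_of_nonneg_right (h1 m) (nrm_nonneg _))
    (Finset.sum_le_sum fun j _ => ?_)) (mul_le_mul_of_nonneg_right (add_le_add
      (mul_le_mul_of_nonneg_left (h3 m) (hG m)) (Finset.sum_le_sum fun j _ => ?_)) hY)
  · have := h2 j; have := (M.E01 m j).bd_pos; gcongr
  · have := h2 j; have := (M.E01 m j).bd_pos; gcongr

/-- Existence of an initial velocity. -/
theorem exists_initialVelocity (h4 : M.Nondegenerate) (h5 : M.PseudoParabolic)
    (h7 : M.InitialFractions) (h9 : M.VelocityCoupling) : ∃ v0 : ℝ → ℝ, M.IsInitialVelocity v0 := by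
  have hΓ := Γmin_pos h4 h7
  obtain ⟨τ0, K, hτ0, hK, hest⟩ := exists_rate_estimate hΓ h5 h9
  have hbox := φ0_mem_box h7
  obtain ⟨h0, hh0, hh0'⟩ := exists_H_lower h4 h7
  have hcube : InCube (n := n) (fun l _ => M.φ0 l) := fun z _ l => box_subset h7.1 hbox l
  set Γ0 := M.Γ M.φ0 with hΓ0
  have hΓ0min : M.Γmin ≤ Γ0 := Γmin_le h7.1 hbox
  have hΓ0p : 0 < Γ0 := hΓ.trans_le hΓ0min
  set hh : Solid n → ℝ := fun m => M.H 1 m M.φ0 with hhdef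
  have hhp : ∀ m, 0 < hh m := fun m => hh0.trans_le (hh0' _ hbox m)
  have hhb : ∀ m, |hh m| ≤ (M.H 1 m).bd := fun m =>
    (M.H 1 m).abs_le _ (box_subset h7.1 hbox)
  set g : Solid n → ℝ := fun m =>
    M.J m.castSucc * posPt (M.res m.castSucc - M.φ0 m.castSucc) / hh m with hg
  set b : ℝ := M.J (compD n) * posPt (M.res (compD n) - M.φ0 (compD n)) / Γ0 with hb
  set F : Solid n → ℝ := fun m => M.F m M.φ0 with hF
  have hFb : ∀ m, |F m| ≤ (M.F m).bd := fun m => (M.F m).abs_le _ (box_subset h7.1 hbox)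
  set s : ℝ := ∑ j, hh j * g j with hs
  -- Integrating the continuity equation gives `Γ₀ v₀ = G_v z + s - ∑ h_j u_j`. Eliminating `v₀` and
  -- `β` leaves an elliptic system for `u` alone, with modified zeroth-order and Robin matrices;
  -- here is its homogeneous version.
  have huniq : ∀ u : Solid n → ℝ → ℝ, (∀ m, MemH2 (u m)) →
      (∀ m, ∀ᵐ z ∂vol01, ∑ j, ((if m = j then 1 else 0) - F m * hh j / Γ0) * u j z
        - M.γ m * dz (dz (u m)) z + ∑ j, dz (fun y => M.E01 m j M.φ0 * u j y) z = 0) →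
      (∀ m, 1 * u m 0 + 0 * dz (u m) 0 = 0) →
      (∀ m, dz (u m) 1 = ∑ j, ((if m = j then M.A m else 0) + M.A m * hh j / Γ0) * u j 1) →
      ∀ m, ∀ z ∈ Icc (0 : ℝ) 1, u m z = 0 := by
    intro u hu heq hu0 hu1
    have hu0' : ∀ m, u m 0 = 0 := fun m => by simpa using hu0 m
    have hS := MemH1.sum (s := Finset.univ) (u := fun j z => hh j * u j z)
      fun j _ => (hu j).1.const_mul _
    have hv := hS.1.const_mul (-Γ0⁻¹)
    set v : ℝ → ℝ := fun z => -Γ0⁻¹ * ∑ j, hh j * u j z with hvdef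
    have hv0 : v 0 = 0 := by simp [hvdef, hu0']
    set Z := nrm (dz v) with hZ
    have hZ0 : 0 ≤ Z := nrm_nonneg _
    have hvh : hnrm v = Z := by rw [hnrm, hv0, abs_zero, zero_add]
    have hvn : nrm v ≤ Z := hvh ▸ hv.nrm_le
    have hv1 : |v 1| ≤ Z := hvh ▸ hv.abs_le (by simp)
    have hZle : Z ≤ (∑ m, (M.H 1 m).bd * nrm (dz (u m))) / M.Γmin := by
      have h1 : Z = |-Γ0⁻¹| * nrm (fun z => ∑ j, dz (fun y => hh j * u j y) z) := by
        rw [hZ, nrm_congr (MemH1.dz_const_mul (-Γ0⁻¹) hS.1), nrm_const_mul, nrm_congr hS.2]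
      rw [h1, abs_neg, abs_of_pos (inv_pos.2 hΓ0p), ← div_eq_inv_mul]
      refine div_le_div₀ (Finset.sum_nonneg fun m _ =>
        mul_nonneg (M.H 1 m).bd_pos.le (nrm_nonneg _)) ?_ hΓ hΓ0min
      refine (nrm_sum_le fun j _ => ((hu j).1.const_mul (hh j)).2).trans
        (Finset.sum_le_sum fun j _ => ?_)
      rw [nrm_congr (MemH1.dz_const_mul (hh j) (hu j).1), nrm_const_mul]
      exact mul_le_mul_of_nonneg_right (hhb j) (nrm_nonneg _)
    have hvz : ∀ z, ∑ j, hh j * u j z = -(Γ0 * v z) := fun z => by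
      simp only [hvdef]; field_simp
    have key := hest 0 0 Z le_rfl hτ0.le le_rfl hZ0 (fun l _ => M.φ0 l) (fun l => MemH1.const _)
      hcube u (fun m z => -F m * v z) hu (fun m => hv.memLp.const_mul _)
      (fun m => by
        rw [hu0', abs_zero, nrm_const_mul, abs_neg, zero_add, zero_add]
        exact mul_le_mul (hFb m) hvn (nrm_nonneg _) (M.F m).bd_pos.le)
      (fun m => by rw [hu0', abs_zero])
      (fun m => by
        have h1 : dz (u m) 1 = M.A m * (u m 1 - v 1) := by
          rw [hu1 m]
          simp only [add_mul, Finset.sum_add_distrib, ite_mul, zero_mul, Finset.sum_ite_eq,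
            Finset.mem_univ, if_true]
          have : ∑ j, M.A m * hh j / Γ0 * u j 1 = M.A m / Γ0 * ∑ j, hh j * u j 1 := by
            rw [Finset.mul_sum]; exact Finset.sum_congr rfl fun j _ => by ring
          rw [this, hvz]; field_simp; ring
        rw [h1, abs_mul]
        refine mul_le_mul_of_nonneg_left ((abs_sub _ _).trans ?_) (abs_nonneg _)
        have h2 := (hu m).1.abs_le (z := 1) (by simp)
        rw [hnrm, hu0', abs_zero, zero_add] at h2
        linarith)
      (fun m => by
        filter_upwards [heq m] with z hz
        simp only [sub_mul, Finset.sum_sub_distrib, ite_mul, zero_mul, one_mul,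
          Finset.sum_ite_eq, Finset.mem_univ, if_true] at hz
        have : ∑ j, F m * hh j / Γ0 * u j z = F m / Γ0 * ∑ j, hh j * u j z := by
          rw [Finset.mul_sum]; exact Finset.sum_congr rfl fun j _ => by ring
        rw [this, hvz, show F m / Γ0 * -(Γ0 * v z) = -F m * v z by field_simp] at hz
        simp only [zero_mul, add_zero]
        linarith)
    -- The velocity induced by a homogeneous solution satisfies `Z ≤ 3/4 Z`.
    have hZz : Z = 0 := by
      have := key.2
      linarith
    intro m z hz
    have h1 := key.1 m
    rw [hZz, add_zero, mul_zero] at h1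
    have h2 := (hu m).1.abs_le hz
    rw [hnrm, hu0', abs_zero, zero_add] at h2
    exact abs_nonpos_iff.1 (h2.trans h1)
  obtain ⟨u, hu, heq, hu0, hu1⟩ := exists_elliptic (G := M.γ) M.γ_pos
    (Cm := fun m j => (if m = j then 1 else 0) - F m * hh j / Γ0)
    (R := fun m j => (if m = j then M.A m else 0) + M.A m * hh j / Γ0)
    (e := fun m j _ => M.E01 m j M.φ0) (fun m j => MemH1.const _)
    (f := fun m z => M.Gw m M.φ0 - F m / Γ0 * (M.Gv M.φ0 * z + s))
    (fun m => ContinuousOn.memLp_vol01 (by fun_prop)) (p := fun _ => 1) (q := fun _ => 0)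
    g (fun m => -M.A m * (M.Gv M.φ0 + s) / Γ0 - M.A m * b) huniq
  have hu0' : ∀ m, u m 0 = g m := fun m => by simpa using hu0 m
  have hid : MemH1 (fun z : ℝ => M.Gv M.φ0 * z + s) ∧
      ∀ z ∈ Icc (0 : ℝ) 1, dz (fun z : ℝ => M.Gv M.φ0 * z + s) z = M.Gv M.φ0 :=
    MemH1.of_hasDerivWithinAt (f := fun _ => M.Gv M.φ0) continuousOn_const fun z _ => by
      simpa using (((hasDerivAt_id z).const_mul (M.Gv M.φ0)).add_const s).hasDerivWithinAt
  have hS := MemH1.sum (s := Finset.univ) (u := fun j z => hh j * u j z)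
    fun j _ => (hu j).1.const_mul _
  have hN := hid.1.add (hS.1.const_mul (-1))
  set v0 : ℝ → ℝ := fun z => Γ0⁻¹ * (M.Gv M.φ0 * z + s + -1 * ∑ j, hh j * u j z) with hv0
  have hv : ∀ z, Γ0 * v0 z = M.Gv M.φ0 * z + s + -1 * ∑ j, hh j * u j z := fun z => by
    simp only [hv0]; field_simp
  have hvS : ∀ z, ∑ j, hh j * u j z = M.Gv M.φ0 * z + s - Γ0 * v0 z := fun z => by
    rw [hv]; ring
  refine ⟨v0, u, v0 1 + b, hu, hN.const_mul _, ?_, ?_, ?_, ?_, ?_, ?_⟩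
  · have : (fun y => M.Γ M.φ0 * v0 y) = fun z => M.Gv M.φ0 * z + s + -1 * ∑ j, hh j * u j z :=
      funext hv
    rw [this]
    filter_upwards [MemH1.dz_add hid.1 (hS.1.const_mul (-1)), MemH1.dz_const_mul (-1) hS.1, hS.2,
      ae_vol01_mem_Icc] with z h1 h2 h3 hz
    rw [h1, h2, h3, hid.2 z hz]
    ring
  · intro m
    filter_upwards [heq m] with z hz
    simp only [sub_mul, Finset.sum_sub_distrib, ite_mul, zero_mul, one_mul,
      Finset.sum_ite_eq, Finset.mem_univ, if_true] at hz
    have : ∑ j, F m * hh j / Γ0 * u j z = F m / Γ0 * ∑ j, hh j * u j z := by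
      rw [Finset.mul_sum]; exact Finset.sum_congr rfl fun j _ => by ring
    rw [this, hvS, show F m / Γ0 * (M.Gv M.φ0 * z + s - Γ0 * v0 z)
      = F m / Γ0 * (M.Gv M.φ0 * z + s) - F m * v0 z by field_simp] at hz
    linarith
  · intro m
    rw [hu0', hg]
    have := (hhp m).ne'
    simp only [hhdef] at this ⊢
    field_simp
  · intro m
    rw [hu1 m]
    simp only [add_mul, Finset.sum_add_distrib, ite_mul, zero_mul, Finset.sum_ite_eq,
      Finset.mem_univ, if_true]
    have : ∑ j, M.A m * hh j / Γ0 * u j 1 = M.A m / Γ0 * ∑ j, hh j * u j 1 := by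
      rw [Finset.mul_sum]; exact Finset.sum_congr rfl fun j _ => by ring
    rw [this, hvS]; field_simp; ring
  · simp only [hv0, hu0', mul_zero, zero_add, hs]; ring
  · rw [hb]; field_simp; ring

end Model

end Rothe

/-! ### Admissible states and the displacement equation. -/

namespace Rothe

open Filter Topology

/-- If `|u z|` exceeds the gradient norm, the excess is a pointwise lower bound for `|u|` on the
interval, hence for its `L²` norm. -/
theorem MemH1.abs_le_nrm {u : ℝ → ℝ} (hu : MemH1 u) {z : ℝ} (hz : z ∈ Icc (0 : ℝ) 1) :
    |u z| ≤ nrm u + nrm (dz u) := by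
  by_cases h : |u z| - nrm (dz u) ≤ 0
  · linarith [nrm_nonneg u]
  push Not at h
  have h1 := (nrm_mono (u := fun _ => |u z| - nrm (dz u)) (v := u) aestronglyMeasurable_const
    hu.memLp (by
      filter_upwards [ae_vol01_mem_Icc] with y hy
      rw [abs_of_pos h]
      have := hu.abs_sub_le hy hz
      have := abs_sub_abs_le_abs_sub (u z) (u y)
      linarith)).2
  rw [nrm_const, abs_of_pos h] at h1
  linarith

theorem MemH1.hnrm_le {u : ℝ → ℝ} (hu : MemH1 u) : hnrm u ≤ nrm u + 2 * nrm (dz u) := by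
  have := hu.abs_le_nrm (z := 0) (by simp)
  unfold hnrm; linarith

namespace Model

variable {n : ℕ}

/-- A common bound for the coefficients and constants of the model. -/
structure Bounds (M : Model n) (L : ℝ) : Prop where
  one_le : 1 ≤ L
  I : ∀ l, (M.I l).bd ≤ L
  Γ : M.Γ.bd ≤ L
  B : ∀ l i j m, (M.B l i j m).bd ≤ L
  H : ∀ j m, (M.H j m).bd ≤ L
  E0 : ∀ m i j, (M.E0 m i j).bd ≤ L
  E01 : ∀ m j, (M.E01 m j).bd ≤ L
  Gφ : ∀ l, (M.Gφ l).bd ≤ L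
  Gv : M.Gv.bd ≤ L
  Gw : ∀ m, (M.Gw m).bd ≤ L
  F : ∀ m, (M.F m).bd ≤ L
  D : ∀ m, M.D m ≤ L
  invγ : ∀ m, (M.γ m)⁻¹ ≤ L
  J : ∀ l, M.J l ≤ L
  δ : ∀ l, M.δ l ≤ L
  invδ : ∀ l, (M.δ l)⁻¹ ≤ L
  invΓ : M.Γmin⁻¹ ≤ L

theorem exists_bounds (M : Model n) : ∃ L : ℝ, M.Bounds L := by
  obtain ⟨a1, h1, k1⟩ := exists_forall_le_of_finite fun l => (M.I l).bd
  obtain ⟨a2, h2, k2⟩ := exists_forall_le_of_finite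
    fun p : Comp n × Fin 2 × Fin 2 × Solid n => (M.B p.1 p.2.1 p.2.2.1 p.2.2.2).bd
  obtain ⟨a3, h3, k3⟩ := exists_forall_le_of_finite fun p : Fin 2 × Solid n => (M.H p.1 p.2).bd
  obtain ⟨a4, h4, k4⟩ := exists_forall_le_of_finite
    fun p : Solid n × Fin 2 × Solid n => (M.E0 p.1 p.2.1 p.2.2).bd
  obtain ⟨a5, h5, k5⟩ := exists_forall_le_of_finite fun p : Solid n × Solid n => (M.E01 p.1 p.2).bd
  obtain ⟨a6, h6, k6⟩ := exists_forall_le_of_finite fun l => (M.Gφ l).bd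
  obtain ⟨a7, h7, k7⟩ := exists_forall_le_of_finite fun m => (M.Gw m).bd
  obtain ⟨a8, h8, k8⟩ := exists_forall_le_of_finite fun m => (M.F m).bd
  obtain ⟨a9, h9, k9⟩ := exists_forall_le_of_finite M.D
  obtain ⟨a10, h10, k10⟩ := exists_forall_le_of_finite fun m => (M.γ m)⁻¹
  obtain ⟨a11, h11, k11⟩ := exists_forall_le_of_finite M.J
  obtain ⟨a12, h12, k12⟩ := exists_forall_le_of_finite M.δ
  obtain ⟨a13, h13, k13⟩ := exists_forall_le_of_finite fun l => (M.δ l)⁻¹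
  have h14 := M.Γ.bd_pos
  have h15 := M.Gv.bd_pos
  have h16 := le_max_right M.Γmin⁻¹ 0
  have k16 := le_max_left M.Γmin⁻¹ 0
  refine ⟨1 + a1 + a2 + a3 + a4 + a5 + a6 + a7 + a8 + a9 + a10 + a11 + a12 + a13 + M.Γ.bd + M.Gv.bd
    + max M.Γmin⁻¹ 0, ⟨by linarith, fun l => ?_, by linarith, fun l i j m => ?_, fun j m => ?_,
      fun m i j => ?_, fun m j => ?_, fun l => ?_, by linarith, fun m => ?_, fun m => ?_,
      fun m => ?_, fun m => ?_, fun l => ?_, fun l => ?_, fun l => ?_, by linarith⟩⟩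
  · linarith [k1 l]
  · linarith [k2 (l, i, j, m)]
  · linarith [k3 (j, m)]
  · linarith [k4 (m, i, j)]
  · linarith [k5 (m, j)]
  · linarith [k6 l]
  · linarith [k7 m]
  · linarith [k8 m]
  · linarith [k9 m]
  · linarith [k10 m]
  · linarith [k11 l]
  · linarith [k12 l]
  · linarith [k13 l]

/-- A state of the discretised system with small gradients and displacements, and with velocity
bound `V`. -/
structure Good (M : Model n) (σ V : ℝ) (φ : Comp n → ℝ → ℝ) (w : Solid n → ℝ → ℝ) (v : ℝ → ℝ)
    (W : ℝ) : Prop where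
  φH2 : ∀ l, MemH2 (φ l)
  box : ∀ z ∈ Icc (0 : ℝ) 1, (fun l => φ l z) ∈ M.box M.φmin
  grad : gradNrm φ ≤ σ
  wH2 : ∀ m, MemH2 (w m)
  w0 : ∀ m, |w m 0| ≤ 1
  w1 : ∀ m, nrm (dz (w m)) ≤ 1
  w2 : ∀ m, nrm (dz (dz (w m))) ≤ 1
  bcw : ∀ m, dz (w m) 1 = M.A m * (w m 1 - W)
  vH1 : MemH1 v
  v0 : v 0 = 0
  v1 : nrm (dz v) ≤ V

section Good

variable {M : Model n} {σ V : ℝ} {φ : Comp n → ℝ → ℝ} {w : Solid n → ℝ → ℝ} {v : ℝ → ℝ} {W : ℝ}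

theorem Good.cube (hg : M.Good σ V φ w v W) (h : 0 < M.φmin) : InCube φ :=
  fun z hz l => box_subset h (hg.box z hz) l

theorem Good.φH1 (hg : M.Good σ V φ w v W) (l : Comp n) : MemH1 (φ l) := (hg.φH2 l).1

theorem Good.hnrm_v (hg : M.Good σ V φ w v W) : hnrm v ≤ V := by
  rw [hnrm, hg.v0, abs_zero, zero_add]; exact hg.v1

theorem Good.hnrm_w (hg : M.Good σ V φ w v W) (m : Solid n) : hnrm (w m) ≤ 2 := by
  have := hg.w0 m; have := hg.w1 m; unfold hnrm; linarith

theorem Good.hnrm_dzPow_w (hg : M.Good σ V φ w v W) (i : Fin 2) (m : Solid n) :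
    MemH1 (dzPow i (w m)) ∧ nrm (dz (dzPow i (w m))) ≤ 1 ∧ hnrm (dzPow i (w m)) ≤ 3 := by
  unfold dzPow
  split_ifs
  · exact ⟨(hg.wH2 m).1, hg.w1 m, (hg.hnrm_w m).trans (by norm_num)⟩
  · refine ⟨(hg.wH2 m).2, hg.w2 m, (hg.wH2 m).2.hnrm_le.trans ?_⟩
    linarith [hg.w1 m, hg.w2 m]

end Good

theorem posPt_mem {a b : ℝ} (ha : a ≤ 1) (hb : 0 ≤ b) : 0 ≤ posPt (a - b) ∧ posPt (a - b) ≤ 1 :=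
  ⟨le_max_right _ _, max_le (by linarith) zero_le_one⟩

/-- Solvability and estimate of the displacement equation for the rates `u`. -/
theorem exists_rates {M : Model n} (h1 : M.Reservoirs) (h4 : M.Nondegenerate)
    (h5 : M.PseudoParabolic) (h7 : M.InitialFractions) (h9 : M.VelocityCoupling) :
    ∃ τ0 K : ℝ, 0 < τ0 ∧ 0 ≤ K ∧ ∀ τ V σ, 0 < τ → τ ≤ τ0 → 0 ≤ V → σ ≤ 1 →
      ∀ φ w v W, M.Good σ V φ w v W → ∃ (u : Solid n → ℝ → ℝ) (β : ℝ),
        (∀ m, MemH2 (u m)) ∧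
        (∀ m, ∀ᵐ z ∂vol01, u m z - M.D m * (dz (dz (w m)) z + τ * dz (dz (u m)) z)
          - M.γ m * dz (dz (u m)) z + M.F m (fun k => φ k z) * v z
          + ∑ j, ((∑ i : Fin 2, dz (fun y => M.E0 m i j (fun k => φ k y) * dzPow i (w j) y) z)
            + dz (fun y => M.E01 m j (fun k => φ k y) * u j y) z) = M.Gw m (fun k => φ k z)) ∧
        (∀ m, M.H 1 m (fun k => φ k 0) * u m 0
          = M.J m.castSucc * posPt (M.res m.castSucc - φ m.castSucc 0)) ∧
        (∀ m, dz (u m) 1 = M.A m * (u m 1 - β)) ∧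
        (M.Γ (fun k => φ k 1) * (β - v 1)
          = M.J (compD n) * posPt (M.res (compD n) - φ (compD n) 1)) ∧
        (∀ m, hnrm (u m) ≤ K * (V + 1)) ∧ (∀ m, nrm (dz (dz (u m))) ≤ K * (V + 1)) ∧
        (∑ m, (M.H 1 m).bd * nrm (dz (u m))) / M.Γmin ≤ 3 / 4 * V + K := by
  have hΓ := Γmin_pos h4 h7
  obtain ⟨τ0, K, hτ0, hK, hest⟩ := exists_rate_estimate hΓ h5 h9
  obtain ⟨h0, hh0, hh0'⟩ := exists_H_lower h4 h7
  obtain ⟨L, hL⟩ := M.exists_bounds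
  have hL1 := hL.one_le
  set N : ℝ := (n : ℝ) + 1 with hN
  have hN0 : 0 < N := by positivity
  -- The summands bound the lagged data, the influx rate at the left end and the influx contribution
  -- to `β`. None depends on `V`, which keeps the factor `3/4` in front of `V` intact.
  set C : ℝ := 2 * L + N * (2 * (4 * L)) + L / h0 + L * L with hC
  have hC0 : 0 ≤ C := by positivity
  set K1 : ℝ := K * (1 + C) + C with hK1
  have hK10 : 0 ≤ K1 := by positivity
  have hgb : C ≤ K1 := by have : 0 ≤ K * (1 + C) := by positivity
                          linarith
  set K2 : ℝ := L * (K1 + N * (2 * L * K1) + (C + L)) with hK2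
  have hK20 : 0 ≤ K2 := by positivity
  refine ⟨τ0, max K1 K2 + K * C, hτ0, by positivity, ?_⟩
  intro τ V σ hτ hτ' hV hσ φ w v W hg
  have hc := hg.cube h7.1
  have hφ := hg.φH1
  have hgr : gradNrm φ ≤ 1 := hg.grad.trans hσ
  have hb0 := hg.box 0 (by simp)
  have hb1 := hg.box 1 (by simp)
  set g : Solid n → ℝ := fun m => M.J m.castSucc *
    posPt (M.res m.castSucc - φ m.castSucc 0) / M.H 1 m (fun k => φ k 0) with hgdef
  have hH0 : ∀ m, h0 ≤ M.H 1 m (fun k => φ k 0) := hh0' _ hb0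
  have hJb : ∀ l z, z ∈ Icc (0 : ℝ) 1 → 0 ≤ M.J l * posPt (M.res l - φ l z) ∧
      M.J l * posPt (M.res l - φ l z) ≤ L := by
    intro l z hz
    have hp := posPt_mem (h1.2.2.1 l).2 (hc z hz l).1.le
    refine ⟨mul_nonneg (h1.1 l) hp.1, ?_⟩
    have := mul_le_mul (hL.J l) hp.2 hp.1 (by linarith)
    linarith
  have hgle : ∀ m, |g m| ≤ L / h0 := fun m => by
    have hj := hJb m.castSucc 0 (by simp)
    rw [hgdef, abs_of_nonneg (div_nonneg hj.1 (hh0.le.trans (hH0 m)))]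
    exact div_le_div₀ (by linarith) hj.2 hh0 (hH0 m)
  have hΓ1 : M.Γmin ≤ M.Γ (fun k => φ k 1) := Γmin_le h7.1 hb1
  set b : ℝ := M.J (compD n) * posPt (M.res (compD n) - φ (compD n) 1) / M.Γ (fun k => φ k 1) with hb
  have hble : |b| ≤ L * L := by
    have hj := hJb (compD n) 1 (by simp)
    rw [hb, abs_of_nonneg (div_nonneg hj.1 (hΓ.le.trans hΓ1)), div_eq_mul_inv]
    refine mul_le_mul hj.2 ((inv_anti₀ hΓ hΓ1).trans hL.invΓ)
      (inv_nonneg.2 (hΓ.le.trans hΓ1)) (by linarith)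
  -- Inserting `w' = w + τ u` splits the diffusion term into a known part and `τ D u''`, so the
  -- rates see the diffusivity `γ + τ D`.
  have hG : ∀ m, 0 < M.γ m + τ * M.D m := fun m =>
    add_pos (M.γ_pos m) (mul_pos hτ (M.D_pos m))
  have hE := fun m i j => (M.E0 m i j).nrm_dz_mul_le hφ hc (hg.hnrm_dzPow_w i j).1
  set f0 : Solid n → ℝ → ℝ := fun m z => M.Gw m (fun k => φ k z) + (M.D m * dz (dz (w m)) z
    + -1 * ∑ j, ∑ i : Fin 2, dz (fun y => M.E0 m i j (fun k => φ k y) * dzPow i (w j) y) z) with hf0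
  have hf0S : ∀ m, MemLp (fun z => ∑ j, ∑ i : Fin 2,
      dz (fun y => M.E0 m i j (fun k => φ k y) * dzPow i (w j) y) z) 2 vol01 ∧
      nrm (fun z => ∑ j, ∑ i : Fin 2,
        dz (fun y => M.E0 m i j (fun k => φ k y) * dzPow i (w j) y) z) ≤ N * (2 * (4 * L)) := by
    intro m
    have hi : ∀ j, MemLp (fun z => ∑ i : Fin 2,
        dz (fun y => M.E0 m i j (fun k => φ k y) * dzPow i (w j) y) z) 2 vol01 := fun j =>
      memLp_finsetSum _ fun i _ => (hE m i j).1.2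
    refine ⟨memLp_finsetSum _ fun j _ => hi j, (nrm_sum_le fun j _ => hi j).trans ?_⟩
    have hj : ∀ j, nrm (fun z => ∑ i : Fin 2,
        dz (fun y => M.E0 m i j (fun k => φ k y) * dzPow i (w j) y) z) ≤ 2 * (4 * L) := by
      intro j
      refine (nrm_sum_le fun i _ => (hE m i j).1.2).trans ?_
      have : ∀ i : Fin 2, nrm (dz fun y => M.E0 m i j (fun k => φ k y) * dzPow i (w j) y)
          ≤ 4 * L := by
        intro i
        refine (hE m i j).2.trans ?_
        have e1 := hg.hnrm_dzPow_w i j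
        have e2 := (M.E0 m i j).bd_pos
        have e3 := hL.E0 m i j
        have e4 := gradNrm_nonneg φ
        have e5 := hnrm_nonneg (dzPow i (w j))
        have t1 : (M.E0 m i j).bd * nrm (dz (dzPow i (w j))) ≤ L * 1 :=
            mul_le_mul e3 e1.2.1 (nrm_nonneg _) (by linarith)
        have t2 : (M.E0 m i j).bd * gradNrm φ * hnrm (dzPow i (w j)) ≤ L * 1 * 3 := by
          gcongr; exact e1.2.2
        linarith
      rw [Fin.sum_univ_two]
      linarith [this 0, this 1]
    refine (Finset.sum_le_sum fun j _ => hj j).trans (le_of_eq ?_)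
    rw [Finset.sum_const, Finset.card_univ, Fintype.card_fin, nsmul_eq_mul]
    push_cast; rfl
  have hf0m : ∀ m, MemLp (f0 m) 2 vol01 ∧ nrm (f0 m) ≤ 2 * L + N * (2 * (4 * L)) := by
    intro m
    have a1 := (M.Gw m).memLp_comp hφ hc
    have a2 : MemLp (fun z => M.D m * dz (dz (w m)) z) 2 vol01 := (hg.wH2 m).2.2.const_mul _
    have a3 := (hf0S m).1.const_mul (-1)
    refine ⟨a1.1.add (a2.add a3), (nrm_add_le a1.1).trans ?_⟩
    have b2 : nrm (fun z => M.D m * dz (dz (w m)) z) ≤ L := by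
      rw [nrm_const_mul, abs_of_pos (M.D_pos m)]
      have := mul_le_mul (hL.D m) (hg.w2 m) (nrm_nonneg _) (by linarith)
      linarith
    have b3 : nrm (fun z => -1 * ∑ j, ∑ i : Fin 2,
        dz (fun y => M.E0 m i j (fun k => φ k y) * dzPow i (w j) y) z) ≤ N * (2 * (4 * L)) := by
      rw [nrm_const_mul]
      simpa using (hf0S m).2
    have b4 := nrm_add_le (v := fun z => -1 * ∑ j, ∑ i : Fin 2,
        dz (fun y => M.E0 m i j (fun k => φ k y) * dzPow i (w j) y) z) a2
    linarith [a1.2, hL.Gw m]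
  have hFv := fun m => (M.F m).nrm_mul_le hφ hc hg.vH1.memLp
  have hvV : nrm v ≤ V := hg.vH1.nrm_le.trans hg.hnrm_v
  set f : Solid n → ℝ → ℝ := fun m z => f0 m z + -1 * (M.F m (fun k => φ k z) * v z) with hf
  have hfm : ∀ m, MemLp (f m) 2 vol01 ∧
      nrm (f m) ≤ 2 * L + N * (2 * (4 * L)) + (M.F m).bd * V := by
    intro m
    refine ⟨(hf0m m).1.add ((hFv m).1.const_mul (-1)), (nrm_add_le (hf0m m).1).trans ?_⟩
    rw [nrm_const_mul]
    have := (hFv m).2.trans (mul_le_mul_of_nonneg_left hvV (M.F m).bd_pos.le)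
    simp only [abs_neg, abs_one, one_mul]
    linarith [(hf0m m).2]
  obtain ⟨u, hu, heq, hu0, hu1⟩ := exists_elliptic hG
    (Cm := fun m j => if m = j then 1 else 0) (R := fun m j => if m = j then M.A m else 0)
    (e := fun m j y => M.E01 m j (fun k => φ k y)) (fun m j => ((M.E01 m j).memH1_comp hφ hc).1)
    (f := f) (fun m => (hfm m).1) (p := fun _ => 1) (q := fun _ => 0) g
    (fun m => -M.A m * (v 1 + b)) (by
      intro u hu heq hu0 hu1 m z hz
      have hu0' : ∀ m, u m 0 = 0 := fun m => by simpa using hu0 m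
      have h2 : ∀ m, |u m 1| ≤ nrm (dz (u m)) := fun m => by
        have h2 := (hu m).1.abs_le (z := 1) (by simp)
        rwa [hnrm, hu0', abs_zero, zero_add] at h2
      -- Uniqueness is the a priori estimate itself with zero data and zero velocity.
      have key := (hest τ 0 0 hτ.le hτ' le_rfl le_rfl φ hφ hc u (fun _ _ => 0) hu
        (fun _ => memLp_const 0) (fun m => by rw [hu0', nrm_const]; simp)
        (fun m => by rw [hu0']; simp)
        (fun m => by
          rw [hu1]
          simp only [ite_mul, zero_mul, Finset.sum_ite_eq, Finset.mem_univ, if_true, abs_mul]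
          exact mul_le_mul_of_nonneg_left (by linarith [h2 m]) (abs_nonneg _))
        (fun m => by
          filter_upwards [heq m] with z hz
          simpa using hz)).1 m
      have h3 := (hu m).1.abs_le hz
      rw [hnrm, hu0', abs_zero, zero_add] at h3
      rw [add_zero, mul_zero] at key
      exact abs_nonpos_iff.1 (h3.trans key))
  have hu0' : ∀ m, u m 0 = g m := fun m => by simpa using hu0 m
  have hu1' : ∀ m, dz (u m) 1 = M.A m * (u m 1 - (v 1 + b)) := fun m => by
    rw [hu1]; simp; ring
  have heq' : ∀ m, ∀ᵐ z ∂vol01, u m z - (M.γ m + τ * M.D m) * dz (dz (u m)) z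
      + ∑ j, dz (fun y => M.E01 m j (fun k => φ k y) * u j y) z = f m z := fun m => by
    filter_upwards [heq m] with z hz
    simpa using hz
  have hgC : ∀ m, |u m 0| ≤ L / h0 := fun m => by rw [hu0']; exact hgle m
  have hLL : 0 ≤ L * L := by positivity
  have hLh : 0 ≤ L / h0 := by positivity
  have hNL : 0 ≤ N * (2 * (4 * L)) := by positivity
  have key := hest τ C V hτ.le hτ' hC0 hV φ hφ hc u f hu (fun m => (hfm m).1)
    (fun m => by linarith [(hfm m).2, hgC m])
    (fun m => by linarith [hgC m])
    (fun m => by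
      rw [hu1', abs_mul]
      refine mul_le_mul_of_nonneg_left ?_ (abs_nonneg _)
      have e1 := abs_sub (u m 1) (v 1 + b)
      have e2 := abs_add_le (v 1) b
      have e3 := (hu m).1.abs_le (z := 1) (by simp)
      have e4 := (hg.vH1.abs_le (z := 1) (by simp)).trans hg.hnrm_v
      unfold hnrm at e3
      linarith [hgC m]) heq'
  have hhn : ∀ m, hnrm (u m) ≤ K1 * (V + 1) := by
    intro m
    have e1 := key.1 m
    have e2 := hgC m
    unfold hnrm
    have e3 : K * (V + C) + C ≤ K1 * (V + 1) := by
      rw [hK1]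
      have : 0 ≤ K * (C * V) + C * V + K := by positivity
      linarith
    linarith
  have hKK : 0 ≤ K * C := by positivity
  refine ⟨u, v 1 + b, hu, fun m => ?_, fun m => ?_, hu1', ?_, fun m => ?_, fun m => ?_, ?_⟩
  · filter_upwards [heq' m] with z hz
    simp only [hf, hf0] at hz
    rw [Finset.sum_add_distrib]
    linarith
  · rw [hu0', hgdef]
    have := (hh0.trans_le (hH0 m)).ne'
    field_simp
  · rw [hb]
    have := (hΓ.trans_le hΓ1).ne'
    field_simp
    ring
  · refine (hhn m).trans (mul_le_mul_of_nonneg_right ?_ (by linarith))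
    linarith [le_max_left K1 K2]
  · have hEu := fun j => (M.E01 m j).nrm_dz_mul_le hφ hc (hu j).1
    have hSm : MemLp (fun z => ∑ j, dz (fun y => M.E01 m j (fun k => φ k y) * u j y) z) 2 vol01 :=
      memLp_finsetSum _ fun j _ => (hEu j).1.2
    have hS : nrm (fun z => ∑ j, dz (fun y => M.E01 m j (fun k => φ k y) * u j y) z)
        ≤ N * (2 * L * K1) * (V + 1) := by
      refine (nrm_sum_le fun j _ => (hEu j).1.2).trans ?_
      have : ∀ j, nrm (dz fun y => M.E01 m j (fun k => φ k y) * u j y)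
          ≤ 2 * L * K1 * (V + 1) := by
        intro j
        refine (hEu j).2.trans ?_
        have e1 := hhn j
        have e2 := (M.E01 m j).bd_pos
        have e3 := hL.E01 m j
        have e4 := gradNrm_nonneg φ
        have e5 := hnrm_nonneg (u j)
        have e6 : nrm (dz (u j)) ≤ hnrm (u j) := by
          unfold hnrm; linarith [abs_nonneg (u j 0)]
        have t1 : (M.E01 m j).bd * nrm (dz (u j)) ≤ L * (K1 * (V + 1)) :=
          mul_le_mul e3 (e6.trans e1) (nrm_nonneg _) (by linarith)
        have t2 : (M.E01 m j).bd * gradNrm φ * hnrm (u j) ≤ L * 1 * (K1 * (V + 1)) := by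
          gcongr
        linarith
      refine (Finset.sum_le_sum fun j _ => this j).trans (le_of_eq ?_)
      rw [Finset.sum_const, Finset.card_univ, Fintype.card_fin, nsmul_eq_mul]
      push_cast; rw [hN]; ring
    set inv : ℝ := (M.γ m + τ * M.D m)⁻¹
    have hinv : 0 ≤ inv ∧ inv ≤ L := by
      refine ⟨inv_nonneg.2 (hG m).le, le_trans (inv_anti₀ (M.γ_pos m) ?_) (hL.invγ m)⟩
      have := mul_pos hτ (M.D_pos m); linarith
    -- The second derivative is read off from the equation; `γ m` bounds the diffusivity below
    -- uniformly in `τ`.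
    have hue : dz (dz (u m)) =ᵐ[vol01] fun z => inv * (u m z +
        ((∑ j, dz (fun y => M.E01 m j (fun k => φ k y) * u j y) z) + -1 * f m z)) := by
      filter_upwards [heq' m] with z hz
      have := (hG m).ne'
      rw [← hz]; simp only [inv]; field_simp; ring
    rw [nrm_congr hue, nrm_const_mul, abs_of_nonneg hinv.1]
    have t1 := nrm_add_le (v := fun z => (∑ j, dz (fun y => M.E01 m j (fun k => φ k y) * u j y) z)
      + -1 * f m z) (hu m).1.memLp
    have t2 := nrm_add_le (v := fun z => -1 * f m z) hSm
    rw [nrm_const_mul, abs_neg, abs_one, one_mul] at t2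
    have t3 := (hu m).1.nrm_le.trans (hhn m)
    have t4 : nrm (f m) ≤ (C + L) * (V + 1) := by
      have e1 := (hfm m).2
      have e2 : (M.F m).bd * V ≤ L * V := mul_le_mul_of_nonneg_right (hL.F m) hV
      have e3 : 0 ≤ C * V := by positivity
      linarith
    have t5 : nrm (fun z => u m z + ((∑ j, dz (fun y => M.E01 m j (fun k => φ k y) * u j y) z)
        + -1 * f m z)) ≤ (K1 + N * (2 * L * K1) + (C + L)) * (V + 1) := by linarith
    refine (mul_le_mul hinv.2 t5 (nrm_nonneg _) (by linarith)).trans ?_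
    rw [← mul_assoc]
    refine mul_le_mul_of_nonneg_right ?_ (by linarith)
    linarith [le_max_right K1 K2]
  · linarith [key.2, le_max_left K1 K2]

end Model

end Rothe

/-! ### The continuity equation. -/

namespace Rothe

open Filter Topology

theorem MemH1.inv {g : ℝ → ℝ} (hg : MemH1 g) {c : ℝ} (hc : 0 < c)
    (h : ∀ z ∈ Icc (0 : ℝ) 1, c ≤ g z) : MemH1 (fun z => (g z)⁻¹) := by
  have hac : AbsolutelyContinuousOnInterval (fun z => (g z)⁻¹) 0 1 :=
    AC.of_dist_le (K := (c * c)⁻¹) (s := Finset.univ) (u := fun _ : Unit => g) (fun _ _ => hg.1)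
      fun x hx y hy => by
        have hx' := h x hx
        have hy' := h y hy
        have hxp := hc.trans_le hx'
        have hyp := hc.trans_le hy'
        rw [inv_sub_inv hxp.ne' hyp.ne', abs_div, abs_of_pos (mul_pos hxp hyp), abs_sub_comm,
          div_eq_inv_mul]
        simp only [Finset.univ_unique, Finset.sum_const, Finset.card_singleton, one_smul]
        have : (g x * g y)⁻¹ ≤ (c * c)⁻¹ :=
          inv_anti₀ (by positivity) (mul_le_mul hx' hy' hc.le hxp.le)
        exact mul_le_mul_of_nonneg_right this (abs_nonneg _)
  have hcont : ContinuousOn (fun z => -(g z ^ 2)⁻¹) (Icc 0 1) :=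
    ((hg.continuousOn.pow 2).inv₀ fun z hz => pow_ne_zero 2 (hc.trans_le (h z hz)).ne').neg
  refine ⟨hac, (MemLp.mul_continuousOn hg.2 hcont).ae_eq ?_⟩
  filter_upwards [hg.ae_hasDerivAt, ae_vol01_mem_Icc] with z hz hz'
  rw [HasDerivAt.dz_eq (hz.fun_inv (hc.trans_le (h z hz')).ne') hz']
  field_simp

namespace Model

variable {n : ℕ}

/-- Solvability and estimate of the continuity equation. -/
theorem exists_velocity {M : Model n} (h4 : M.Nondegenerate) (h7 : M.InitialFractions) {K : ℝ}
    (hK : 0 ≤ K) :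
    ∃ σ0 V0 : ℝ, 0 < σ0 ∧ σ0 ≤ 1 ∧ 0 ≤ V0 ∧ ∀ V, V0 ≤ V → ∀ φ w v W, M.Good σ0 V φ w v W →
      ∀ u : Solid n → ℝ → ℝ, (∀ m, MemH2 (u m)) → (∀ m, hnrm (u m) ≤ K * (V + 1)) →
      (∑ m, (M.H 1 m).bd * nrm (dz (u m))) / M.Γmin ≤ 3 / 4 * V + K →
      ∃ v' : ℝ → ℝ, MemH1 v' ∧ v' 0 = 0 ∧ nrm (dz v') ≤ V ∧
        ∀ᵐ z ∂vol01, (∑ m, dz (fun y => M.H 0 m (fun k => φ k y) * w m y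
          + M.H 1 m (fun k => φ k y) * u m y) z)
          + dz (fun y => M.Γ (fun k => φ k y) * v' y) z = M.Gv (fun k => φ k z) := by
  have hΓ := Γmin_pos h4 h7
  obtain ⟨L, hL⟩ := M.exists_bounds
  have hL1 := hL.one_le
  set N : ℝ := (n : ℝ) + 1 with hN
  have hN0 : 0 < N := by positivity
  -- Derivatives of the coefficients are proportional to the gradients of the fractions. This
  -- smallness makes their contributions at most `(V + 1) / 20` and a twentieth of the new velocity
  -- norm.
  set σ0 : ℝ := min 1 (1 / (20 * (L * L * (N * K + 1)))) with hσ0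
  have hσpos : 0 < σ0 := by positivity
  set c : ℝ := L * L * (1 + 3 * N) + K + 1 / 20 with hc
  have hc0 : 0 ≤ c := by positivity
  -- The new velocity norm `Z` satisfies `19/20 Z ≤ c + 16/20 V`, so it stays below `V` once `V ≥
  -- 20/3 c`.
  refine ⟨σ0, 7 * c, hσpos, min_le_left _ _, by positivity, ?_⟩
  intro V hV φ w v W hg u hu hun hsum
  have hV0 : 0 ≤ V := by linarith
  have hcube := hg.cube h7.1
  have hφ := hg.φH1
  have hgr := hg.grad
  have hgr0 := gradNrm_nonneg φ
  have hσ1 : σ0 ≤ 1 := min_le_left _ _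
  have hσ2 : L * L * (N * K + 1) * σ0 ≤ 1 / 20 := by
    have : σ0 ≤ 1 / (20 * (L * L * (N * K + 1))) := min_le_right _ _
    rw [le_div_iff₀ (by positivity)] at this
    linarith
  have hσ3 : L * L * σ0 ≤ 1 / 20 := by
    have : 0 ≤ L * L * (N * K) * σ0 := by positivity
    linarith
  have hσ4 : L * L * (N * K) * σ0 ≤ 1 / 20 := by
    have : 0 ≤ L * L * σ0 := by positivity
    linarith
  have hw := fun m => (M.H 0 m).nrm_dz_mul_le hφ hcube (hg.wH2 m).1
  have hu' := fun m => (M.H 1 m).nrm_dz_mul_le hφ hcube (hu m).1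
  set q : Solid n → ℝ → ℝ := fun m y => M.H 0 m (fun k => φ k y) * w m y
          + M.H 1 m (fun k => φ k y) * u m y with hq
  have hq1 : ∀ m, MemH1 (q m) := fun m => (hw m).1.add (hu' m).1
  have hq2 : ∀ m, nrm (dz (q m)) ≤ 3 * L + L * σ0 * (K * (V + 1))
      + (M.H 1 m).bd * nrm (dz (u m)) := by
    intro m
    rw [hq, nrm_congr (MemH1.dz_add (hw m).1 (hu' m).1)]
    refine (nrm_add_le (hw m).1.2).trans ?_
    have e0 := (M.H 0 m).bd_pos
    have e1 := (M.H 1 m).bd_pos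
    have t1 : (M.H 0 m).bd * nrm (dz (w m)) ≤ L * 1 :=
      mul_le_mul (hL.H 0 m) (hg.w1 m) (nrm_nonneg _) (by linarith)
    have t2 : (M.H 0 m).bd * gradNrm φ * hnrm (w m) ≤ L * 1 * 2 :=
      mul_le_mul (mul_le_mul (hL.H 0 m) (hgr.trans hσ1) hgr0 (by linarith)) (hg.hnrm_w m)
        (hnrm_nonneg _) (by linarith)
    have t3 : (M.H 1 m).bd * gradNrm φ * hnrm (u m) ≤ L * σ0 * (K * (V + 1)) :=
      mul_le_mul (mul_le_mul (hL.H 1 m) hgr hgr0 (by linarith)) (hun m)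
        (hnrm_nonneg _) (by positivity)
    linarith [(hw m).2, (hu' m).2]
  have hGvc := M.Gv.memLp_comp hφ hcube
  set P0 : ℝ → ℝ := fun z => 0 + ∫ s in (0 : ℝ)..z, M.Gv (fun k => φ k s) with hP0
  have hP01 := MemH1.of_integral (u := P0) (c := 0) hGvc.1 fun z _ => rfl
  have hqS := MemH1.sum (s := Finset.univ) (u := q) fun m _ => hq1 m
  have hP1 := (hP01.1.add (hqS.1.const_mul (-1)))
  -- The constant of integration that makes the velocity vanish at the left end.
  set s0 : ℝ := ∑ m, q m 0 with hs0
  have hP := hP1.add (MemH1.const s0)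
  set P : ℝ → ℝ := fun z => P0 z + -1 * (∑ m, q m z) + s0 with hPdef
  have hPd : dz P =ᵐ[vol01] fun z => M.Gv (fun k => φ k z) + -1 * ∑ m, dz (q m) z := by
    filter_upwards [MemH1.dz_add hP1 (MemH1.const s0), MemH1.dz_add hP01.1 (hqS.1.const_mul (-1)),
      MemH1.dz_const_mul (-1) hqS.1, hqS.2, hP01.2] with z a1 a2 a3 a4 a5
    rw [a1, a2, a3, a4, a5, dz_const]; ring
  have hΓφ := (M.Γ.memH1_comp hφ hcube)
  set Γφ : ℝ → ℝ := fun y => M.Γ (fun k => φ k y) with hΓφdef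
  have hΓle : ∀ z ∈ Icc (0 : ℝ) 1, M.Γmin ≤ Γφ z := fun z hz => Γmin_le h7.1 (hg.box z hz)
  have hΓi := hΓφ.1.inv hΓ hΓle
  set v' : ℝ → ℝ := fun z => (Γφ z)⁻¹ * P z with hv'
  have hv'1 : MemH1 v' := hΓi.mul hP
  have hΓv : EqOn (fun y => Γφ y * v' y) P (Icc 0 1) := fun z hz => by
    have := (hΓ.trans_le (hΓle z hz)).ne'
    simp only [hv']; field_simp
  have hdzΓv : dz (fun y => Γφ y * v' y) =ᵐ[vol01]
      fun z => M.Gv (fun k => φ k z) + -1 * ∑ m, dz (q m) z := by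
    filter_upwards [hPd, ae_vol01_mem_Icc] with z h1 h2
    rw [dz_congr hΓv h2, h1]
  have hv'0 : v' 0 = 0 := by simp [hv', hPdef, hP0, hs0]
  have hv'h : hnrm v' = nrm (dz v') := by rw [hnrm, hv'0, abs_zero, zero_add]
  refine ⟨v', hv'1, hv'0, ?_, ?_⟩
  · set Z := nrm (dz v') with hZ
    have hZ0 : 0 ≤ Z := nrm_nonneg _
    have hqm : MemLp (fun z => ∑ m, dz (q m) z) 2 vol01 := memLp_finsetSum _ fun m _ => (hq1 m).2
    have hA : MemLp (fun z => M.Gv (fun k => φ k z) + -1 * ∑ m, dz (q m) z) 2 vol01 :=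
      hGvc.1.add (hqm.const_mul (-1))
    have hB : MemLp (fun z => dz Γφ z * v' z) 2 vol01 := by
      simpa only [mul_comm] using MemLp.mul_continuousOn hΓφ.1.2 hv'1.continuousOn
    have hdv : ∀ᵐ z ∂vol01, |M.Γmin * dz v' z| ≤
        |M.Gv (fun k => φ k z) + -1 * ∑ m, dz (q m) z - dz Γφ z * v' z| := by
      filter_upwards [hdzΓv, MemH1.dz_mul hΓφ.1 hv'1, ae_vol01_mem_Icc] with z a1 a2 hz
      rw [← a1, a2, add_sub_cancel_left, abs_mul, abs_mul, abs_of_pos hΓ]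
      exact mul_le_mul_of_nonneg_right ((hΓle z hz).trans (le_abs_self _)) (abs_nonneg _)
    have h1 := (nrm_mono (hv'1.2.const_mul M.Γmin).1 (hA.sub hB) hdv).2
    rw [nrm_const_mul, abs_of_pos hΓ] at h1
    have h2 := nrm_sub_le (v := fun z => dz Γφ z * v' z) hA
    have h3 := nrm_add_le (v := fun z => -1 * ∑ m, dz (q m) z) hGvc.1
    rw [nrm_const_mul, abs_neg, abs_one, one_mul] at h3
    have h4 : nrm (fun z => dz Γφ z * v' z) ≤ L * σ0 * Z := by
      refine (M.Γ.nrm_dz_comp_mul_le hφ hcube hv'1).trans ?_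
      rw [hv'h]
      exact mul_le_mul_of_nonneg_right (mul_le_mul hL.Γ hgr hgr0 (by linarith)) hZ0
    set S : ℝ := ∑ m, (M.H 1 m).bd * nrm (dz (u m)) with hS
    have h5 : nrm (fun z => ∑ m, dz (q m) z) ≤ N * (3 * L + L * σ0 * (K * (V + 1))) + S := by
      refine (nrm_sum_le fun m _ => (hq1 m).2).trans ((Finset.sum_le_sum fun m _ => hq2 m).trans
        (le_of_eq ?_))
      rw [Finset.sum_add_distrib, Finset.sum_const, Finset.card_univ, Fintype.card_fin,
        nsmul_eq_mul]
      push_cast; rfl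
    have h6 : M.Γmin * Z ≤ L + N * (3 * L + L * σ0 * (K * (V + 1))) + S + L * σ0 * Z := by
      have := hGvc.2.trans hL.Gv
      exact h1.trans (h2.trans (by linarith))
    have h7 : Z ≤ (L + N * (3 * L + L * σ0 * (K * (V + 1))) + L * σ0 * Z) * M.Γmin⁻¹
        + S / M.Γmin := by
      rw [div_eq_mul_inv, ← add_mul, ← div_eq_mul_inv, le_div_iff₀ hΓ]
      linarith
    have h8 : (L + N * (3 * L + L * σ0 * (K * (V + 1))) + L * σ0 * Z) * M.Γmin⁻¹
        ≤ (L + N * (3 * L + L * σ0 * (K * (V + 1))) + L * σ0 * Z) * L :=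
      mul_le_mul_of_nonneg_left hL.invΓ (by positivity)
    have h9 : (L + N * (3 * L + L * σ0 * (K * (V + 1))) + L * σ0 * Z) * L
        = L * L * (1 + 3 * N) + L * L * (N * K) * σ0 * (V + 1) + L * L * σ0 * Z := by ring
    have h10 := mul_le_mul_of_nonneg_right hσ3 hZ0
    have h11 := mul_le_mul_of_nonneg_right hσ4 (by linarith : 0 ≤ V + 1)
    linarith
  · filter_upwards [hdzΓv] with z hz
    rw [hz]; ring

end Model

end Rothe

namespace Rothe

open Filter Topology

/-! ### The discrete heat equation with Neumann conditions -/

theorem integral_sq_eq_nrm {u : ℝ → ℝ} (hu : MemLp u 2 vol01) :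
    ∫ z, u z * u z ∂vol01 = nrm u ^ 2 := by
  rw [← l2sq_eq hu, l2sq, intervalIntegral_eq_vol01]
  simp only [sq]

theorem integrable_mul_of_memLp {u v : ℝ → ℝ} (hu : MemLp u 2 vol01) (hv : MemLp v 2 vol01) :
    Integrable (fun z => u z * v z) vol01 := hu.integrable_mul hv

theorem MemH1.abs_sub_integral_le {u : ℝ → ℝ} (hu : MemH1 u) {z : ℝ} (hz : z ∈ Icc (0 : ℝ) 1) :
    |u z - ∫ y, u y ∂vol01| ≤ nrm (dz u) := by
  have hi := memLp_two_integrable hu.memLp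
  have h : u z - ∫ y, u y ∂vol01 = ∫ y, (u z - u y) ∂vol01 := by
    rw [integral_sub (integrable_const _) hi]; simp
  rw [h]
  have := norm_integral_le_of_norm_le_const (μ := vol01) (f := fun y => u z - u y)
    (C := nrm (dz u)) (by
      filter_upwards [ae_vol01_mem_Icc] with y hy using hu.abs_sub_le hy hz)
  simpa using this

theorem neumann_energy {κ : ℝ} {u f : ℝ → ℝ} (hu : MemH2 u)
    (h0 : dz u 0 = 0) (h1 : dz u 1 = 0) (heq : ∀ᵐ z ∂vol01, u z - κ * dz (dz u) z = f z) :
    nrm u ^ 2 + κ * nrm (dz u) ^ 2 = ∫ z, u z * f z ∂vol01 := by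
  have a1 := hu.1.integral_mul_dz hu.2
  rw [h0, h1, integral_sq_eq_nrm hu.1.2] at a1
  rw [← integral_sq_eq_nrm hu.1.memLp]
  have e : ∫ z, u z * f z ∂vol01 = ∫ z, (u z * u z - κ * (u z * dz (dz u) z)) ∂vol01 := by
    refine integral_congr_ae ?_
    filter_upwards [heq] with z hz
    rw [← hz]; ring
  rw [e, integral_sub (integrable_mul_of_memLp hu.1.memLp hu.1.memLp)
    ((integrable_mul_of_memLp hu.1.memLp hu.2.2).const_mul _), integral_const_mul, a1]
  ring

theorem exists_neumann {κ : ℝ} (hκ : 0 < κ) {f : ℝ → ℝ} (hf : MemLp f 2 vol01) :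
    ∃ u : ℝ → ℝ, MemH2 u ∧ (∀ᵐ z ∂vol01, u z - κ * dz (dz u) z = f z) ∧
      dz u 0 = 0 ∧ dz u 1 = 0 := by
  obtain ⟨u, hu, heq, h0, h1⟩ := exists_elliptic (ι := Unit) (G := fun _ => κ) (fun _ => hκ)
    (Cm := fun _ _ => 1) (R := fun _ _ => 0) (e := fun _ _ _ => 0) (fun _ _ => MemH1.const 0)
    (f := fun _ => f) (fun _ => hf) (p := fun _ => 0) (q := fun _ => 1) (fun _ => 0) (fun _ => 0)
    (by
      intro u hu heq h0 h1 m z hz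
      have := neumann_energy (hu m) (f := fun _ => 0) (κ := κ)
        (by simpa using h0 m) (by simpa using h1 m) (by
          filter_upwards [heq m] with z hz
          simpa [dz_const] using hz)
      simp only [mul_zero, integral_zero] at this
      have n1 := nrm_nonneg (u m)
      have n2 := nrm_nonneg (dz (u m))
      have p1 : nrm (u m) = 0 := by
        have : 0 ≤ κ * nrm (dz (u m)) ^ 2 := by positivity
        have : nrm (u m) ^ 2 ≤ 0 := by linarith
        exact pow_eq_zero_iff (two_ne_zero) |>.1 (le_antisymm this (sq_nonneg _))
      have p2 : nrm (dz (u m)) = 0 := by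
        have h3 : κ * nrm (dz (u m)) ^ 2 = 0 := by rw [p1] at this; linarith
        exact pow_eq_zero_iff two_ne_zero |>.1 ((mul_eq_zero.1 h3).resolve_left hκ.ne')
      have := (hu m).1.abs_le_nrm hz
      rw [p1, p2, add_zero] at this
      exact abs_nonpos_iff.1 this)
  refine ⟨u (), hu (), ?_, by simpa using h0 (), by simpa using h1 ()⟩
  filter_upwards [heq ()] with z hz
  simpa [dz_const] using hz

/-- One implicit Euler step of the heat equation: energy, mean value and rate. -/
theorem heat_step {τ δ R : ℝ} (hτ : 0 < τ) (hδ : 0 < δ) {φ u r : ℝ → ℝ} (hφ : MemH1 φ)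
    (hu : MemH2 u) (h0 : dz u 0 = 0) (h1 : dz u 1 = 0) (hr : MemLp r 2 vol01) (hrR : nrm r ≤ R)
    (heq : ∀ᵐ z ∂vol01, (u z - φ z) / τ - δ * dz (dz u) z = r z) :
    nrm (dz u) ^ 2 + τ * δ * nrm (dz (dz u)) ^ 2 ≤ nrm (dz φ) ^ 2 + τ * (R ^ 2 / δ) ∧
      |(∫ z, u z ∂vol01) - ∫ z, φ z ∂vol01| ≤ τ * R ∧
      nrm (fun z => (u z - φ z) / τ) ≤ δ * nrm (dz (dz u)) + R := by
  have hR : 0 ≤ R := (nrm_nonneg r).trans hrR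
  have hdd := hu.2.2
  refine ⟨?_, ?_, ?_⟩
  -- Testing with `u''`: the Neumann conditions remove every boundary term.
  · have a1 := hu.1.integral_mul_dz hu.2
    have a2 := hφ.integral_mul_dz hu.2
    rw [h0, h1, integral_sq_eq_nrm hu.1.2] at a1
    rw [h0, h1] at a2
    have a3 : ∫ z, r z * dz (dz u) z ∂vol01
        = ∫ z, (τ⁻¹ * (u z * dz (dz u) z) - τ⁻¹ * (φ z * dz (dz u) z)
          - δ * (dz (dz u) z * dz (dz u) z)) ∂vol01 := by
      refine integral_congr_ae ?_
      filter_upwards [heq] with z hz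
      rw [← hz]; ring
    have i1 := (integrable_mul_of_memLp hu.1.memLp hdd).const_mul τ⁻¹
    have i2 := (integrable_mul_of_memLp hφ.memLp hdd).const_mul τ⁻¹
    have i3 := (integrable_mul_of_memLp hdd hdd).const_mul δ
    have i12 : Integrable (fun z => τ⁻¹ * (u z * dz (dz u) z) - τ⁻¹ * (φ z * dz (dz u) z)) vol01 :=
      i1.sub i2
    rw [integral_sub i12 i3, integral_sub i1 i2, integral_const_mul, integral_const_mul,
      integral_const_mul, a1, a2, integral_sq_eq_nrm hdd] at a3
    have b1 := integral_mul_le_nrm hr hdd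
    have b2 := integral_mul_le_nrm hφ.2 hu.1.2
    rw [a3] at b1
    set X := nrm (dz u)
    set Y := nrm (dz (dz u))
    set Z := nrm (dz φ)
    set J := ∫ z, dz φ z * dz u z ∂vol01
    have hX : 0 ≤ X := nrm_nonneg _
    have hY : 0 ≤ Y := nrm_nonneg _
    have hZ : 0 ≤ Z := nrm_nonneg _
    have c1 := (abs_le.1 b1).1
    have c2 := (abs_le.1 b2).2
    have c3 : nrm r * Y ≤ R * Y := mul_le_mul_of_nonneg_right hrR hY
    have c4 : R * Y ≤ δ / 2 * Y ^ 2 + R ^ 2 / (2 * δ) := by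
      have := young_ineq Y R hδ; linarith
    have c5 : R ^ 2 / (2 * δ) = R ^ 2 / δ / 2 := by rw [mul_comm, div_mul_eq_div_div]
    have c6 : τ⁻¹ * (X ^ 2 - J) + δ * Y ^ 2 ≤ δ / 2 * Y ^ 2 + R ^ 2 / δ / 2 := by
      have : τ⁻¹ * (u 1 * 0 - u 0 * 0 - X ^ 2) - τ⁻¹ * (φ 1 * 0 - φ 0 * 0 - J)
          = -(τ⁻¹ * (X ^ 2 - J)) := by ring
      linarith
    have c7 := mul_le_mul_of_nonneg_left c6 hτ.le
    have c8 : τ * (τ⁻¹ * (X ^ 2 - J) + δ * Y ^ 2) = X ^ 2 - J + τ * δ * Y ^ 2 := by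
      field_simp
    nlinarith [sq_nonneg (X - Z)]
  · have i1 := memLp_two_integrable hu.1.memLp
    have i2 := memLp_two_integrable hφ.memLp
    have e1 : (∫ z, u z ∂vol01) - ∫ z, φ z ∂vol01
        = ∫ z, (τ * r z + τ * δ * dz (dz u) z) ∂vol01 := by
      rw [← integral_sub i1 i2]
      refine integral_congr_ae ?_
      filter_upwards [heq] with z hz
      rw [← hz]; field_simp; ring
    -- Without flux through the ends, the mean changes only through the source.
    have e2 : ∫ z, dz (dz u) z ∂vol01 = 0 := by
      have := AC.ftc hu.2.1 (a := 0) (b := 1) (by simp) (by simp)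
      rw [intervalIntegral_eq_vol01] at this
      rw [this, h0, h1, sub_zero]
    rw [e1, integral_add ((memLp_two_integrable hr).const_mul _)
      ((memLp_two_integrable hdd).const_mul _), integral_const_mul, integral_const_mul, e2,
      mul_zero, add_zero, abs_mul, abs_of_pos hτ]
    exact mul_le_mul_of_nonneg_left ((integral_le_nrm hr).trans hrR) hτ.le
  · have e : (fun z => (u z - φ z) / τ) =ᵐ[vol01] fun z => δ * dz (dz u) z + r z := by
      filter_upwards [heq] with z hz
      rw [← hz]; ring
    rw [nrm_congr e]
    refine (nrm_add_le (hdd.const_mul δ)).trans ?_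
    rw [nrm_const_mul, abs_of_pos hδ]
    linarith

/-! ### Source terms of the fraction equations. -/

namespace Model

variable {n : ℕ}

/-- Bound of the source terms in the equations for the volume fractions. -/
theorem exists_source_bound {M : Model n} (h7 : M.InitialFractions) (V K : ℝ) (hV : 0 ≤ V)
    (hK : 0 ≤ K) : ∃ R : ℝ, 0 ≤ R ∧ ∀ σ, σ ≤ 1 → ∀ φ w v W, M.Good σ V φ w v W →
      ∀ u : Solid n → ℝ → ℝ, (∀ m, MemH2 (u m)) → (∀ m, hnrm (u m) ≤ K) → ∀ l : Comp n,
      MemLp (fun z => M.Gφ l (fun k => φ k z)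
        - M.I l (fun k => φ k z) * dz (fun y => M.Γ (fun k => φ k y) * v y) z
        - ∑ m, ∑ i : Fin 2, dzPow i (fun y => M.B l i 0 m (fun k => φ k y) * w m y
          + M.B l i 1 m (fun k => φ k y) * u m y) z) 2 vol01 ∧
      nrm (fun z => M.Gφ l (fun k => φ k z)
        - M.I l (fun k => φ k z) * dz (fun y => M.Γ (fun k => φ k y) * v y) z
        - ∑ m, ∑ i : Fin 2, dzPow i (fun y => M.B l i 0 m (fun k => φ k y) * w m y
          + M.B l i 1 m (fun k => φ k y) * u m y) z) ≤ R := by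
  obtain ⟨L, hL⟩ := M.exists_bounds
  have hL1 := hL.one_le
  set b : ℝ := 2 * L * (2 + K) with hb
  have hb0 : 0 ≤ b := by positivity
  refine ⟨L + L * (2 * L * V) + (n + 1) * (b + b), by positivity, ?_⟩
  intro σ hσ φ w v W hg u hu huK l
  have hc := hg.cube h7.1
  have hφ := hg.φH1
  have hgr : gradNrm φ ≤ 1 := hg.grad.trans hσ
  have hgr0 := gradNrm_nonneg φ
  have aux : ∀ (f : Coeff n) (g : ℝ → ℝ) (c : ℝ), f.bd ≤ L → MemH1 g → hnrm g ≤ c →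
      MemH1 (fun y => f (fun k => φ k y) * g y) ∧
      nrm (fun y => f (fun k => φ k y) * g y) ≤ 2 * L * c ∧
      nrm (dz fun y => f (fun k => φ k y) * g y) ≤ 2 * L * c := by
    intro f g c hf hg' hgc
    have e0 := f.bd_pos
    have e1 := f.nrm_dz_mul_le hφ hc hg'
    have e2 := (f.nrm_mul_le hφ hc hg'.memLp).2
    have e3 := hnrm_nonneg g
    have e4 : nrm (dz g) ≤ c := by
      have := abs_nonneg (g 0); unfold hnrm at hgc; linarith
    have e5 : nrm g ≤ c := hg'.nrm_le.trans hgc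
    have t1 : f.bd * nrm (dz g) ≤ L * c := mul_le_mul hf e4 (nrm_nonneg _) (by linarith)
    have t2 : f.bd * gradNrm φ * hnrm g ≤ L * 1 * c :=
      mul_le_mul (mul_le_mul hf hgr hgr0 (by linarith)) hgc e3 (by linarith)
    have t3 : f.bd * nrm g ≤ L * c := mul_le_mul hf e5 (nrm_nonneg _) (by linarith)
    have t4 : 0 ≤ L * c := mul_nonneg (by linarith) (e3.trans hgc)
    exact ⟨e1.1, by linarith, by linarith [e1.2]⟩
  have hΓv := aux M.Γ v V hL.Γ hg.vH1 hg.hnrm_v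
  have hB0 := fun i m => aux (M.B l i 0 m) (w m) 2 (hL.B l i 0 m) (hg.wH2 m).1 (hg.hnrm_w m)
  have hB1 := fun i m => aux (M.B l i 1 m) (u m) K (hL.B l i 1 m) (hu m).1 (huK m)
  have hT : ∀ i m, MemLp (dzPow i (fun y => M.B l i 0 m (fun k => φ k y) * w m y
        + M.B l i 1 m (fun k => φ k y) * u m y)) 2 vol01 ∧
      nrm (dzPow i (fun y => M.B l i 0 m (fun k => φ k y) * w m y
        + M.B l i 1 m (fun k => φ k y) * u m y)) ≤ b := by
    intro i m
    have e := (hB0 i m).1.add (hB1 i m).1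
    unfold dzPow
    split_ifs
    · exact ⟨e.memLp, (nrm_add_le (hB0 i m).1.memLp).trans (by linarith [(hB0 i m).2.1, (hB1 i m).2.1])⟩
    · refine ⟨e.2, ?_⟩
      rw [nrm_congr (MemH1.dz_add (hB0 i m).1 (hB1 i m).1)]
      exact (nrm_add_le (hB0 i m).1.2).trans (by linarith [(hB0 i m).2.2, (hB1 i m).2.2])
  have hS1 : ∀ m, MemLp (fun z => ∑ i : Fin 2, dzPow i (fun y => M.B l i 0 m (fun k => φ k y) * w m y
          + M.B l i 1 m (fun k => φ k y) * u m y) z) 2 vol01 := fun m =>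
    memLp_finsetSum _ fun i _ => (hT i m).1
  have hS1n : ∀ m, nrm (fun z => ∑ i : Fin 2, dzPow i (fun y =>
      M.B l i 0 m (fun k => φ k y) * w m y + M.B l i 1 m (fun k => φ k y) * u m y) z) ≤ b + b := by
    intro m
    refine (nrm_sum_le fun i _ => (hT i m).1).trans ?_
    rw [Fin.sum_univ_two]
    exact add_le_add (hT 0 m).2 (hT 1 m).2
  have hS : MemLp (fun z => ∑ m, ∑ i : Fin 2, dzPow i (fun y => M.B l i 0 m (fun k => φ k y) * w m y
          + M.B l i 1 m (fun k => φ k y) * u m y) z) 2 vol01 :=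
    memLp_finsetSum _ fun m _ => hS1 m
  have hSn : nrm (fun z => ∑ m, ∑ i : Fin 2, dzPow i (fun y => M.B l i 0 m (fun k => φ k y) * w m y
          + M.B l i 1 m (fun k => φ k y) * u m y) z) ≤ (n + 1) * (b + b) := by
    refine (nrm_sum_le fun m _ => hS1 m).trans ((Finset.sum_le_sum fun m _ => hS1n m).trans
      (le_of_eq ?_))
    rw [Finset.sum_const, Finset.card_univ, Fintype.card_fin, nsmul_eq_mul]
    push_cast; rfl
  have hI := (M.I l).nrm_mul_le hφ hc hΓv.1.2
  have hG := (M.Gφ l).memLp_comp hφ hc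
  refine ⟨(hG.1.sub hI.1).sub hS, (nrm_sub_le (hG.1.sub hI.1)).trans
    (add_le_add ((nrm_sub_le hG.1).trans (add_le_add (hG.2.trans (hL.Gφ l)) (hI.2.trans ?_))) hSn)⟩
  exact mul_le_mul (hL.I l) hΓv.2.2 (nrm_nonneg _) (by linarith)

end Model

end Rothe

/-! ### Induction over the time steps. -/

namespace Rothe

open Filter Topology

/-- Dependent choice for a construction available only on an initial segment `ok` of the indices;
where no step is possible, the sequence stays put. -/
theorem exists_seq {α : Type*} (a0 : α) (ok : ℕ → Prop) (hok : ∀ k, ok (k + 1) → ok k)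
    (Inv : ℕ → α → Prop) (Rel : α → α → Prop) (h0 : Inv 0 a0)
    (hs : ∀ k a, ok (k + 1) → Inv k a → ∃ b, Rel a b ∧ Inv (k + 1) b) :
    ∃ s : ℕ → α, s 0 = a0 ∧ (∀ k, ok k → Inv k (s k)) ∧
      ∀ k, ok (k + 1) → Rel (s k) (s (k + 1)) := by
  have h : ∀ k a, ∃ b, ok (k + 1) → Inv k a → Rel a b ∧ Inv (k + 1) b := by
    intro k a
    by_cases hc : ok (k + 1) ∧ Inv k a
    · obtain ⟨b, hb⟩ := hs k a hc.1 hc.2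
      exact ⟨b, fun _ _ => hb⟩
    · exact ⟨a, fun h1 h2 => absurd ⟨h1, h2⟩ hc⟩
  choose f hf using h
  let s : ℕ → α := fun k => Nat.rec a0 (fun k a => f k a) k
  have hI : ∀ k, ok k → Inv k (s k) := by
    intro k
    induction k with
    | zero => exact fun _ => h0
    | succ k ih => exact fun h => (hf k (s k) h (ih (hok k h))).2
  exact ⟨s, rfl, hI, fun k hk => (hf k (s k) hk (hI k (hok k hk))).1⟩

theorem sq_sum_le_of_le {ι : Type*} {s : Finset ι} {a b : ι → ℝ} {x N : ℝ} (hx : 0 ≤ x)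
    (h : x ≤ ∑ i ∈ s, a i) (hab : ∀ i ∈ s, a i ^ 2 ≤ b i) (hN : (s.card : ℝ) ≤ N) :
    x ^ 2 ≤ N * ∑ i ∈ s, b i := by
  have h1 : x ^ 2 ≤ (∑ i ∈ s, a i) ^ 2 := pow_le_pow_left₀ hx h 2
  have h2 := sq_sum_le_card_mul_sum_sq (s := s) (f := a)
  have h3 := Finset.sum_le_sum hab
  have h4 : 0 ≤ ∑ i ∈ s, a i ^ 2 := Finset.sum_nonneg fun i _ => sq_nonneg _
  calc x ^ 2 ≤ s.card * ∑ i ∈ s, a i ^ 2 := h1.trans h2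
    _ ≤ N * ∑ i ∈ s, b i := mul_le_mul hN h3 h4 ((Nat.cast_nonneg _).trans hN)

namespace Model

variable {n : ℕ}

/-- The components other than `d - 1` as a finite set. -/
def others (n : ℕ) : Finset (Comp n) := Finset.univ.erase (compDm1 n)

theorem card_others : ((others n).card : ℝ) = n + 1 := by
  rw [others, Finset.card_erase_of_mem (Finset.mem_univ _), Finset.card_univ, Fintype.card_fin]
  push_cast; rfl

theorem mem_others {l : Comp n} : l ∈ others n ↔ l ≠ compDm1 n := by simp [others]

theorem eq_of_sum_eq {x : Comp n → ℝ} {c : ℝ} (h : ∑ l, x l = c) :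
    x (compDm1 n) = c + -1 * ∑ k ∈ others n, x k := by
  rw [← h, ← Finset.add_sum_erase _ _ (Finset.mem_univ (compDm1 n)), others]; ring

/-- The component `d - 1` has no evolution equation of its own. Differentiating the constraint is
how it inherits its estimates from the others. -/
theorem dz_of_sum_eq {φ : Comp n → ℝ → ℝ} {c : ℝ} (hφ : ∀ l, MemH2 (φ l))
    (hs : ∀ z ∈ Icc (0 : ℝ) 1, ∑ l, φ l z = c) :
    nrm (dz (φ (compDm1 n))) ≤ ∑ k ∈ others n, nrm (dz (φ k)) ∧
      nrm (dz (dz (φ (compDm1 n)))) ≤ ∑ k ∈ others n, nrm (dz (dz (φ k))) := by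
  have h1 := MemH2.sum (s := Finset.univ) (u := φ) fun l _ => hφ l
  have h2 : ∀ z ∈ Icc (0 : ℝ) 1, ∑ l, dz (φ l) z = 0 := fun z hz => by
    rw [← h1.2 z hz, dz_congr (v := fun _ => c) hs hz, dz_const]
  have e1 : ∀ z ∈ Icc (0 : ℝ) 1, dz (φ (compDm1 n)) z = -1 * ∑ k ∈ others n, dz (φ k) z :=
    fun z hz => by simpa using eq_of_sum_eq (x := fun l => dz (φ l) z) (h2 z hz)
  have h3 := MemH1.sum (s := others n) (u := fun l => dz (φ l)) fun l _ => (hφ l).2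
  have e2 : dz (dz (φ (compDm1 n))) =ᵐ[vol01] fun z => -1 * ∑ k ∈ others n, dz (dz (φ k)) z := by
    filter_upwards [MemH1.dz_const_mul (-1) h3.1, h3.2, ae_vol01_mem_Icc] with z a1 a2 hz
    rw [dz_congr e1 hz, a1, a2]
  have e1' : dz (φ (compDm1 n)) =ᵐ[vol01] fun z => -1 * ∑ k ∈ others n, dz (φ k) z := by
    filter_upwards [ae_vol01_mem_Icc] with z hz using e1 z hz
  constructor
  · rw [nrm_congr e1', nrm_const_mul, abs_neg, abs_one, one_mul]
    exact nrm_sum_le fun l _ => (hφ l).1.2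
  · rw [nrm_congr e2, nrm_const_mul, abs_neg, abs_one, one_mul]
    exact nrm_sum_le fun l _ => (hφ l).2.2

/-- Sum of the squared norms of the gradients of the components other than `d - 1`. -/
noncomputable def gradSq (φ : Comp n → ℝ → ℝ) : ℝ := ∑ k ∈ others n, nrm (dz (φ k)) ^ 2

/-- Sum of the squared norms of the second derivatives of the components other than `d - 1`. -/
noncomputable def lapSq (φ : Comp n → ℝ → ℝ) : ℝ := ∑ k ∈ others n, nrm (dz (dz (φ k))) ^ 2

/-- A state of the discretised system after elapsed time `s`. -/
structure Evolved (M : Model n) (L R U V s : ℝ) (φ : Comp n → ℝ → ℝ) (w : Solid n → ℝ → ℝ)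
    (v : ℝ → ℝ) (W : ℝ) : Prop where
  φH2 : ∀ l, MemH2 (φ l)
  sum_eq : ∀ z ∈ Icc (0 : ℝ) 1, ∑ l, φ l z = 1
  grad : ∀ l ∈ others n, nrm (dz (φ l)) ^ 2 ≤ s * (R ^ 2 * L)
  mean : ∀ l ∈ others n, |(∫ z, φ l z ∂vol01) - M.φ0 l| ≤ s * R
  wH2 : ∀ m, MemH2 (w m)
  w0 : ∀ m, |w m 0| ≤ s * U
  w1 : ∀ m, nrm (dz (w m)) ≤ s * U
  w2 : ∀ m, nrm (dz (dz (w m))) ≤ s * U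
  bcw : ∀ m, dz (w m) 1 = M.A m * (w m 1 - W)
  vH1 : MemH1 v
  v0 : v 0 = 0
  v1 : nrm (dz v) ≤ V

/-- For short times an evolved state is admissible for the next step. -/
theorem exists_good_time {M : Model n} (h7 : M.InitialFractions) {L R U σ : ℝ}
    (hR : 0 ≤ R) (hσ : 0 < σ) :
    ∃ x0 : ℝ, 0 < x0 ∧ ∀ s V φ w v W, 0 ≤ s → s ≤ x0 → M.Evolved L R U V s φ w v W →
      M.Good σ V φ w v W := by
  obtain ⟨ε, hε, hε'⟩ := exists_pos_forall_le_of_finite (fun l => M.φ0 l - M.φmin)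
    fun l => sub_pos.2 (h7.2.2.2.2.1 l)
  set N : ℝ := (n : ℝ) + 1 with hN
  have hN0 : 0 < N := by positivity
  -- Pointwise deviation from the initial value: drift of the mean plus oscillation around it, the
  -- latter controlled by the gradient. It tends to `0` with `s`.
  set e : ℝ → ℝ := fun s => s * R + √(s * (R ^ 2 * L)) with he
  have hev : ∀ᶠ s in 𝓝 (0 : ℝ), N * e s < ε ∧ N * e s + N * e s < σ ∧ s * U < 1 := by
    have h0 : Continuous fun s : ℝ => N * e s := by simp only [he]; fun_prop
    refine (h0.tendsto 0 |>.eventually_lt_const ?_).and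
      (((h0.add h0).tendsto 0 |>.eventually_lt_const ?_).and
        ((continuous_id.mul_const U).tendsto 0 |>.eventually_lt_const ?_)) <;> simp [he, hε, hσ]
  obtain ⟨x0, hx0, hx⟩ := Metric.eventually_nhds_iff.1 hev
  refine ⟨x0 / 2, by positivity, ?_⟩
  intro s V φ w v W hs0 hs hg
  obtain ⟨a1, a2, a3⟩ := hx (y := s) (by rw [Real.dist_eq, sub_zero, abs_of_nonneg hs0]; linarith)
  have hes : 0 ≤ s * R := mul_nonneg hs0 hR
  have hgr : ∀ l ∈ others n, nrm (dz (φ l)) ≤ √(s * (R ^ 2 * L)) := fun l hl =>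
    Real.le_sqrt_of_sq_le (hg.grad l hl)
  have hgr' : ∑ l ∈ others n, nrm (dz (φ l)) ≤ N * e s := by
    refine (Finset.sum_le_sum (g := fun _ => e s) fun l hl =>
      (hgr l hl).trans (by simp only [he]; linarith)).trans (le_of_eq ?_)
    rw [Finset.sum_const, nsmul_eq_mul, card_others]
  have hpt : ∀ l ∈ others n, ∀ z ∈ Icc (0 : ℝ) 1, |φ l z - M.φ0 l| ≤ e s := by
    intro l hl z hz
    have b1 := (hg.φH2 l).1.abs_sub_integral_le hz
    have b2 := hg.mean l hl
    have b3 := hgr l hl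
    have := abs_sub_le (φ l z) (∫ z, φ l z ∂vol01) (M.φ0 l)
    simp only [he]; linarith
  have hNe : e s ≤ N * e s := by
    have : 0 ≤ e s := add_nonneg hes (Real.sqrt_nonneg _)
    have : 0 ≤ (n : ℝ) * e s := by positivity
    rw [hN]; linarith
  have hpt' : ∀ l, ∀ z ∈ Icc (0 : ℝ) 1, |φ l z - M.φ0 l| < ε := by
    intro l z hz
    by_cases hl : l = compDm1 n
    · subst hl
      have b1 := eq_of_sum_eq (hg.sum_eq z hz)
      have b2 := eq_of_sum_eq h7.2.2.2.1
      -- By the constraint its deviation is minus the sum of the others, which explains the factor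
      -- `N` required in `a1`.
      have b3 : φ (compDm1 n) z - M.φ0 (compDm1 n) = -∑ k ∈ others n, (φ k z - M.φ0 k) := by
        rw [b1, b2, Finset.sum_sub_distrib]; ring
      rw [b3, abs_neg]
      refine ((Finset.abs_sum_le_sum_abs _ _).trans (Finset.sum_le_sum fun k hk =>
        hpt k hk z hz)).trans_lt ?_
      rw [Finset.sum_const, nsmul_eq_mul, card_others]; exact a1
    · exact (hpt l (mem_others.2 hl) z hz).trans_lt (hNe.trans_lt a1)
  refine ⟨hg.φH2, fun z hz => mem_box_of_sum_eq_one (fun l => ?_) (hg.sum_eq z hz), ?_, hg.wH2,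
    fun m => (hg.w0 m).trans a3.le, fun m => (hg.w1 m).trans a3.le, fun m => (hg.w2 m).trans a3.le,
    hg.bcw, hg.vH1, hg.v0, hg.v1⟩
  · have := (abs_lt.1 (hpt' l z hz)).1
    linarith [hε' l]
  · rw [gradNrm, ← Finset.add_sum_erase _ _ (Finset.mem_univ (compDm1 n))]
    have := (dz_of_sum_eq hg.φH2 hg.sum_eq).1
    rw [others] at this hgr'
    linarith

/-- The relation between the states before and after one step. -/
def Advance (M : Model n) (K τ : ℝ) (p q : (Comp n → ℝ → ℝ) × (Solid n → ℝ → ℝ) × (ℝ → ℝ) × ℝ) :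
    Prop :=
  M.Step τ p.1 q.1 p.2.1 q.2.1 p.2.2.1 q.2.2.1 p.2.2.2 q.2.2.2 ∧
  gradSq q.1 + τ * (K⁻¹ * lapSq q.1) ≤ gradSq p.1 + τ * K ∧
  (∀ l, nrm (dz (dz (q.1 l))) ^ 2 ≤ K * lapSq q.1) ∧
  (∀ l, nrm (fun z => (q.1 l z - p.1 l z) / τ) ^ 2 ≤ K * lapSq q.1 + K) ∧
  ∀ m, MemH2 (fun z => (q.2.1 m z - p.2.1 m z) / τ) ∧
    hnrm (fun z => (q.2.1 m z - p.2.1 m z) / τ) ≤ K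

end Model

end Rothe

/-! ### One complete time step. -/

namespace Rothe

open Filter Topology

namespace Model

variable {n : ℕ}

/-- Solvability of one time step, with estimates, as long as the elapsed time is small. -/
theorem exists_advance {M : Model n} (h1 : M.Reservoirs) (h4 : M.Nondegenerate)
    (h5 : M.PseudoParabolic) (h7 : M.InitialFractions) (h9 : M.VelocityCoupling) (V1 : ℝ) :
    ∃ x0 K L R U V : ℝ, 0 < x0 ∧ 0 < K ∧ 0 ≤ L ∧ 0 ≤ R ∧ 0 ≤ U ∧ 0 ≤ V ∧ V1 ≤ V ∧
      (∀ s φ w v W, 0 ≤ s → s ≤ x0 → M.Evolved L R U V s φ w v W → M.Good 1 V φ w v W) ∧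
      ∀ τ s p, 0 < τ → 0 ≤ s → s + τ ≤ x0 →
        M.Evolved L R U V s p.1 p.2.1 p.2.2.1 p.2.2.2 →
        ∃ q, M.Advance K τ p q ∧ M.Evolved L R U V (s + τ) q.1 q.2.1 q.2.2.1 q.2.2.2 := by
  obtain ⟨τ0, K1, hτ0, hK1, hrates⟩ := exists_rates h1 h4 h5 h7 h9
  obtain ⟨σ0, V0, hσ0, hσ1, hV0, hvel⟩ := exists_velocity h4 h7 hK1
  -- The velocity bound is fixed first: large enough to reproduce itself and to cover `V1`, later
  -- the norm of the initial gradient. The constants `U`, `R` and the time span may then depend on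
  -- it without circularity.
  set V := max V0 V1 with hV
  have hVV0 : V0 ≤ V := le_max_left _ _
  have hVnn : 0 ≤ V := hV0.trans hVV0
  set U := K1 * (V + 1) with hU
  have hU0 : 0 ≤ U := by positivity
  obtain ⟨R, hR, hsrc⟩ := exists_source_bound h7 V U hVnn hU0
  obtain ⟨L, hL⟩ := M.exists_bounds
  have hL1 := hL.one_le
  obtain ⟨x1, hx1, hgood⟩ := exists_good_time h7 (L := L) (U := U) hR hσ0
  set N : ℝ := (n : ℝ) + 1 with hN
  have hN1 : 1 ≤ N := by rw [hN]; linarith [(Nat.cast_nonneg n : (0 : ℝ) ≤ n)]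
  have hN0 : 0 < N := by linarith
  set K : ℝ := L + N * (R ^ 2 * L) + N + N * (2 * L ^ 2) + N * (N * (2 * R ^ 2)) + U with hK
  have k1 : 0 ≤ N * (R ^ 2 * L) := by positivity
  have k2 : 0 ≤ N * (2 * L ^ 2) := by positivity
  have k3 : 0 ≤ N * (N * (2 * R ^ 2)) := by positivity
  have k4 : 2 * R ^ 2 ≤ N * (N * (2 * R ^ 2)) := by
    have : 0 ≤ 2 * R ^ 2 := by positivity
    calc 2 * R ^ 2 = 1 * (1 * (2 * R ^ 2)) := by ring
      _ ≤ N * (N * (2 * R ^ 2)) := by gcongr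
  have k5 : 2 * L ^ 2 ≤ N * (2 * L ^ 2) := le_mul_of_one_le_left (by positivity) hN1
  have hK0 : 0 < K := by linarith
  have hLK : L ≤ K := by linarith
  refine ⟨min x1 τ0, K, L, R, U, V, by positivity, hK0, by linarith, hR, hU0, hVnn,
    le_max_right _ _, ?_, ?_⟩
  · intro s φ w v W hs hs' he
    have hg := hgood s V φ w v W hs (hs'.trans (min_le_left _ _)) he
    exact ⟨hg.φH2, hg.box, hg.grad.trans hσ1, hg.wH2, hg.w0, hg.w1, hg.w2, hg.bcw, hg.vH1, hg.v0,
      hg.v1⟩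
  rintro τ s ⟨φ, w, v, W⟩ hτ hs hsτ he
  simp only at he
  have hg := hgood s V φ w v W hs (by linarith [min_le_left x1 τ0]) he
  obtain ⟨u, β, hu, heq, hu0, hu1, hβ, huK, huK2, hus⟩ := hrates τ V σ0 hτ
    (by linarith [min_le_right x1 τ0]) hVnn hσ1 φ w v W hg
  obtain ⟨v', hv', hv'0, hv'V, heqv⟩ := hvel V hVV0 φ w v W hg u hu huK hus
  have hr := hsrc σ0 hσ1 φ w v W hg u hu huK
  set r : Comp n → ℝ → ℝ := fun l z => M.Gφ l (fun k => φ k z)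
        - M.I l (fun k => φ k z) * dz (fun y => M.Γ (fun k => φ k y) * v y) z
        - ∑ m, ∑ i : Fin 2, dzPow i (fun y => M.B l i 0 m (fun k => φ k y) * w m y
          + M.B l i 1 m (fun k => φ k y) * u m y) z with hrdef
  -- Solved for every index for uniformity; the solution for `d - 1` is discarded in favour of the
  -- constraint.
  have hneu : ∀ l, ∃ p : ℝ → ℝ, MemH2 p ∧
      (∀ᵐ z ∂vol01, (p z - φ l z) / τ - M.δ l * dz (dz p) z = r l z) ∧
      dz p 0 = 0 ∧ dz p 1 = 0 := by
    intro l
    have hf : MemLp (fun z => φ l z + τ * r l z) 2 vol01 :=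
      (he.φH2 l).1.memLp.add ((hr l).1.const_mul τ)
    obtain ⟨p, hp, hpe, hp0, hp1⟩ := exists_neumann (mul_pos hτ (M.δ_pos l)) hf
    refine ⟨p, hp, ?_, hp0, hp1⟩
    filter_upwards [hpe] with z hz
    have : p z - φ l z = τ * (M.δ l * dz (dz p) z + r l z) := by linarith
    rw [this, mul_div_cancel_left₀ _ hτ.ne']; ring
  choose p hp hpe hp0 hp1 using hneu
  have hheat := fun l => heat_step hτ (M.δ_pos l) (he.φH2 l).1 (hp l) (hp0 l) (hp1 l) (hr l).1
    (hr l).2 (hpe l)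
  obtain ⟨φ', hφ'o, hφ'd⟩ : ∃ φ' : Comp n → ℝ → ℝ, (∀ l, l ≠ compDm1 n → φ' l = p l) ∧
      φ' (compDm1 n) = fun z => 1 + -1 * ∑ k ∈ others n, p k z :=
    ⟨fun l => if l = compDm1 n then fun z => 1 + -1 * ∑ k ∈ others n, p k z else p l,
      fun l hl => if_neg hl, if_pos rfl⟩
  have hpo : ∀ l ∈ others n, φ' l = p l := fun l hl => hφ'o l (mem_others.1 hl)
  have hφ'2 : ∀ l, MemH2 (φ' l) := by
    intro l
    by_cases hl : l = compDm1 n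
    · rw [hl, hφ'd]
      exact (MemH2.const 1).add ((MemH2.sum fun k _ => hp k).1.const_mul (-1))
    · rw [hφ'o l hl]; exact hp l
  have hsum : ∀ z, ∑ l, φ' l z = 1 := by
    intro z
    rw [← Finset.add_sum_erase _ _ (Finset.mem_univ (compDm1 n)), ← others, hφ'd,
      Finset.sum_congr rfl fun l hl => congrFun (hpo l hl) z]
    ring
  -- With this choice the difference quotients are exactly the rates, and the equations for the step
  -- become those already solved.
  obtain ⟨w', hw'⟩ : ∃ w' : Solid n → ℝ → ℝ, ∀ m, w' m = fun y => w m y + τ * u m y :=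
    ⟨fun m y => w m y + τ * u m y, fun _ => rfl⟩
  obtain ⟨W', hW'⟩ : ∃ W' : ℝ, W' = W + τ * β := ⟨_, rfl⟩
  have hq : ∀ m y, (w' m y - w m y) / τ = u m y := fun m y => by
    rw [hw', add_sub_cancel_left, mul_div_cancel_left₀ _ hτ.ne']
  have hw2 : ∀ m, MemH2 (w' m) := fun m => by
    rw [hw']; exact (he.wH2 m).add ((hu m).const_mul τ)
  have hdw : ∀ m, ∀ z ∈ Icc (0 : ℝ) 1, dz (w' m) z = dz (w m) z + τ * dz (u m) z := by
    intro m z hz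
    rw [hw', MemH2.dz_add (he.wH2 m) ((hu m).const_mul τ) hz, MemH2.dz_const_mul τ (hu m) hz]
  have hddw : ∀ m, dz (dz (w' m)) =ᵐ[vol01] fun z => dz (dz (w m)) z + τ * dz (dz (u m)) z := by
    intro m
    rw [hw']
    filter_upwards [MemH2.dz_dz_add (he.wH2 m) ((hu m).const_mul τ),
      MemH2.dz_dz_const_mul τ (hu m)] with z a1 a2
    rw [a1, a2]
  have hu0' : ∀ m, |u m 0| ≤ U := fun m => by
    have := huK m; have := nrm_nonneg (dz (u m)); unfold hnrm at *; linarith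
  have hu1' : ∀ m, nrm (dz (u m)) ≤ U := fun m => by
    have := huK m; have := abs_nonneg (u m 0); unfold hnrm at *; linarith
  have hδL : ∀ l, L⁻¹ ≤ M.δ l := fun l => by
    have := inv_anti₀ (inv_pos.2 (M.δ_pos l)) (hL.invδ l)
    rwa [inv_inv] at this
  have hRδ : ∀ l, R ^ 2 / M.δ l ≤ R ^ 2 * L := fun l => by
    rw [div_eq_mul_inv]; exact mul_le_mul_of_nonneg_left (hL.invδ l) (sq_nonneg _)
  refine ⟨(φ', w', v', W'), ⟨?_, ?_, ?_, ?_, ?_⟩, ?_⟩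
  · refine ⟨hφ'2, hw2, hv', fun z _ => hsum z, ?_, ?_, ?_, ?_, ?_, ?_, hv'0, ?_⟩
    · intro l hl
      simp only [hq, hφ'o l hl]
      filter_upwards [hpe l] with z hz
      rw [hz, hrdef]; ring
    · simp only [hq]; exact heqv
    · intro m
      simp only [hq]
      filter_upwards [heq m, hddw m] with z a1 a2
      rw [a2]; exact a1
    · intro l hl
      simp only [hφ'o l hl]
      exact ⟨hp0 l, hp1 l⟩
    · intro m; simp only [hq]; exact hu0 m
    · intro m
      simp only [hdw m 1 (by simp), he.bcw m, hu1 m]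
      rw [hw', hW']; ring
    · simp only [hW', add_sub_cancel_left, mul_div_cancel_left₀ _ hτ.ne']
      exact hβ
  · simp only [gradSq, lapSq]
    rw [Finset.mul_sum, Finset.mul_sum, ← Finset.sum_add_distrib]
    have hterm : ∀ l ∈ others n, nrm (dz (φ' l)) ^ 2 + τ * (K⁻¹ * nrm (dz (dz (φ' l))) ^ 2)
        ≤ nrm (dz (φ l)) ^ 2 + τ * (R ^ 2 * L) := by
      intro l hl
      rw [hpo l hl]
      have e1 := (hheat l).1
      have e2 : K⁻¹ ≤ M.δ l := (inv_anti₀ (by linarith) hLK).trans (hδL l)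
      have e3 : τ * (K⁻¹ * nrm (dz (dz (p l))) ^ 2) ≤ τ * (M.δ l * nrm (dz (dz (p l))) ^ 2) := by
        gcongr
      have e4 : τ * (R ^ 2 / M.δ l) ≤ τ * (R ^ 2 * L) := by
        have := hRδ l; gcongr
      linarith
    refine (Finset.sum_le_sum hterm).trans ?_
    rw [Finset.sum_add_distrib, Finset.sum_const, nsmul_eq_mul, card_others]
    have : ((n : ℝ) + 1) * (τ * (R ^ 2 * L)) ≤ τ * K := by
      rw [mul_left_comm]
      refine mul_le_mul_of_nonneg_left ?_ hτ.le
      rw [← hN]; linarith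
    linarith
  · intro l
    have hlap0 : 0 ≤ lapSq φ' := Finset.sum_nonneg fun _ _ => sq_nonneg _
    by_cases hl : l = compDm1 n
    · rw [hl]
      refine (sq_sum_le_of_le (nrm_nonneg _) (dz_of_sum_eq hφ'2 fun z _ => hsum z).2
        (fun i _ => le_rfl) card_others.le).trans ?_
      exact mul_le_mul_of_nonneg_right (by rw [← hN]; linarith) hlap0
    · have : nrm (dz (dz (φ' l))) ^ 2 ≤ lapSq φ' :=
        Finset.single_le_sum (f := fun l => nrm (dz (dz (φ' l))) ^ 2) (fun _ _ => sq_nonneg _)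
          (mem_others.2 hl)
      exact this.trans (le_mul_of_one_le_left hlap0 (by linarith))
  · have hrate : ∀ l ∈ others n, nrm (fun z => (φ' l z - φ l z) / τ) ^ 2
        ≤ 2 * L ^ 2 * nrm (dz (dz (φ' l))) ^ 2 + 2 * R ^ 2 := by
      intro l hl
      rw [hpo l hl]
      have e1 := (hheat l).2.2
      have e2 : M.δ l * nrm (dz (dz (p l))) ≤ L * nrm (dz (dz (p l))) :=
        mul_le_mul_of_nonneg_right (hL.δ l) (nrm_nonneg _)
      have e3 : nrm (fun z => (p l z - φ l z) / τ) ^ 2 ≤ (L * nrm (dz (dz (p l))) + R) ^ 2 :=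
        pow_le_pow_left₀ (nrm_nonneg _) (by linarith) 2
      nlinarith [sq_nonneg (L * nrm (dz (dz (p l))) - R)]
    have hlap0 : 0 ≤ lapSq φ' := Finset.sum_nonneg fun _ _ => sq_nonneg _
    intro l
    simp only
    by_cases hl : l = compDm1 n
    -- The constraint holds at both times, so this difference quotient is minus the sum of the
    -- others.
    · have hd : (fun z => (φ' l z - φ l z) / τ)
          =ᵐ[vol01] fun z => -1 * ∑ k ∈ others n, (φ' k z - φ k z) / τ := by
        filter_upwards [ae_vol01_mem_Icc] with z hz
        rw [hl, eq_of_sum_eq (hsum z), eq_of_sum_eq (he.sum_eq z hz), ← Finset.sum_div,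
          Finset.sum_sub_distrib]
        ring
      have hm : ∀ k, MemLp (fun z => (φ' k z - φ k z) / τ) 2 vol01 := fun k => by
        simp only [div_eq_mul_inv]
        exact ((hφ'2 k).1.memLp.sub (he.φH2 k).1.memLp).mul_const τ⁻¹
      have hle : nrm (fun z => (φ' l z - φ l z) / τ)
          ≤ ∑ k ∈ others n, nrm (fun z => (φ' k z - φ k z) / τ) := by
        rw [nrm_congr hd, nrm_const_mul, abs_neg, abs_one, one_mul]
        exact nrm_sum_le fun k _ => hm k
      refine (sq_sum_le_of_le (nrm_nonneg _) hle hrate card_others.le).trans ?_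
      rw [Finset.sum_add_distrib, ← Finset.mul_sum, Finset.sum_const, nsmul_eq_mul, card_others,
        ← hN]
      change N * (2 * L ^ 2 * lapSq φ' + N * (2 * R ^ 2)) ≤ _
      have : N * (2 * L ^ 2) * lapSq φ' ≤ K * lapSq φ' :=
        mul_le_mul_of_nonneg_right (by linarith) hlap0
      linarith
    · refine (hrate l (mem_others.2 hl)).trans ?_
      have e1 : nrm (dz (dz (φ' l))) ^ 2 ≤ lapSq φ' :=
        Finset.single_le_sum (f := fun l => nrm (dz (dz (φ' l))) ^ 2) (fun _ _ => sq_nonneg _)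
          (mem_others.2 hl)
      have e2 : 2 * L ^ 2 * nrm (dz (dz (φ' l))) ^ 2 ≤ K * lapSq φ' :=
        mul_le_mul (by linarith) e1 (sq_nonneg _) hK0.le
      linarith
  · intro m
    simp only [hq]
    exact ⟨hu m, (huK m).trans (by rw [← hU]; linarith)⟩
  · refine ⟨hφ'2, fun z _ => hsum z, ?_, ?_, hw2, ?_, ?_, ?_, ?_, hv', hv'0, hv'V⟩
    · intro l hl
      simp only [hpo l hl]
      have e1 := (hheat l).1
      have e2 := he.grad l hl
      have e3 : 0 ≤ τ * M.δ l * nrm (dz (dz (p l))) ^ 2 := by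
        have := M.δ_pos l; positivity
      have e4 := mul_le_mul_of_nonneg_left (hRδ l) hτ.le
      linarith
    · intro l hl
      simp only [hpo l hl]
      have e1 := (hheat l).2.1
      have e2 := he.mean l hl
      have := abs_sub_le (∫ z, p l z ∂vol01) (∫ z, φ l z ∂vol01) (M.φ0 l)
      linarith
    · intro m
      simp only [hw']
      have e := abs_add_le (w m 0) (τ * u m 0)
      rw [abs_mul, abs_of_pos hτ] at e
      have := mul_le_mul_of_nonneg_left (hu0' m) hτ.le
      linarith [he.w0 m]
    · intro m
      have e : dz (w' m) =ᵐ[vol01] fun z => dz (w m) z + τ * dz (u m) z := by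
        filter_upwards [ae_vol01_mem_Icc] with z hz using hdw m z hz
      simp only
      rw [nrm_congr e]
      refine (nrm_add_le (he.wH2 m).1.2).trans ?_
      rw [nrm_const_mul, abs_of_pos hτ]
      have := mul_le_mul_of_nonneg_left (hu1' m) hτ.le
      linarith [he.w1 m]
    · intro m
      simp only
      rw [nrm_congr (hddw m)]
      refine (nrm_add_le (he.wH2 m).2.2).trans ?_
      rw [nrm_const_mul, abs_of_pos hτ]
      have := mul_le_mul_of_nonneg_left (huK2 m) hτ.le
      linarith [he.w2 m]
    · intro m
      simp only [hdw m 1 (by simp), he.bcw m, hu1 m]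
      rw [hw', hW']; ring

end Model

end Rothe

/-! ### Summation over the time steps. -/

namespace Rothe

open Filter Topology

theorem sum_Icc_mul_le {k : ℕ} {τ x a b S : ℝ} {f g : ℕ → ℝ} (hτ : 0 ≤ τ) (hk : (k : ℝ) * τ ≤ x)
    (ha : 0 ≤ a) (hb : 0 ≤ b) (hf : ∀ j ∈ Finset.Icc 1 k, f j ≤ a * g j + b)
    (hS : ∑ j ∈ Finset.Icc 1 k, g j * τ ≤ S) :
    ∑ j ∈ Finset.Icc 1 k, f j * τ ≤ a * S + b * x := by
  calc ∑ j ∈ Finset.Icc 1 k, f j * τ ≤ ∑ j ∈ Finset.Icc 1 k, (a * (g j * τ) + b * τ) :=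
        Finset.sum_le_sum fun j hj => by
          have := mul_le_mul_of_nonneg_right (hf j hj) hτ
          linarith
    _ = a * ∑ j ∈ Finset.Icc 1 k, g j * τ + b * (k * τ) := by
        rw [Finset.sum_add_distrib, ← Finset.mul_sum, Finset.sum_const, Nat.card_Icc,
          nsmul_eq_mul, Nat.add_sub_cancel]
        ring
    _ ≤ _ := by gcongr

namespace Model

variable {n : ℕ}

/-- Local in time solvability of the discretised system, with bounds that do not depend on the
step size. -/
theorem exists_local_solution {M : Model n} (h1 : M.Reservoirs) (h4 : M.Nondegenerate)
    (h5 : M.PseudoParabolic) (h7 : M.InitialFractions) (h9 : M.VelocityCoupling) {v0 : ℝ → ℝ}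
    (hv0 : MemH1 v0) (hv00 : v0 0 = 0) :
    ∃ x0 V C : ℝ, 0 < x0 ∧ 0 ≤ V ∧ 0 < C ∧ ∀ x τ, 0 ≤ x → x ≤ x0 → 0 < τ →
      ∃ (φ : ℕ → Comp n → ℝ → ℝ) (w : ℕ → Solid n → ℝ → ℝ) (v : ℕ → ℝ → ℝ) (W : ℕ → ℝ),
        M.IsSolution τ (M.t0 + x) v0 φ w v W ∧ ∀ k : ℕ, (k : ℝ) * τ ≤ x →
          l2sq (v k) ≤ V ^ 2 ∧ l2sq (dz (v k)) ≤ V ^ 2 ∧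
          (∀ l, ∀ z ∈ Icc (0 : ℝ) 1, φ k l z ∈ Icc M.φmin (1 - (M.dR - 1) * M.φmin)) ∧
          (∀ l, √(h1sq (φ k l)) ≤ C) ∧
          (∀ l, ∑ j ∈ Finset.Icc 1 k, h2sq (φ j l) * τ ≤ C) ∧
          (∀ l, ∑ j ∈ Finset.Icc 1 k, l2sq (fun z => (φ j l z - φ (j - 1) l z) / τ) * τ ≤ C) ∧
          (∀ m, √(h2sq (w k m)) ≤ C) ∧
          (∀ m, ∑ j ∈ Finset.Icc 1 k, h1sq (fun z => (w j m z - w (j - 1) m z) / τ) * τ ≤ C) := by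
  obtain ⟨x0, K, L, R, U, V, hx0, hK, hL, hR, hU, hV, hV1, hgood, hadv⟩ :=
    exists_advance h1 h4 h5 h7 h9 (nrm (dz v0))
  set S : ℝ := K * (x0 * K) with hS
  have hS0 : 0 ≤ S := by positivity
  set C : ℝ := 6 + (K * S + 2 * x0) + (K * S + K * x0) + 2 * K ^ 2 * x0 with hC
  have c1 : 0 ≤ K * S := by positivity
  have c2 : 0 ≤ K * x0 := by positivity
  have c3 : 0 ≤ 2 * K ^ 2 * x0 := by positivity
  refine ⟨x0, V, C, hx0, hV, by linarith, ?_⟩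
  intro x τ hx hxx0 hτ
  have hinit : M.Evolved L R U V (((0 : ℕ) : ℝ) * τ) (fun l _ => M.φ0 l) (fun _ _ => 0) v0 0 := by
    refine ⟨fun l => MemH2.const _, fun _ _ => h7.2.2.2.1, fun l _ => ?_, fun l _ => ?_,
      fun m => MemH2.const _, fun m => ?_, fun m => ?_, fun m => ?_, fun m => ?_, hv0, hv00, hV1⟩ <;>
      simp [dz_const]
  obtain ⟨q, hq0, hqI, hqR⟩ := exists_seq
    (α := (Comp n → ℝ → ℝ) × (Solid n → ℝ → ℝ) × (ℝ → ℝ) × ℝ)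
    ((fun l _ => M.φ0 l), (fun _ _ => 0), v0, 0) (fun k => (k : ℝ) * τ ≤ x)
    (fun k hk => by push_cast at hk; linarith)
    (fun k p => M.Evolved L R U V (k * τ) p.1 p.2.1 p.2.2.1 p.2.2.2) (M.Advance K τ) hinit
    (fun k p hk hp => by
      have e : ((k + 1 : ℕ) : ℝ) * τ = k * τ + τ := by push_cast; ring
      rw [e] at hk ⊢
      exact hadv τ (k * τ) p hτ (by positivity) (hk.trans hxx0) hp)
  refine ⟨fun k => (q k).1, fun k => (q k).2.1, fun k => (q k).2.2.1, fun k => (q k).2.2.2,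
    ⟨fun l z => by simp only [hq0], fun m z => by simp only [hq0], by simp only [hq0],
      by simp only [hq0], fun k hk => (hqR k (by linarith)).1⟩, ?_⟩
  intro k hk
  have hle : ∀ j, j ≤ k → (j : ℝ) * τ ≤ x := fun j hj =>
    (mul_le_mul_of_nonneg_right (Nat.cast_le.2 hj) hτ.le).trans hk
  have hG : ∀ j, j ≤ k → M.Good 1 V (q j).1 (q j).2.1 (q j).2.2.1 (q j).2.2.2 := fun j hj =>
    hgood _ _ _ _ _ (by positivity) ((hle j hj).trans hxx0) (hqI j (hle j hj))
  have hkx : 0 ≤ x0 - x := by linarith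
  have hφ : ∀ j, j ≤ k → ∀ l, l2sq ((q j).1 l) ≤ 1 ∧ l2sq (dz ((q j).1 l)) ≤ 1 := by
    intro j hj l
    have hg := hG j hj
    have e1 : nrm ((q j).1 l) ≤ 1 := ContinuousOn.nrm_le (hg.φH1 l).continuousOn fun z hz => by
      have := hg.cube h7.1 z hz l
      rw [abs_of_pos this.1]; exact this.2.le
    have e2 : nrm (dz ((q j).1 l)) ≤ 1 :=
      (Finset.single_le_sum (f := fun l => nrm (dz ((q j).1 l))) (fun _ _ => nrm_nonneg _)
        (Finset.mem_univ l)).trans hg.grad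
    rw [l2sq_eq (hg.φH1 l).memLp, l2sq_eq (hg.φH1 l).2]
    exact ⟨pow_le_one₀ (nrm_nonneg _) e1, pow_le_one₀ (nrm_nonneg _) e2⟩
  have hsum : ∑ j ∈ Finset.Icc 1 k, lapSq (q j).1 * τ ≤ S := by
    -- The energy inequality telescopes; it starts at zero because the initial fractions are
    -- constant in space.
    have ind : ∀ k : ℕ, (k : ℝ) * τ ≤ x → gradSq (q k).1
        + K⁻¹ * ∑ j ∈ Finset.Icc 1 k, lapSq (q j).1 * τ ≤ k * τ * K := by
      intro k
      induction k with
      | zero => intro _; simp [hq0, gradSq, dz_const]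
      | succ k ih =>
        intro hk
        have h := (hqR k hk).2.1
        have h' := ih (by push_cast at hk; linarith)
        rw [← Finset.insert_Icc_right_eq_Icc_add_one (by omega), Finset.sum_insert (by simp)]
        push_cast
        linarith
    have h := ind k hk
    have h0 : 0 ≤ gradSq (q k).1 := Finset.sum_nonneg fun _ _ => sq_nonneg _
    have h' : K⁻¹ * ∑ j ∈ Finset.Icc 1 k, lapSq (q j).1 * τ ≤ x0 * K := by
      have : k * τ * K ≤ x0 * K := by gcongr; linarith
      linarith
    rw [inv_mul_le_iff₀ hK] at h'
    exact h'
  have hg := hG k le_rfl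
  have hprev : ∀ j ∈ Finset.Icc 1 k, M.Advance K τ (q (j - 1)) (q j) ∧ j ≤ k := by
    intro j hj
    obtain ⟨i, rfl⟩ : ∃ i, j = i + 1 := ⟨j - 1, by have := (Finset.mem_Icc.1 hj).1; omega⟩
    exact ⟨hqR i (hle _ (Finset.mem_Icc.1 hj).2), (Finset.mem_Icc.1 hj).2⟩
  refine ⟨?_, ?_, ?_, ?_, ?_, ?_, ?_, ?_⟩
  · rw [l2sq_eq hg.vH1.memLp]
    exact pow_le_pow_left₀ (nrm_nonneg _) (hg.vH1.nrm_le.trans hg.hnrm_v) 2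
  · rw [l2sq_eq hg.vH1.2]
    exact pow_le_pow_left₀ (nrm_nonneg _) hg.v1 2
  · exact fun l z hz => Ioo_subset_Icc_self (hg.box z hz l)
  · intro l
    refine Real.sqrt_le_iff.2 ⟨by linarith, ?_⟩
    have := hφ k le_rfl l
    unfold h1sq
    nlinarith
  · intro l
    have h := sum_Icc_mul_le (f := fun j => h2sq ((q j).1 l)) (g := fun j => lapSq (q j).1)
      (a := K) (b := 2) hτ.le hk hK.le (by norm_num) (fun j hj => by
        obtain ⟨ha, hjk⟩ := hprev j hj
        have e1 := hφ j hjk l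
        have e2 := ha.2.2.1 l
        have e3 := l2sq_eq ((hG j hjk).φH2 l).2.2
        simp only [h2sq, h1sq]
        linarith) hsum
    exact h.trans (by linarith)
  · intro l
    have h := sum_Icc_mul_le
      (f := fun j => l2sq (fun z => ((q j).1 l z - (q (j - 1)).1 l z) / τ))
      (g := fun j => lapSq (q j).1) (a := K) (b := K) hτ.le hk hK.le hK.le (fun j hj => by
        obtain ⟨ha, hjk⟩ := hprev j hj
        have hm : MemLp (fun z => ((q j).1 l z - (q (j - 1)).1 l z) / τ) 2 vol01 := by
          simp only [div_eq_mul_inv]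
          exact (((hG j hjk).φH1 l).memLp.sub
            ((hG (j - 1) (by omega)).φH1 l).memLp).mul_const τ⁻¹
        simp only [l2sq_eq hm]
        exact ha.2.2.2.1 l) hsum
    have : K * x ≤ K * x0 := by gcongr
    exact h.trans (by linarith)
  · intro m
    refine Real.sqrt_le_iff.2 ⟨by linarith, ?_⟩
    have e0 : nrm ((q k).2.1 m) ≤ 2 := (hg.wH2 m).1.nrm_le.trans (hg.hnrm_w m)
    have e1 := pow_le_pow_left₀ (nrm_nonneg _) e0 2
    have e2 := pow_le_pow_left₀ (nrm_nonneg _) (hg.w1 m) 2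
    have e3 := pow_le_pow_left₀ (nrm_nonneg _) (hg.w2 m) 2
    simp only [h2sq, h1sq]
    rw [l2sq_eq (hg.wH2 m).1.memLp, l2sq_eq (hg.wH2 m).1.2, l2sq_eq (hg.wH2 m).2.2]
    nlinarith
  · intro m
    have h := sum_Icc_mul_le
      (f := fun j => h1sq (fun z => ((q j).2.1 m z - (q (j - 1)).2.1 m z) / τ))
      (g := fun j => lapSq (q j).1) (a := 0) (b := 2 * K ^ 2) hτ.le hk le_rfl (by positivity)
      (fun j hj => by
        obtain ⟨hm, hn⟩ := (hprev j hj).1.2.2.2.2 m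
        have e1 := pow_le_pow_left₀ (nrm_nonneg _) (hm.1.nrm_le.trans hn) 2
        have e2 : nrm (dz (fun z => ((q j).2.1 m z - (q (j - 1)).2.1 m z) / τ)) ≤ K :=
          le_trans (le_add_of_nonneg_left (abs_nonneg _)) hn
        have e3 := pow_le_pow_left₀ (nrm_nonneg _) e2 2
        simp only [h1sq]
        rw [l2sq_eq hm.1.memLp, l2sq_eq hm.1.2]
        linarith) hsum
    have : 2 * K ^ 2 * x ≤ 2 * K ^ 2 * x0 := by gcongr
    exact h.trans (by linarith)

end Model

end Rothe

namespace Rothe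

open Filter Topology

/-! ### The product logarithm -/

theorem lambertW0_bddAbove (x : ℝ) : BddAbove {w : ℝ | -1 ≤ w ∧ w * Real.exp w ≤ x} := by
  refine ⟨max x 0, fun w hw => ?_⟩
  rcases le_total w 0 with h | h
  · exact h.trans (le_max_right _ _)
  · have : w * 1 ≤ w * Real.exp w := mul_le_mul_of_nonneg_left (Real.one_le_exp h) h
    exact le_max_of_le_left (by linarith [hw.2])

theorem lambertW0_nonneg {x : ℝ} (hx : 0 ≤ x) : 0 ≤ lambertW0 x :=
  le_csSup (lambertW0_bddAbove x) ⟨by norm_num, by simpa using hx⟩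

theorem lambertW0_mul_exp_le {x : ℝ} (hx : 0 ≤ x) :
    lambertW0 x * Real.exp (lambertW0 x) ≤ x := by
  have hc : IsClosed {w : ℝ | -1 ≤ w ∧ w * Real.exp w ≤ x} :=
    (isClosed_le continuous_const continuous_id).inter
      (isClosed_le (by fun_prop : Continuous fun w : ℝ => w * Real.exp w) continuous_const)
  exact (hc.csSup_mem ⟨0, by norm_num, by simpa using hx⟩ (lambertW0_bddAbove x)).2

/-- No sign of `x` is required: an empty defining set would have supremum `0`, contradicting `0 ≤ t
< lambertW0 x`. -/
theorem mul_exp_lt_of_lt_lambertW0 {t x : ℝ} (ht : 0 ≤ t) (h : t < lambertW0 x) :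
    t * Real.exp t < x := by
  have hne : {w : ℝ | -1 ≤ w ∧ w * Real.exp w ≤ x}.Nonempty := by
    by_contra hn
    rw [not_nonempty_iff_eq_empty] at hn
    rw [lambertW0, hn, Real.sSup_empty] at h
    linarith
  obtain ⟨w, hw, htw⟩ := exists_lt_of_lt_csSup hne h
  refine lt_of_lt_of_le ?_ hw.2
  exact mul_lt_mul htw (Real.exp_le_exp.2 htw.le) (Real.exp_pos _) (ht.trans htw.le)

/-- Here `s` stands for `y²` and `a` for `Q₀H`. The candidate is the smaller of `z / D` and `Y²`:
the definition of `z` makes `(1 - Q₁) s - Q₂ s² exp(D s)` at least `Q₂ s² (1 + D s) exp(D s)` there,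
and `h3` or `h2` places `a` below this value. -/
theorem exists_smallness {a Q1 Q2 D Y z : ℝ} (hQ1 : Q1 < 1) (hQ2 : 0 < Q2) (hD : 0 < D)
    (ha : 0 ≤ a) (hY : 0 ≤ Y) (hz : z = 2 / 3 * lambertW0 (3 * D / (4 * Q2) * (1 - Q1)))
    (h2 : a < Y ^ 4 * Q2) (h3 : a < Q2 * z ^ 2 / D ^ 2 * (1 + z) * Real.exp z) :
    ∃ s : ℝ, 0 < s ∧ s < Y ^ 2 ∧ a + Q1 * s + Q2 * s ^ 2 * Real.exp (D * s) < s := by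
  set X := 3 * D / (4 * Q2) * (1 - Q1) with hX
  have hX0 : 0 ≤ X := mul_nonneg (by positivity) (by linarith)
  have hW0 := lambertW0_nonneg hX0
  have hWX := lambertW0_mul_exp_le hX0
  have hW : lambertW0 X = 3 / 2 * z := by linarith
  rw [hW] at hW0 hWX
  have hz0 : 0 ≤ z := by linarith
  have hzp : 0 < z := by
    refine lt_of_le_of_ne hz0 fun h => ?_
    rw [← h] at h3; simp at h3; linarith
  have hYp : 0 < Y := by
    refine lt_of_le_of_ne hY fun h => ?_
    rw [← h] at h2; simp at h2; linarith
  -- The defining inequality of the product logarithm at `3/2 z`, multiplied by `4 Q₂ / 3`.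
  have hQz : 2 * Q2 * z * Real.exp (3 / 2 * z) ≤ D * (1 - Q1) := by
    have e : 4 * Q2 / 3 * X = D * (1 - Q1) := by rw [hX]; field_simp
    rw [← e]
    have := mul_le_mul_of_nonneg_left hWX (by positivity : 0 ≤ 4 * Q2 / 3)
    linarith
  set s0 := min (z / D) (Y ^ 2) with hs0
  have hs0p : 0 < s0 := by positivity
  have hDs : D * s0 ≤ z := by
    have : s0 ≤ z / D := min_le_left _ _
    rw [le_div_iff₀ hD] at this; linarith
  -- Equivalent to `1 + t / 2 ≤ exp (t / 2)`; it links the exponent `3/2 z` of the product logarithm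
  -- to the factor `(1 + z) exp z` in the step bound.
  have hexp : ∀ t : ℝ, (1 + t) * Real.exp t ≤ 2 * Real.exp (3 / 2 * t) - Real.exp t := by
    intro t
    have e1 : Real.exp (3 / 2 * t) = Real.exp (t / 2) * Real.exp t := by
      rw [← Real.exp_add]; ring_nf
    have e2 := Real.add_one_le_exp (t / 2)
    have e3 := Real.exp_pos t
    rw [e1]; nlinarith
  have hlow : Q2 * s0 ^ 2 * ((1 + D * s0) * Real.exp (D * s0))
      ≤ (1 - Q1) * s0 - Q2 * s0 ^ 2 * Real.exp (D * s0) := by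
    have e1 : 2 * Q2 * (D * s0) * Real.exp (3 / 2 * (D * s0)) ≤ D * (1 - Q1) :=
      le_trans (by gcongr) hQz
    have e2 : 2 * Q2 * s0 * Real.exp (3 / 2 * (D * s0)) ≤ 1 - Q1 := by
      refine le_of_mul_le_mul_left ?_ hD
      linarith
    have e3 := mul_le_mul_of_nonneg_left (hexp (D * s0)) (by positivity : 0 ≤ Q2 * s0 ^ 2)
    have e4 := mul_le_mul_of_nonneg_left e2 hs0p.le
    linarith
  have hstrict : a < Q2 * s0 ^ 2 * ((1 + D * s0) * Real.exp (D * s0)) := by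
    rcases min_choice (z / D) (Y ^ 2) with h | h
    · rw [← hs0] at h
      have e : D * s0 = z := by rw [h]; field_simp
      rw [e, h]
      refine h3.trans_le (le_of_eq ?_)
      ring
    · rw [← hs0] at h
      have e : 0 ≤ D * s0 := by positivity
      have e1 := Real.one_le_exp e
      have e2 : 1 ≤ (1 + D * s0) * Real.exp (D * s0) := by nlinarith
      have e3 : Q2 * s0 ^ 2 * 1 ≤ Q2 * s0 ^ 2 * ((1 + D * s0) * Real.exp (D * s0)) := by gcongr
      refine h2.trans_le (le_trans (le_of_eq ?_) e3)
      rw [h]; ring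
  have hfin : 0 < (1 - Q1) * s0 - Q2 * s0 ^ 2 * Real.exp (D * s0) - a := by linarith
  have hcont : Continuous fun s => (1 - Q1) * s - Q2 * s ^ 2 * Real.exp (D * s) - a := by fun_prop
  -- The inequality is strict at `s0`, so moving slightly to the left preserves it and makes `s < Y
  -- ^ 2` strict too.
  have hev : ∀ᶠ s in 𝓝[<] s0, 0 < (1 - Q1) * s - Q2 * s ^ 2 * Real.exp (D * s) - a :=
    ((hcont.tendsto s0).eventually_const_lt hfin).filter_mono nhdsWithin_le_nhds
  obtain ⟨s, hs, hsI⟩ := (hev.and (Ioo_mem_nhdsLT hs0p)).exists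
  exact ⟨s, hsI.1, hsI.2.trans_le (min_le_right _ _), by linarith⟩

theorem continuous_ciSup_of_finite {ι X : Type*} [Finite ι] [Nonempty ι] [TopologicalSpace X]
    {f : ι → X → ℝ} (hf : ∀ i, Continuous (f i)) : Continuous fun x => ⨆ i, f i x := by
  have := Fintype.ofFinite ι
  simp only [← Finset.sup'_univ_eq_ciSup]
  exact Continuous.finset_sup'_apply _ fun i _ => hf i

/-! ### Signs of the constants for admissible parameters. -/

namespace Model

variable {n : ℕ} {M : Model n} {η : Young n}

instance : Nonempty (Ind n) := ⟨⟨compD n, by simp [compD, compDm1, Fin.ext_iff]⟩⟩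

theorem Admissible.κ_pos (ha : M.Admissible η) : 0 < M.κ η := by
  obtain ⟨ε, hε, h⟩ := exists_pos_forall_le_of_finite
    (fun m => min (1 - M.Kw5 η m) (M.γ m - M.Kw6 η m))
    fun m => lt_min (by linarith [ha.2.1 m]) (by linarith [ha.2.2.1 m])
  exact hε.trans_le (le_ciInf h)

theorem Admissible.Kw78_pos (ha : M.Admissible η) : 0 < M.Kw78 η := by
  obtain ⟨h1, h2, h3, h4, h5, h6, h7, h8, h9, h10, h11, h12, h13, h14, h15, h16⟩ := ha.1
  refine add_pos_of_pos_of_nonneg (Finset.sum_pos (fun m _ => ?_) Finset.univ_nonempty)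
    (Finset.sum_nonneg fun m _ => ?_)
  · have := (M.F m).bd_pos; have := h3 m; have := h4 m; positivity
  · have := h11 m; have := h12 m; have := h8 m; have := h9 m; positivity

theorem Admissible.Kb1_pos (ha : M.Admissible η) : 0 < M.Kb1 η := by
  obtain ⟨h1, -⟩ := ha.1.2.2.2.2.2.2.2.2.2.2.2.2.2.2.2
  refine Finset.sum_pos (fun l _ => ?_) Finset.univ_nonempty
  have := h1 l; have := (M.I l).bd_pos; have := M.Γ.bd_pos; have := M.δ_pos l; positivity

theorem Admissible.Kb67_nonneg (ha : M.Admissible η) : 0 ≤ M.Kb67 η := by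
  obtain ⟨-, -, -, h, -⟩ := ha.1.2.2.2.2.2.2.2.2.2.2.2.2.2.2.2
  refine Real.iSup_nonneg fun m => le_max_of_le_left (div_nonneg (Finset.sum_nonneg fun l _ => ?_)
    (by linarith [ha.2.1 m]))
  have := h l 0 1 m; have := M.δ_pos l; positivity

theorem Admissible.Ka67_nonneg (ha : M.Admissible η) : 0 ≤ M.Ka67 η := by
  obtain ⟨-, -, -, h, h'⟩ := ha.1.2.2.2.2.2.2.2.2.2.2.2.2.2.2.1
  refine Real.iSup_nonneg fun m => le_max_of_le_left (div_nonneg (Real.iSup_nonneg fun l => ?_)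
    (by linarith [ha.2.1 m]))
  have h1 := h l 0 1 m
  have h2 : ∀ k, 0 < η.a.eBn l 1 m k := fun k => h' l 1 m k
  have : 0 ≤ ∑ k : Ind n, (M.B l 1 1 m).bd ^ 2 / η.a.eBn l 1 m k :=
    Finset.sum_nonneg fun k _ => by have := h2 k; positivity
  positivity

theorem Admissible.Ka1_nonneg (ha : M.Admissible η) : 0 ≤ M.Ka1 η := by
  obtain ⟨h, -, h', -⟩ := ha.1.2.2.2.2.2.2.2.2.2.2.2.2.2.2.1
  refine Real.iSup_nonneg fun l => ?_
  have h1 := h l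
  have : 0 ≤ ∑ k : Ind n, (M.I l).bd ^ 2 * M.Γ.bd ^ 2 * Cp ^ 2 / η.a.en l k :=
    Finset.sum_nonneg fun k _ => by have := h' l k; positivity
  positivity

theorem Admissible.DbHat_pos (ha : M.Admissible η) : 0 < M.DbHat η := by
  obtain ⟨-, -, h, -, h'⟩ := ha.1.2.2.2.2.2.2.2.2.2.2.2.2.2.2.2
  obtain ⟨l⟩ : Nonempty (Ind n) := inferInstance
  refine lt_of_lt_of_le ?_ (le_ciSup (f := fun l : Ind n =>
    2 * M.Kφ31 η l + M.Kφ34 η l / M.κ η * M.Kw78 η) (Finite.bddAbove_range _) l)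
  have h1 : 0 < M.Kφ31 η l := by
    refine mul_pos two_pos (Finset.sum_pos (fun k _ => ?_) Finset.univ_nonempty)
    have := h k l; have := (M.I k).bd_pos; have := M.Γ.bd_pos; have := M.δ_pos k
    unfold Cinf2; positivity
  have h2 : 0 ≤ M.Kφ34 η l := by
    refine Finset.sum_nonneg fun m _ => div_nonneg (add_nonneg
      (mul_nonneg two_pos.le (Finset.sum_nonneg fun k _ => ?_))
      (mul_nonneg two_pos.le (Finset.sum_nonneg fun k _ => ?_)))
      (le_min (by linarith [ha.2.1 m]) (by linarith [ha.2.2.1 m]))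
    · have := h' k 1 m l; have := M.δ_pos l; unfold Cinf2; positivity
    · have := h' k 0 m l; have := M.δ_pos l; unfold Cinf2; positivity
  have := ha.κ_pos
  have := ha.Kw78_pos
  positivity

theorem Admissible.cbHat_pos (ha : M.Admissible η) : 0 < M.cbHat η := by
  have := ha.Kb1_pos
  have := ha.Kb67_nonneg
  have := ha.κ_pos
  have := ha.Kw78_pos
  unfold cbHat; positivity

theorem Admissible.ZaHat_nonneg (ha : M.Admissible η) : 0 ≤ M.ZaHat η := by
  have := ha.Ka1_nonneg
  have := ha.Ka67_nonneg
  have := ha.κ_pos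
  have := ha.Kw78_pos
  unfold ZaHat; positivity

theorem Admissible.Q1_nonneg (ha : M.Admissible η) : 0 ≤ M.Q1 η := by
  have h1 := M.one_le_dR_sub_one
  have : 0 ≤ ⨆ m, (M.H 1 m).bd ^ 2 / (M.γ m - M.Kw6 η m) :=
    Real.iSup_nonneg fun m => div_nonneg (sq_nonneg _) (by linarith [ha.2.2.1 m])
  have := ha.Kw78_pos
  have : 0 ≤ 4 * M.dR - 2 := by linarith
  unfold Q1; positivity

theorem Admissible.Q2_pos (ha : M.Admissible η) (hΓ : 0 < M.Γmin) : 0 < M.Q2 η := by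
  have h1 := M.one_le_dR_sub_one
  have : 0 < ⨆ m, (2 * M.Γ.bd ^ 2 + (M.H 1 m).bd ^ 2 / (1 - M.Kw5 η m) * M.Kw78 η) := by
    refine lt_of_lt_of_le ?_ (le_ciSup (f := fun m =>
      2 * M.Γ.bd ^ 2 + (M.H 1 m).bd ^ 2 / (1 - M.Kw5 η m) * M.Kw78 η) (Finite.bddAbove_range _) 0)
    have := M.Γ.bd_pos
    have := ha.Kw78_pos
    have : 0 < 1 - M.Kw5 η 0 := by linarith [ha.2.1 0]
    positivity
  have := ha.cbHat_pos
  have : 0 < 4 * M.dR - 2 := by linarith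
  have : 0 < 4 * M.dR - 4 := by linarith
  unfold Q2 Cinf2; positivity

/-! ### The bounding functions at the initial time -/

theorem Chat2_zero (y : ℝ) : M.Chat2 η 0 y = M.Kw78 η * y ^ 2 := by simp [Chat2]

theorem cb_zero (y : ℝ) : M.cb η 0 y = M.cbHat η * y ^ 2 := by
  simp only [cb, Ctil2, Chat2_zero, cbHat]; ring

theorem Db_zero (y : ℝ) : M.Db η 0 y = M.DbHat η * y ^ 2 := by
  simp only [Db, Ctil2, Chat2_zero, DbHat]
  rw [Real.iSup_mul_of_nonneg (sq_nonneg y)]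
  refine iSup_congr fun l => ?_
  ring

/-- Up to the factor `DbHat` this is `t exp t` with `t = DbHat y²`, the form that the product
logarithm in `yTilde` inverts. -/
theorem gradB_zero (y : ℝ) :
    M.gradB η 0 y = M.cbHat η * (y ^ 2 * Real.exp (M.DbHat η * y ^ 2)) := by
  rw [gradB, cb_zero, Db_zero]; ring

theorem phiB_zero (j : Ind n) (y : ℝ) : M.phiB η j 0 y = M.φ0 j ^ 2 + M.ZaHat η * y ^ 2 := by
  simp only [phiB, Za, Ctil2, Chat2_zero, ZaHat]
  simp; ring

theorem pH1_zero (y : ℝ) : M.pH1 η 0 y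
    = M.φ0 (compDm1 n) ^ 2 + M.PHat η * y ^ 2 + (M.dR - 1) * M.gradB η 0 y := by
  simp only [pH1, Chat2_zero, PHat, Cinf2]
  simp; ring

theorem sum_Ind_eq {f : Comp n → ℝ} : ∑ j : Ind n, f j = ∑ j ∈ others n, f j := by
  rw [Finset.sum_subtype (others n) (p := fun l => l ≠ compDm1 n) fun l => mem_others]

/-- The bound `P` at the initial time. -/
theorem P_zero_le (ha : M.Admissible η) (l : Comp n) (y : ℝ) : M.P η l 0 y
    ≤ (∑ j ∈ Finset.univ.filter (fun j => j ≠ l), M.φ0 j ^ 2)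
      + (if l = compDm1 n then (M.dR - 1) * M.ZaHat η + M.cbHat η
        else (M.dR - 2) * M.ZaHat η + M.dR * M.cbHat η + M.PHat η)
        * (y ^ 2 * Real.exp (M.DbHat η * y ^ 2)) := by
  have hD := ha.DbHat_pos
  have hZ := ha.ZaHat_nonneg
  have hk := ha.Kw78_pos
  have hd := M.one_le_dR_sub_one
  set E := y ^ 2 * Real.exp (M.DbHat η * y ^ 2) with hE
  -- Replacing the plain `y²` by `E` puts all contributions on one common factor, whose coefficient
  -- is the denominator in `yTilde`.
  have hyE : y ^ 2 ≤ E := le_mul_of_one_le_right (sq_nonneg y) (Real.one_le_exp (by positivity))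
  have hZE : M.ZaHat η * y ^ 2 ≤ M.ZaHat η * E := mul_le_mul_of_nonneg_left hyE hZ
  have hPE : M.PHat η * y ^ 2 ≤ M.PHat η * E :=
    mul_le_mul_of_nonneg_left hyE (by
      have : 0 ≤ M.dR * M.Kw78 η := mul_nonneg (by linarith) hk.le
      unfold PHat; linarith)
  have hfil : Finset.univ.filter (fun j => j ≠ l) = Finset.univ.erase l := by
    ext j; simp
  rw [P, hfil]
  simp only [phiB_zero, gradB_zero, pH1_zero, ← hE]
  rw [sum_Ind_eq (f := fun j => if j = l then 0 else M.φ0 j ^ 2 + M.ZaHat η * y ^ 2)]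
  split_ifs with hl
  · subst hl
    rw [Finset.sum_congr rfl fun j hj => if_neg (mem_others.1 hj), Finset.sum_add_distrib,
      Finset.sum_const, nsmul_eq_mul, card_others, others]
    have : ((n : ℝ) + 1) = M.dR - 1 := by rw [dR]; ring
    rw [this]
    have := mul_le_mul_of_nonneg_left hZE (by linarith : 0 ≤ M.dR - 1)
    linarith
  -- One of the `d - 1` terms drops out, leaving `d - 2` of them. The gradient bound occurs once
  -- directly and `d - 1` times inside `pH1`, hence the coefficient `d`.
  · have hmem : l ∈ others n := mem_others.2 hl
    rw [← Finset.add_sum_erase _ _ hmem, if_pos rfl, zero_add,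
      Finset.sum_congr rfl fun j hj => if_neg (Finset.mem_erase.1 hj).1, Finset.sum_add_distrib,
      Finset.sum_const, nsmul_eq_mul, Finset.card_erase_of_mem hmem]
    have hc : (((others n).card - 1 : ℕ) : ℝ) = M.dR - 2 := by
      have h := card_others (n := n)
      rw [Nat.cast_sub (Finset.card_pos.2 ⟨l, hmem⟩), h, dR]; push_cast; ring
    have hs : ∑ j ∈ Finset.univ.erase l, M.φ0 j ^ 2
        = M.φ0 (compDm1 n) ^ 2 + ∑ j ∈ (others n).erase l, M.φ0 j ^ 2 := by
      rw [← Finset.add_sum_erase _ _ (Finset.mem_erase.2 ⟨Ne.symm hl, Finset.mem_univ _⟩), others,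
        Finset.erase_right_comm]
    have hd2 : 0 ≤ M.dR - 2 := by rw [dR]; simp
    rw [hc, hs]
    have := mul_le_mul_of_nonneg_left hZE hd2
    linarith

/-- Terms without the gradient bound form `Q₁ y²`. The others carry `gradB`, itself of order `y²`,
and form the term with `Q₂`. -/
theorem Q_zero_le (ha : M.Admissible η) (Q0 h y : ℝ) : M.Q η Q0 h 0 y
    ≤ Q0 * h + M.Q1 η * y ^ 2 + M.Q2 η * (y ^ 2) ^ 2 * Real.exp (M.DbHat η * y ^ 2) := by
  have hd := M.one_le_dR_sub_one
  have hk := ha.Kw78_pos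
  have hg0 : 0 ≤ M.gradB η 0 y := by
    rw [gradB_zero]
    have := ha.cbHat_pos
    positivity
  set A := ⨆ m, (M.H 1 m).bd ^ 2 / (M.γ m - M.Kw6 η m) with hA
  set S := ⨆ m, (2 * M.Γ.bd ^ 2 + (M.H 1 m).bd ^ 2 / (1 - M.Kw5 η m) * M.Kw78 η) with hS
  set g := M.gradB η 0 y with hg
  -- A maximum of nonnegative numbers is at most their sum. The subtracted `2 Γ²` is exactly what
  -- the term `8 Γ²` of `Q` adds back.
  have key : (⨆ m, max ((M.H 1 m).bd ^ 2 / (M.γ m - M.Kw6 η m))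
      (4 * (M.dR - 1) * Cinf2 * (M.H 1 m).bd ^ 2 * g / (1 - M.Kw5 η m))) * M.Kw78 η
      ≤ A * M.Kw78 η + (4 * M.dR - 4) * Cinf2 * g * (S - 2 * M.Γ.bd ^ 2) := by
    rw [Real.iSup_mul_of_nonneg hk.le]
    refine ciSup_le fun m => ?_
    have e1 : (M.H 1 m).bd ^ 2 / (M.γ m - M.Kw6 η m) ≤ A :=
      le_ciSup (f := fun m => (M.H 1 m).bd ^ 2 / (M.γ m - M.Kw6 η m)) (Finite.bddAbove_range _) m
    have e2 : 2 * M.Γ.bd ^ 2 + (M.H 1 m).bd ^ 2 / (1 - M.Kw5 η m) * M.Kw78 η ≤ S :=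
      le_ciSup (f := fun m => 2 * M.Γ.bd ^ 2 + (M.H 1 m).bd ^ 2 / (1 - M.Kw5 η m) * M.Kw78 η)
        (Finite.bddAbove_range _) m
    have h5 : 0 < 1 - M.Kw5 η m := by linarith [ha.2.1 m]
    have h6 : 0 < M.γ m - M.Kw6 η m := by linarith [ha.2.2.1 m]
    have e3 : 0 ≤ (M.H 1 m).bd ^ 2 / (M.γ m - M.Kw6 η m) := by positivity
    have e5 : 0 ≤ (4 * M.dR - 4) * Cinf2 * g :=
      mul_nonneg (mul_nonneg (by linarith) (by unfold Cinf2; norm_num)) hg0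
    have e4 : 4 * (M.dR - 1) * Cinf2 * (M.H 1 m).bd ^ 2 * g / (1 - M.Kw5 η m)
        = (4 * M.dR - 4) * Cinf2 * g * ((M.H 1 m).bd ^ 2 / (1 - M.Kw5 η m)) := by ring
    have e6 : 0 ≤ (4 * M.dR - 4) * Cinf2 * g * ((M.H 1 m).bd ^ 2 / (1 - M.Kw5 η m)) := by
      positivity
    rw [e4]
    have e7 := max_le (by linarith : (M.H 1 m).bd ^ 2 / (M.γ m - M.Kw6 η m)
        ≤ A + (4 * M.dR - 4) * Cinf2 * g * ((M.H 1 m).bd ^ 2 / (1 - M.Kw5 η m)))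
      (by linarith : (4 * M.dR - 4) * Cinf2 * g * ((M.H 1 m).bd ^ 2 / (1 - M.Kw5 η m))
        ≤ A + (4 * M.dR - 4) * Cinf2 * g * ((M.H 1 m).bd ^ 2 / (1 - M.Kw5 η m)))
    have e8 := mul_le_mul_of_nonneg_right e7 hk.le
    have e9 := mul_le_mul_of_nonneg_left
      (by linarith : (M.H 1 m).bd ^ 2 / (1 - M.Kw5 η m) * M.Kw78 η ≤ S - 2 * M.Γ.bd ^ 2) e5
    linarith
  have hy := sq_nonneg y
  have key2 := mul_le_mul_of_nonneg_right key hy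
  have hpre : 0 ≤ (4 * M.dR - 2) / M.Γmin ^ 2 := div_nonneg (by linarith) (sq_nonneg _)
  have hQ1 : M.Q1 η = (4 * M.dR - 2) / M.Γmin ^ 2 * A * M.Kw78 η := rfl
  have hQ2 : M.Q2 η * (y ^ 2) ^ 2 * Real.exp (M.DbHat η * y ^ 2)
      = (4 * M.dR - 2) / M.Γmin ^ 2 * ((4 * M.dR - 4) * Cinf2 * g * S * y ^ 2) := by
    rw [hg, gradB_zero, Q2, ← hS]; ring
  rw [Q, Chat2_zero, hQ2, hQ1, add_assoc (Q0 * h), add_le_add_iff_left]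
  rw [show (4 * M.dR - 2) / M.Γmin ^ 2 * A * M.Kw78 η * y ^ 2
    + (4 * M.dR - 2) / M.Γmin ^ 2 * ((4 * M.dR - 4) * Cinf2 * g * S * y ^ 2)
    = (4 * M.dR - 2) / M.Γmin ^ 2 * (A * M.Kw78 η * y ^ 2
      + (4 * M.dR - 4) * Cinf2 * g * S * y ^ 2) by ring]
  refine mul_le_mul_of_nonneg_left ?_ hpre
  rw [← hg]
  linarith

end Model

end Rothe

namespace Rothe

open Filter Topology

namespace Model

variable {n : ℕ} {M : Model n} {η : Young n}

/-! ### Continuity of the bounding functions in time -/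

theorem continuous_Chat2 (y : ℝ) : Continuous fun x => M.Chat2 η x y := by
  unfold Chat2 gA Kw0 Mt
  fun_prop

theorem continuous_Ctil2 (y : ℝ) : Continuous fun x => M.Ctil2 η x y :=
  (continuous_Chat2 y).div_const _

theorem continuous_gradB (y : ℝ) : Continuous fun x => M.gradB η x y := by
  have h1 := continuous_Ctil2 (M := M) (η := η) y
  have h2 : Continuous fun x => M.Db η x y := continuous_ciSup_of_finite fun l => by fun_prop
  unfold gradB cb
  fun_prop

theorem continuous_P (l : Comp n) (y : ℝ) : Continuous fun x => M.P η l x y := by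
  have h1 := continuous_Ctil2 (M := M) (η := η) y
  have h2 := continuous_gradB (M := M) (η := η) y
  have h3 := continuous_Chat2 (M := M) (η := η) y
  have h4 : ∀ j, Continuous fun x => M.phiB η j x y := fun j => by
    unfold phiB Za Aa
    fun_prop
  have h5 : Continuous fun x => M.pH1 η x y := by
    unfold pH1 pA pB
    fun_prop
  unfold P
  refine ((continuous_finsetSum _ fun j _ => ?_).add h2).add ?_
  · split_ifs
    · exact continuous_const
    · exact h4 j
  · split_ifs
    · exact continuous_const
    · exact h5

theorem continuous_Q (Q0 h y : ℝ) : Continuous fun x => M.Q η Q0 h x y := by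
  have h2 := continuous_gradB (M := M) (η := η) y
  have h3 := continuous_Chat2 (M := M) (η := η) y
  have h4 : Continuous fun x => ⨆ m, max ((M.H 0 m).bd ^ 2 / (M.γ m + M.D m))
      (4 * (M.dR - 1) * Cinf2 * (M.H 0 m).bd ^ 2 * M.gradB η x y) :=
    continuous_ciSup_of_finite fun m => by fun_prop
  have h5 : Continuous fun x => ⨆ m, max ((M.H 1 m).bd ^ 2 / (M.γ m - M.Kw6 η m))
      (4 * (M.dR - 1) * Cinf2 * (M.H 1 m).bd ^ 2 * M.gradB η x y / (1 - M.Kw5 η m)) :=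
    continuous_ciSup_of_finite fun m => by fun_prop
  unfold Q
  fun_prop

/-- The step bound yields a velocity bound that is admissible for all short time intervals. -/
theorem exists_velocity_bound (ha : M.Admissible η) (hΓ : 0 < M.Γmin) {Q0 h : ℝ} (hQ0 : 0 ≤ Q0)
    (hh : 0 ≤ h) (hs : M.StepBound η Q0 h) :
    ∃ y x1 : ℝ, 0 < y ∧ 0 < x1 ∧ Q0 * h < y ^ 2 ∧ ∀ x, 0 < x → x < x1 →
      (x, y) ∈ M.regionS η ∩ M.regionR η Q0 h := by
  have hD := ha.DbHat_pos
  -- The velocity bound will be `√s`: the constraint `s < yTilde²` serves `P`, the last inequality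
  -- serves `Q`.
  obtain ⟨s, hs0, hsY, hsQ⟩ := exists_smallness ha.2.2.2.2.2 (ha.Q2_pos hΓ) hD
    (mul_nonneg hQ0 hh) (Real.sqrt_nonneg _) rfl hs.2.1 hs.2.2.1
  have hys : √s ^ 2 = s := Real.sq_sqrt hs0.le
  have hQ2 := ha.Q2_pos hΓ
  have hQ1 := ha.Q1_nonneg
  have hP0 : ∀ l, M.P η l 0 √s < M.thr := by
    intro l
    refine (P_zero_le ha l √s).trans_lt ?_
    rw [hys]
    set Θ := (if l = compDm1 n then (M.dR - 1) * M.ZaHat η + M.cbHat η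
        else (M.dR - 2) * M.ZaHat η + M.dR * M.cbHat η + M.PHat η) with hΘ
    set r := M.thr - ∑ j ∈ Finset.univ.filter (fun j => j ≠ l), M.φ0 j ^ 2 with hr
    have hΘ0 : 0 < Θ := by
      have h1 := M.one_le_dR_sub_one
      have h2 := ha.ZaHat_nonneg
      have h3 := ha.cbHat_pos
      have h4 := ha.Kw78_pos
      have h5 : 0 ≤ M.dR - 2 := by rw [dR]; simp
      have h6 : 0 < M.dR := by linarith
      have h7 : 0 ≤ M.dR - 1 := by linarith
      rw [hΘ]
      split_ifs
      · positivity
      · unfold PHat; positivity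
    have hlt : M.DbHat η * s < lambertW0 (⨅ l : Comp n,
        (M.thr - ∑ j ∈ Finset.univ.filter (fun j => j ≠ l), M.φ0 j ^ 2) * M.DbHat η /
          (if l = compDm1 n then (M.dR - 1) * M.ZaHat η + M.cbHat η
            else (M.dR - 2) * M.ZaHat η + M.dR * M.cbHat η + M.PHat η)) := by
      have h1 : √s < M.yTilde η :=
        lt_of_pow_lt_pow_left₀ 2 (Real.sqrt_nonneg _) (by rw [hys]; exact hsY)
      have h2 := (Real.sqrt_lt_sqrt_iff hs0.le).1 h1
      rwa [one_div, lt_inv_mul_iff₀ hD] at h2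
    have h2 := mul_exp_lt_of_lt_lambertW0 (by positivity) hlt
    have h3 := h2.trans_le (ciInf_le (Finite.bddBelow_range _) l)
    rw [← hΘ, ← hr, lt_div_iff₀ hΘ0] at h3
    have h4 : Θ * (s * Real.exp (M.DbHat η * s)) < r :=
      lt_of_mul_lt_mul_right (by linarith) hD.le
    linarith
  have hR0 : M.Q η Q0 h 0 √s < √s ^ 2 := by
    refine (Q_zero_le ha Q0 h √s).trans_lt ?_
    rw [hys]; exact hsQ
  -- Finitely many strict inequalities between continuous functions at `x = 0` persist for small
  -- `x`.
  have hev : ∀ᶠ x in 𝓝 (0 : ℝ), (∀ l, M.P η l x √s < M.thr) ∧ M.Q η Q0 h x √s < √s ^ 2 :=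
    (eventually_all.2 fun l =>
      ((continuous_P l √s).tendsto 0).eventually_lt_const (hP0 l)).and
      (((continuous_Q Q0 h √s).tendsto 0).eventually_lt_const hR0)
  obtain ⟨x1, hx1, hx⟩ := Metric.eventually_nhds_iff.1 hev
  have hyp := Real.sqrt_pos.2 hs0
  refine ⟨√s, x1, hyp, hx1, ?_, fun x hx0 hxx => ?_⟩
  · rw [hys]
    have : 0 ≤ M.Q1 η * s := mul_nonneg hQ1 hs0.le
    have : 0 ≤ M.Q2 η * s ^ 2 * Real.exp (M.DbHat η * s) := by positivity
    linarith
  · obtain ⟨b1, b2⟩ := hx (y := x) (by rw [Real.dist_eq, sub_zero, abs_of_pos hx0]; exact hxx)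
    exact ⟨⟨hx0, hyp, b1⟩, ⟨hx0, hyp, b2⟩⟩

end Model

end Rothe

/-! ### Admissible Young parameters. -/

namespace Rothe

open Filter Topology

namespace Model

variable {n : ℕ} (M : Model n)

/-- Young parameters that approach the optimal ones as `ε → 0`. -/
noncomputable def young (θ : Solid n → ℝ) (ε : ℝ) : Young n where
  e1 _ := 1
  e2 _ := ε
  eL1 _ := ε⁻¹
  eL2 m := M.cgap m
  eM1 _ := 1
  eM2 _ := ε
  eMm _ := ε⁻¹
  eMv1 _ := ε
  eMv2 m := θ m
  -- The parameters set to `ε⁻¹` enter `Kw5` and `Kw6` only in denominators. The value `(√γ_m)⁻¹`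
  -- balances `Kw5` against `Kw6` so as to produce `cgap` and `gap`.
  eM m i k _ s := if s = 0 then ε⁻¹ else if k = 0 then ε⁻¹ else if i = 0 then (√(M.γ m))⁻¹ else 1
  eN11 _ := ε
  eN12 _ := ε
  eN21 _ := ε
  eN22 _ := ε
  a := ⟨fun _ => 1, fun _ => 1, fun _ _ => 1, fun _ _ _ _ => 1, fun _ _ _ _ => 1⟩
  b := ⟨fun _ => ε, fun _ => ε, fun _ _ => ε, fun _ _ _ _ => ε, fun _ _ _ _ => ε⟩

variable {M} {θ : Solid n → ℝ}

theorem young_pos (h5 : M.PseudoParabolic) (hθ : ∀ m, 0 < θ m) {ε : ℝ} (hε : 0 < ε) :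
    (M.young θ ε).Pos := by
  have hi : 0 < ε⁻¹ := inv_pos.2 hε
  refine ⟨fun _ => one_pos, fun _ => hε, fun _ => hi, fun m => cgap_pos h5 m, fun _ => one_pos,
    fun _ => hε, fun _ => hi, fun _ => hε, hθ, fun m i k j s => ?_, fun _ => hε, fun _ => hε,
    fun _ => hε, fun _ => hε,
    ⟨fun _ => one_pos, fun _ => one_pos, fun _ _ => one_pos, fun _ _ _ _ => one_pos,
      fun _ _ _ _ => one_pos⟩,
    ⟨fun _ => hε, fun _ => hε, fun _ _ => hε, fun _ _ _ _ => hε, fun _ _ _ _ => hε⟩⟩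
  have := Real.sqrt_pos.2 (M.γ_pos m)
  simp only [young]
  split_ifs <;> positivity

/-- Also valid at `ε = 0`, where both sides vanish by the conventions for division by zero. Hence
the constants below are continuous at `ε = 0` and can be evaluated there, although the parameters
themselves degenerate. -/
theorem div_two_mul_inv (x ε : ℝ) : x / (2 * ε⁻¹) = x * ε / 2 := by
  rw [div_mul_eq_div_div, div_inv_eq_mul]; ring

theorem Kw5_young (ε : ℝ) (m : Solid n) : M.Kw5 (M.young θ ε) m
    = 3 * ε / 2 + M.cgap m / 2
      + ∑ j, (M.Mc j 0 1 m ^ 2 * ε / 2 + M.Mc j 0 1 m / (2 * √(M.γ j))) := by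
  simp only [Kw5, young, if_true, one_ne_zero, if_false, div_two_mul_inv]
  have : ∀ j : Solid n, M.Mc j 0 1 m / 2 * (√(M.γ j))⁻¹ = M.Mc j 0 1 m / (2 * √(M.γ j)) := fun j => by
    rw [← div_eq_mul_inv, div_div]
  simp only [this]
  ring

theorem Kw6_young (ε : ℝ) (m : Solid n) : M.Kw6 (M.young θ ε) m
    = ε / 2 + M.Mmm m ^ 2 * ε / 2 + M.Mv m ^ 2 / (2 * θ m)
      + (∑ j, (M.Mc m 0 1 j * √(M.γ m) / 2 + ∑ i, M.Mc m i 0 j * ε / 2))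
      + ∑ j, (M.Mc j 1 1 m ^ 2 * ε / 2 + M.Mc m 1 1 j / 2 + M.Mc j 1 1 m / 2) := by
  simp only [Kw6, young, if_true, one_ne_zero, if_false, div_two_mul_inv, mul_one]

theorem Kw78_young (ε : ℝ) : M.Kw78 (M.young θ ε)
    = (∑ m, (M.F m).bd ^ 2 / 2 * (ε + 1 / M.cgap m))
      + ∑ m, (ε / 2 + ε / 2 + ε / 2 + θ m / 2) := by
  simp only [Kw78, Kw7, Kw8, young, one_div, inv_inv]

theorem Kb2_young (ε : ℝ) (l : Ind n) : M.Kb2 (M.young θ ε) l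
    = ε + ε + (∑ _m : Solid n, (ε + ε + ε + ε))
      + 2 * ∑ _k : Ind n, (ε + ∑ _j : Solid n, (ε + ε)) := by
  simp only [Kb2, young]

theorem gB_add_gC_pos {η : Young n} (hη : η.Pos) : 0 < M.gB η + M.gC η := by
  have h1 : 0 < M.gB η := by
    refine mul_pos two_pos (lt_of_lt_of_le ?_ (le_ciSup (f := fun m =>
      max (M.Kw1 η m) (M.Kw2 η m / (M.γ m + M.D m))) (Finite.bddAbove_range _) 0))
    refine lt_max_of_lt_left ?_
    have := hη.1 0; have := hη.2.2.1 0
    unfold Kw1; positivity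
  have h2 : 0 ≤ M.gC η := by
    refine mul_nonneg two_pos.le (Real.iSup_nonneg fun m => le_max_of_le_left ?_)
    refine Finset.sum_nonneg fun j _ => ?_
    have h3 := hη.2.2.2.2.2.2.2.2.2.1
    have h4 := h3 j 0 0 m 0
    have h5 := h3 j 0 0 m 1
    have h6 : 0 < M.Mc j 0 0 m := by simp only [Mc, Mi0, if_true]; exact (M.E0 j 0 m).bd_pos
    positivity
  linarith

/-- Existence of admissible Young parameters. -/
theorem exists_admissible (hΓ : 0 < M.Γmin) (h5 : M.PseudoParabolic) (h9 : M.VelocityCoupling) :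
    ∃ η : Young n, M.Admissible η := by
  obtain ⟨θ, hθ, hgap, hsmall⟩ := h9
  have c5 : ∀ m, Continuous fun ε => M.Kw5 (M.young θ ε) m := fun m => by
    simp only [Kw5_young]; fun_prop
  have c6 : ∀ m, Continuous fun ε => M.Kw6 (M.young θ ε) m := fun m => by
    simp only [Kw6_young]; fun_prop
  have c78 : Continuous fun ε => M.Kw78 (M.young θ ε) := by
    simp only [Kw78_young]; fun_prop
  have cb2 : ∀ l : Ind n, Continuous fun ε => M.δ l * M.Kb2 (M.young θ ε) l := fun l => by
    simp only [Kb2_young]; fun_prop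
  -- At `ε = 0` the constant equals `1 - cgap / 2`.
  have z5 : ∀ m, M.Kw5 (M.young θ 0) m < 1 := fun m => by
    rw [Kw5_young]
    have := cgap_pos h5 m
    have e : M.cgap m = 1 - ∑ j, M.Mc j 0 1 m / (2 * √(M.γ j)) := rfl
    simp only [mul_zero, zero_div, zero_add]
    linarith
  have z6 : ∀ m, M.γ m - M.Kw6 (M.young θ 0) m = M.gap θ m := fun m => by
    rw [Kw6_young, gap]
    simp only [mul_zero, zero_div, zero_add, add_zero, Finset.sum_const_zero,
      Finset.sum_add_distrib]
    ring
  have z6' : ∀ m, M.Kw6 (M.young θ 0) m < M.γ m := fun m => by linarith [z6 m, hgap m]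
  set κ0 := ∑ m, ((M.F m).bd ^ 2 / M.cgap m + θ m / 2) with hκ0
  have hterm : ∀ m, 0 ≤ (M.F m).bd ^ 2 / M.cgap m + θ m / 2 := fun m => by
    have := cgap_pos h5 m; have := hθ m; positivity
  have hκ0nn : 0 ≤ κ0 := Finset.sum_nonneg fun m _ => hterm m
  have z78 : M.Kw78 (M.young θ 0) ≤ κ0 := by
    rw [Kw78_young, ← Finset.sum_add_distrib]
    refine Finset.sum_le_sum fun m _ => ?_
    have : 0 ≤ (M.F m).bd ^ 2 / M.cgap m := div_nonneg (sq_nonneg _) (cgap_pos h5 m).le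
    have e : (M.F m).bd ^ 2 / 2 * (0 + 1 / M.cgap m) = (M.F m).bd ^ 2 / M.cgap m / 2 := by ring
    rw [e]; linarith
  set hm : ℝ := ⨆ m, (M.H 1 m).bd ^ 2 / M.gap θ m with hhm
  have hd := M.one_le_dR_sub_one
  have hpre : 0 ≤ (4 * M.dR - 2) / M.Γmin ^ 2 := div_nonneg (by linarith) (sq_nonneg _)
  have zQ : ∀ m, (4 * M.dR - 2) / M.Γmin ^ 2 * ((M.H 1 m).bd ^ 2 / (M.γ m - M.Kw6 (M.young θ 0) m))
      * M.Kw78 (M.young θ 0) < 1 := fun m => by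
    rw [z6]
    have e1 : (M.H 1 m).bd ^ 2 / M.gap θ m ≤ hm :=
      le_ciSup (f := fun m => (M.H 1 m).bd ^ 2 / M.gap θ m) (Finite.bddAbove_range _) m
    have e0 : 0 ≤ (M.H 1 m).bd ^ 2 / M.gap θ m := div_nonneg (sq_nonneg _) (hgap m).le
    have hm0 := e0.trans e1
    have e2 : (4 * M.dR - 2) / M.Γmin ^ 2 * ((M.H 1 m).bd ^ 2 / M.gap θ m) * M.Kw78 (M.young θ 0)
        ≤ (4 * M.dR - 2) / M.Γmin ^ 2 * hm * κ0 :=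
      (mul_le_mul_of_nonneg_left z78 (mul_nonneg hpre e0)).trans
        (mul_le_mul_of_nonneg_right (mul_le_mul_of_nonneg_left e1 hpre) hκ0nn)
    have e3 : (4 * M.dR - 2) / M.Γmin ^ 2 * hm * κ0
        = (4 * M.dR - 2) * (κ0 * hm / M.Γmin ^ 2) := by ring
    have e4 : (M.dR - 1 / 2) * (M.dR + 3) / M.Γmin ^ 2 * κ0 * hm
        = (M.dR - 1 / 2) * (M.dR + 3) * (κ0 * hm / M.Γmin ^ 2) := by ring
    have e5 : (M.dR - 1 / 2) * (M.dR + 3) / M.Γmin ^ 2 * κ0 * hm < 1 := hsmall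
    -- The left side is `4 (d - 1/2)`, and `4 ≤ d + 3`; so (9) already implies `Q₁ < 1` in the
    -- limit.
    have e6 : 4 * M.dR - 2 ≤ (M.dR - 1 / 2) * (M.dR + 3) := by nlinarith
    have e7 : 0 ≤ κ0 * hm / M.Γmin ^ 2 := by positivity
    have e8 := mul_le_mul_of_nonneg_right e6 e7
    linarith
  have cQ : ∀ m, ContinuousAt (fun ε => (4 * M.dR - 2) / M.Γmin ^ 2
      * ((M.H 1 m).bd ^ 2 / (M.γ m - M.Kw6 (M.young θ ε) m)) * M.Kw78 (M.young θ ε)) 0 := fun m =>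
    (continuousAt_const.mul (continuousAt_const.div (continuous_const.sub (c6 m)).continuousAt
      (((z6 m).trans_ne (hgap m).ne')))).mul c78.continuousAt
  have hev : ∀ᶠ ε in 𝓝 (0 : ℝ), (∀ m, M.Kw5 (M.young θ ε) m < 1) ∧
      (∀ m, M.Kw6 (M.young θ ε) m < M.γ m) ∧ (∀ l : Ind n, M.δ l * M.Kb2 (M.young θ ε) l < 2) ∧
      ∀ m, (4 * M.dR - 2) / M.Γmin ^ 2
        * ((M.H 1 m).bd ^ 2 / (M.γ m - M.Kw6 (M.young θ ε) m)) * M.Kw78 (M.young θ ε) < 1 :=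
    (eventually_all.2 fun m => ((c5 m).tendsto 0).eventually_lt_const (z5 m)).and
      ((eventually_all.2 fun m => ((c6 m).tendsto 0).eventually_lt_const (z6' m)).and
        ((eventually_all.2 fun l => ((cb2 l).tendsto 0).eventually_lt_const
          (by simp [Kb2_young])).and
          (eventually_all.2 fun m => (cQ m).tendsto.eventually_lt_const (zQ m))))
  obtain ⟨ε, hε, hεpos⟩ := ((hev.filter_mono nhdsWithin_le_nhds).and
    (self_mem_nhdsWithin : Ioi (0 : ℝ) ∈ 𝓝[>] (0 : ℝ))).exists
  have hpos := young_pos h5 hθ (M := M) hεpos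
  refine ⟨M.young θ ε, hpos, hε.1, hε.2.1, hε.2.2.1, gB_add_gC_pos hpos, ?_⟩
  -- The supremum over finitely many solids is attained, which reduces the strict bound to
  -- individual indices.
  obtain ⟨m, hmax⟩ := exists_eq_ciSup_of_finite
    (f := fun m => (M.H 1 m).bd ^ 2 / (M.γ m - M.Kw6 (M.young θ ε) m))
  rw [Q1, ← hmax]
  exact hε.2.2.2 m

end Model

end Rothe

/-! ### Assembly of the theorem. -/

theorem mainTheorem2 {n : ℕ} (M : Rothe.Model n)
    (h1 : M.Reservoirs) (h4 : M.Nondegenerate) (h5 : M.PseudoParabolic)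
    (h7 : M.InitialFractions) (h9 : M.VelocityCoupling) :
    (∃ η : Rothe.Young n, M.Admissible η) ∧
    (∃ v0 : ℝ → ℝ, M.IsInitialVelocity v0) ∧
    ∀ (η : Rothe.Young n) (v0 : ℝ → ℝ) (H : ℝ), M.Admissible η → M.IsInitialVelocity v0 →
      0 < H → M.StepBound η (Rothe.l2sq (Rothe.dz v0)) H →
      ∃ T V C : ℝ, 0 < C ∧
        (T - M.t0, V) ∈ M.regionS η ∩ M.regionR η (Rothe.l2sq (Rothe.dz v0)) H ∧
        ∀ τ ∈ Set.Ioo 0 H,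
          ∃ (φ : ℕ → Rothe.Comp n → ℝ → ℝ) (w : ℕ → Rothe.Solid n → ℝ → ℝ) (v : ℕ → ℝ → ℝ)
            (W : ℕ → ℝ), M.IsSolution τ T v0 φ w v W ∧
            ∀ k : ℕ, M.t0 + (k : ℝ) * τ ≤ T →
              (∑ j ∈ Finset.range (k + 1), Rothe.l2sq (v j) * τ ≤ V ^ 2) ∧
              (∑ j ∈ Finset.range (k + 1), Rothe.l2sq (Rothe.dz (v j)) * τ ≤ V ^ 2) ∧
              (∀ l, ∀ z ∈ Set.Icc (0 : ℝ) 1,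
                φ k l z ∈ Set.Icc M.φmin (1 - (M.dR - 1) * M.φmin)) ∧
              (∀ l, Real.sqrt (Rothe.h1sq (φ k l)) ≤ C) ∧
              (∀ l, ∑ j ∈ Finset.Icc 1 k, Rothe.h2sq (φ j l) * τ ≤ C) ∧
              (∀ l, ∑ j ∈ Finset.Icc 1 k,
                Rothe.l2sq (fun z => (φ j l z - φ (j - 1) l z) / τ) * τ ≤ C) ∧
              (∀ m, Real.sqrt (Rothe.h2sq (w k m)) ≤ C) ∧
              (∀ m, ∑ j ∈ Finset.Icc 1 k,
                Rothe.h1sq (fun z => (w j m z - w (j - 1) m z) / τ) * τ ≤ C) := by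
  have hΓ := Rothe.Model.Γmin_pos h4 h7
  refine ⟨Rothe.Model.exists_admissible hΓ h5 h9,
    Rothe.Model.exists_initialVelocity h4 h5 h7 h9, ?_⟩
  intro η v0 H hη hv0 hH hstep
  obtain ⟨-, -, -, hv0H, -, -, -, -, hv00, -⟩ := hv0
  have hQ0 : Rothe.l2sq (Rothe.dz v0) = Rothe.nrm (Rothe.dz v0) ^ 2 := Rothe.l2sq_eq hv0H.2
  have hQ0nn : 0 ≤ Rothe.l2sq (Rothe.dz v0) := by rw [hQ0]; positivity
  -- Poincaré's inequality with constant `1`, as `v0` vanishes at `0`; it lets both velocity sums be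
  -- treated alike.
  have hv0le : Rothe.l2sq v0 ≤ Rothe.l2sq (Rothe.dz v0) := by
    rw [hQ0, Rothe.l2sq_eq hv0H.memLp]
    refine pow_le_pow_left₀ (Rothe.nrm_nonneg _) ?_ 2
    have := hv0H.nrm_le
    rwa [Rothe.hnrm, hv00, abs_zero, zero_add] at this
  obtain ⟨V, x1, hV, hx1, hQV, hreg⟩ :=
    Rothe.Model.exists_velocity_bound hη hΓ hQ0nn hH.le hstep
  obtain ⟨x0, V', C, hx0, hV', hC, hsol⟩ :=
    Rothe.Model.exists_local_solution h1 h4 h5 h7 h9 hv0H hv00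
  -- The bound `V'` for the velocity at each single time may exceed `V`; the last entry makes the
  -- interval short enough for the time sums to stay below `V²`.
  set x : ℝ := min x0 (min (x1 / 2) (V ^ 2 / (2 * (V' ^ 2 + 1)))) with hx
  have hxpos : 0 < x := by positivity
  have hxx0 : x ≤ x0 := min_le_left _ _
  have hxx1 : x < x1 := by
    have : x ≤ x1 / 2 := (min_le_right _ _).trans (min_le_left _ _)
    linarith
  have hxV : 2 * x * V' ^ 2 ≤ V ^ 2 := by
    have : x ≤ V ^ 2 / (2 * (V' ^ 2 + 1)) := (min_le_right _ _).trans (min_le_right _ _)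
    rw [le_div_iff₀ (by positivity)] at this
    linarith
  refine ⟨M.t0 + x, V, C, hC, by rw [add_sub_cancel_left]; exact hreg x hxpos hxx1, ?_⟩
  rintro τ ⟨hτ, hτH⟩
  obtain ⟨φ, w, v, W, hIs, hb⟩ := hsol x τ hxpos.le hxx0 hτ
  refine ⟨φ, w, v, W, hIs, fun k hk => ?_⟩
  have hkx : (k : ℝ) * τ ≤ x := by linarith
  have hsum : ∀ f : ℕ → ℝ, f 0 ≤ Rothe.l2sq (Rothe.dz v0) → (∀ j ≤ k, f j ≤ V' ^ 2) →
      ∑ j ∈ Finset.range (k + 1), f j * τ ≤ V ^ 2 := by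
    intro f hf0 hf
    -- The sum has `k + 1` terms. For `k ≥ 1` the extra one is harmless because `τ ≤ k τ ≤ x`. For
    -- `k = 0` the step may exceed the whole interval, and only here `τ < H` enters: the single term
    -- is at most `Q₀H < V²`.
    rcases Nat.eq_zero_or_pos k with rfl | hkpos
    · rw [Finset.sum_range_one]
      have h1 := mul_le_mul hf0 hτH.le hτ.le hQ0nn
      linarith
    · have hk1 : (1 : ℝ) ≤ k := by exact_mod_cast hkpos
      have hτx : τ ≤ k * τ := le_mul_of_one_le_left hτ.le hk1
      calc ∑ j ∈ Finset.range (k + 1), f j * τ ≤ ∑ _j ∈ Finset.range (k + 1), V' ^ 2 * τ :=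
            Finset.sum_le_sum fun j hj => mul_le_mul_of_nonneg_right
              (hf j (Nat.lt_succ_iff.1 (Finset.mem_range.1 hj))) hτ.le
        _ = V' ^ 2 * (k * τ + τ) := by
            rw [Finset.sum_const, Finset.card_range, nsmul_eq_mul]; push_cast; ring
        _ ≤ V' ^ 2 * (2 * x) := by gcongr; linarith
        _ ≤ V ^ 2 := by linarith
  have hle : ∀ j ≤ k, (j : ℝ) * τ ≤ x := fun j hj =>
    (mul_le_mul_of_nonneg_right (Nat.cast_le.2 hj) hτ.le).trans hkx
  exact ⟨hsum _ (by rw [hIs.initv]; exact hv0le) fun j hj => (hb j (hle j hj)).1,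
    hsum _ (by rw [hIs.initv]) fun j hj => (hb j (hle j hj)).2.1, (hb k hkx).2.2⟩
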